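/- Setting. Let $k\ge 0$, $0\le q_1<\dots<q_k<q_{k+1}=1$, and let $x$ be a probability measure on $[0,1]$ whose atoms are exactly $q_1,\dots,q_{k+1}$ and which is carried by them; write $x(q)=x([0,q])$ also for its distribution function and $x_l=x(q_l)$, so that $0<x_1<\dots<x_k<x_{k+1}=1$. (The set of all such $x$, over all $k$, is $\mathcal M_a^{<1}$.) Let $g\in C^1([0,1])$ be strictly increasing with $g(0)=0$, and let $\psi\in C^2(\mathbb R)$ be such that $\psi'$ and $\psi''$ are bounded and $E[e^{\psi(Y)}]<\infty$ for every Gaussian variable $Y$. For $0<m<1$, a REM$(m)$ is a Poisson point process on $(0,\infty)$ with intensity $m\,s^{-m-1}\,ds$, its points being listed in decreasing order $\zeta_1>\zeta_2>\cdots$. For $\alpha=(\alpha_1,\dots,\alpha_k)\in\mathbb N^k$ put $\alpha(l)=(\alpha_1,\dots,\alpha_l)$, $0\le l\le k$. Let $\zeta^{\beta}$ ($\beta\in\mathbb N^{l-1}$, $1\le l\le k$) be independent processes, $\zeta^{\beta}$ being a REM$(x_l)$ for $\beta\in\mathbb N^{l-1}$, and set $$\xi_\alpha=\prod_{l=1}^k\big(\zeta^{\alpha(l-1)}\big)_{\alpha_l},\qquad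 q_{\alpha,\alpha'}=\max\{q_{l+1}:0\le l\le k,\ \alpha(l)=\alpha'(l)\}.$$ The pair $(\xi,Q)$ with $\xi=\{\xi_\alpha\}_{\alpha\in\mathbb N^k}$, $Q=\{q_{\alpha,\alpha'}\}$ is a GREM$(x)$. Let $\kappa=(\kappa_\alpha(r))_{\alpha\in\mathbb N^k,\,r\in[0,1]}$ be a centered Gaussian process, independent of the processes $\zeta^\beta$, with $\mathrm{Cov}(\kappa_\alpha(r),\kappa_{\alpha'}(r'))=g(r\wedge r'\wedge q_{\alpha,\alpha'})$, and denote by $\mathbb E_x$ the expectation over the GREM$(x)$ and $\kappa$. Theorem (The Parisi functional on RPC's). There is a unique function $f_x:[0,1]\times\mathbb R\to\mathbb R$ that is continuous, is $C^2$ in $y$ with $\partial_yf_x$ and $\partial_y^2f_x$ bounded on $[0,1]\times\mathbb R$, and satisfies $$\partial_q f_x(q,y)+\frac{g'(q)}{2}\Big[\partial_y^2f_x(q,y)+x(q)\big(\partial_yf_x(q,y)\big)^2\Big]=0,\qquad f_x(1,y)=\psi(y),$$ the equation being required for all $y\in\mathbb R$ and all $q\in(0,1)$ that are not atoms of $x$.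 Moreover, for every GREM$(x)$ and every field $\kappa$ as above, the sums $\sum_\alpha\xi_\alpha$ and $\sum_\alpha\xi_\alpha e^{\psi(\kappa_\alpha(1))}$ converge almost surely, the random variable $\log\big(\sum_\alpha\xi_\alpha e^{\psi(\kappa_\alpha(1))}/\sum_\alpha\xi_\alpha\big)$ is integrable, and $$\mathbb E_x\left[\log\frac{\sum_{\alpha}\xi_\alpha e^{\psi(\kappa_\alpha(1))}}{\sum_{\alpha}\xi_\alpha}\right]=f_x(0,0).$$ -/

import Mathlib

open MeasureTheory ProbabilityTheory Set

open scoped ENNReal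

noncomputable section

namespace RuelleCascade

/-! ### Finitely supported probability measures on `[0,1]` with an atom at `1` -/

/-- `μ` is a probability measure whose atoms are exactly `q 0 < q 1 < ⋯ < q k = 1`, all of them
in `[0,1]`. (The index `i : Fin (k + 1)` stands for the `(i+1)`-st atom.) -/
structure IsAtomicWithTop (μ : Measure ℝ) {k : ℕ} (q : Fin (k + 1) → ℝ) : Prop where
  isProbabilityMeasure : IsProbabilityMeasure μ
  strictMono : StrictMono q
  nonneg : 0 ≤ q 0
  last_eq_one : q (Fin.last k) = 1
  concentrated : μ (range q)ᶜ = 0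
  atom_pos : ∀ i, 0 < μ {q i}

/-! ### Poisson point processes and the REM -/

/-- The number of points of the sequence `Z` that lie in `A`. -/
def pointCount {Ω : Type*} (Z : ℕ → Ω → ℝ) (A : Set ℝ) (ω : Ω) : ℝ≥0∞ :=
  ∑' j, A.indicator 1 (Z j ω)

/-- The points `Z 0, Z 1, …` form a Poisson point process with intensity measure `Λ`: the number
of points in a Borel set `A` of finite intensity is Poisson distributed with mean `Λ A`, and the
numbers of points in finitely many disjoint Borel sets are independent. -/
structure IsPoissonProcess {Ω : Type*} [MeasurableSpace Ω] (Z : ℕ → Ω → ℝ) (Λ : Measure ℝ)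
    (P : Measure Ω) : Prop where
  measurable : ∀ j, Measurable (Z j)
  hasLaw_count : ∀ A, MeasurableSet A → Λ A ≠ ∞ →
    HasLaw (pointCount Z A) ((poissonMeasure (Λ A).toNNReal).map (Nat.cast : ℕ → ℝ≥0∞)) P
  indep_count : ∀ (n : ℕ) (A : Fin n → Set ℝ), (∀ i, MeasurableSet (A i)) →
    Pairwise (fun i j => Disjoint (A i) (A j)) → iIndepFun (fun i => pointCount Z (A i)) P

/-- The measure `x s^{-x-1} ds` on `(0,∞)`. -/
def remIntensity (x : ℝ) : Measure ℝ :=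
  (volume.restrict (Ioi 0)).withDensity (fun s => ENNReal.ofReal (x * s ^ (-x - 1)))

/-- `ζ` is a REM(`x`): a Poisson point process on `(0,∞)` with intensity `x s^{-x-1} ds`, its
points being enumerated in decreasing order. -/
structure IsREM {Ω : Type*} [MeasurableSpace Ω] (x : ℝ) (ζ : ℕ → Ω → ℝ) (P : Measure Ω) :
    Prop where
  poisson : IsPoissonProcess ζ (remIntensity x) P
  pos : ∀ᵐ ω ∂P, ∀ j, 0 < ζ j ω
  decreasing : ∀ᵐ ω ∂P, StrictAnti (fun j => ζ j ω)

/-! ### The cascade -/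

/-- The truncation `α(l) = (α_1, …, α_l)`. -/
def trunc {k : ℕ} (α : Fin k → ℕ) (l : Fin k) : Fin (l : ℕ) → ℕ :=
  fun i => α (Fin.castLE l.isLt.le i)

/-- The weight `ξ_α = ∏_l (ζ^{α(l-1)})_{α_l}`; for `k = 0` there is one index and its weight
is `1`. Here `ζ l β` is the point process attached to `β ∈ ℕ^l`, for `0 ≤ l < k`. -/
def weight {Ω : Type*} {k : ℕ} (ζ : (l : Fin k) → (Fin (l : ℕ) → ℕ) → ℕ → Ω → ℝ)
    (α : Fin k → ℕ) (ω : Ω) : ℝ :=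
  ∏ l : Fin k, ζ l (trunc α l) (α l) ω

/-- The levels `l ∈ {0, …, k}` such that `α(l) = α'(l)`. -/
def commonLevels {k : ℕ} (α α' : Fin k → ℕ) : Finset (Fin (k + 1)) :=
  Finset.univ.filter (fun l => ∀ i : Fin k, (i : ℕ) < (l : ℕ) → α i = α' i)

theorem commonLevels_nonempty {k : ℕ} (α α' : Fin k → ℕ) : (commonLevels α α').Nonempty :=
  ⟨0, by simp [commonLevels]⟩

/-- The overlap `q_{α,α'} = max {q_{l+1} : α(l) = α'(l)}` (the `(l+1)`-st atom is `q l`). -/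
def overlap {k : ℕ} (q : Fin (k + 1) → ℝ) (α α' : Fin k → ℕ) : ℝ :=
  (commonLevels α α').sup' (commonLevels_nonempty α α') q

/-- `ζ` is a cascade of independent REM's, the ones attached to `ℕ^l` having parameter `x l`. -/
structure IsCascade {Ω : Type*} [MeasurableSpace Ω] {k : ℕ} (x : Fin k → ℝ)
    (ζ : (l : Fin k) → (Fin (l : ℕ) → ℕ) → ℕ → Ω → ℝ) (P : Measure Ω) : Prop where
  isREM : ∀ (l : Fin k) (β : Fin (l : ℕ) → ℕ), IsREM (x l) (ζ l β) P
  indep : iIndepFun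
    (fun (n : (l : Fin k) × (Fin (l : ℕ) → ℕ)) (ω : Ω) (j : ℕ) => ζ n.1 n.2 j ω) P

/-- `κ` is a centered Gaussian process with
`Cov(κ_α(r), κ_{α'}(r')) = g(r ∧ r' ∧ q_{α,α'})`. -/
structure IsCavityField {Ω : Type*} [MeasurableSpace Ω] {k : ℕ} (q : Fin (k + 1) → ℝ)
    (g : ℝ → ℝ) (κ : (Fin k → ℕ) → unitInterval → Ω → ℝ) (P : Measure Ω) : Prop where
  measurable : ∀ α r, Measurable (κ α r)
  gaussian : IsGaussianProcess
    (fun (p : (Fin k → ℕ) × unitInterval) (ω : Ω) => κ p.1 p.2 ω) P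
  centered : ∀ α r, ∫ ω, κ α r ω ∂P = 0
  covariance_eq : ∀ (α α' : Fin k → ℕ) (r r' : unitInterval),
    covariance (κ α r) (κ α' r') P = g (min (min (r : ℝ) (r' : ℝ)) (overlap q α α'))

/-- Under the probability measure `P`, the weights `ξ = weight ζ` with the overlaps
`overlap q` form a GREM(`μ`), where `μ` has its atoms at `q`, and `κ` is a Gaussian field on it
with covariance function `g`, independent of the cascade. The parameter of the REM's at level `l`
is the value of the distribution function of `μ` at the corresponding atom. -/
structure IsGREMWithField {Ω : Type*} [MeasurableSpace Ω] (μ : Measure ℝ) {k : ℕ}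
    (q : Fin (k + 1) → ℝ) (g : ℝ → ℝ)
    (ζ : (l : Fin k) → (Fin (l : ℕ) → ℕ) → ℕ → Ω → ℝ)
    (κ : (Fin k → ℕ) → unitInterval → Ω → ℝ) (P : Measure Ω) : Prop where
  cascade : IsCascade (fun l : Fin k => cdf μ (q l.castSucc)) ζ P
  field : IsCavityField q g κ P
  indep : IndepFun
    (fun (ω : Ω) (n : (l : Fin k) × (Fin (l : ℕ) → ℕ)) (j : ℕ) => ζ n.1 n.2 j ω)
    (fun (ω : Ω) (p : (Fin k → ℕ) × unitInterval) => κ p.1 p.2 ω) P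

/-- The random variable `log (∑_α ξ_α e^{ψ(κ_α(1))} / ∑_α ξ_α)`. -/
def logRatio {Ω : Type*} {k : ℕ} (ψ : ℝ → ℝ)
    (ζ : (l : Fin k) → (Fin (l : ℕ) → ℕ) → ℕ → Ω → ℝ)
    (κ : (Fin k → ℕ) → unitInterval → Ω → ℝ) (ω : Ω) : ℝ :=
  Real.log ((∑' α, weight ζ α ω * Real.exp (ψ (κ α 1 ω))) / ∑' α, weight ζ α ω)

/-! ### The class of functions and the Parisi equation -/

/-- The class of `C²` functions `ψ` with bounded first and second derivatives and with
`E[e^{ψ(Y)}] < ∞` for every Gaussian variable `Y`. -/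
structure IsAdmissible (ψ : ℝ → ℝ) : Prop where
  contDiff : ContDiff ℝ 2 ψ
  deriv_bounded : ∃ K, ∀ y, |deriv ψ y| ≤ K
  deriv_deriv_bounded : ∃ K, ∀ y, |deriv (deriv ψ) y| ≤ K
  integrable_exp : ∀ (m : ℝ) (v : NNReal), Integrable (fun y => Real.exp (ψ y)) (gaussianReal m v)

/-- `f` solves `∂_q f + (g'/2) (∂²_y f + x(q) (∂_y f)²) = 0` on `[0,1] × ℝ` with `f(1,·) = ψ`,
where `x` is the distribution function of `μ`: `f` is continuous, it is `C²` in `y` with first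
and second `y`-derivatives bounded on `[0,1] × ℝ`, and the equation holds at every `q ∈ (0,1)`
that is not an atom of `μ` (at an atom the coefficient `x` jumps). -/
structure IsParisiSolution (μ : Measure ℝ) (g ψ : ℝ → ℝ) (f : ℝ → ℝ → ℝ) : Prop where
  continuousOn : ContinuousOn (fun p : ℝ × ℝ => f p.1 p.2) (Icc 0 1 ×ˢ univ)
  contDiff : ∀ q ∈ Icc (0 : ℝ) 1, ContDiff ℝ 2 (f q)
  deriv_bounded : ∃ K, ∀ q ∈ Icc (0 : ℝ) 1, ∀ y, |deriv (f q) y| ≤ K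
  deriv_deriv_bounded : ∃ K, ∀ q ∈ Icc (0 : ℝ) 1, ∀ y, |deriv (deriv (f q)) y| ≤ K
  equation : ∀ q ∈ Ioo (0 : ℝ) 1, μ {q} = 0 → ∀ y,
    DifferentiableAt ℝ (fun r => f r y) q ∧
      deriv (fun r => f r y) q
        + deriv g q / 2 * (deriv (deriv (f q)) y + cdf μ q * (deriv (f q) y) ^ 2) = 0
  boundary : ∀ y, f 1 y = ψ y

end RuelleCascade

end

open Filter Topology

noncomputable section

namespace RuelleCascade

/-! The cascade side rests on the stability of Poisson processes with power intensity. Multiplying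
the points by `b` multiplies the intensity `m s^{-m-1} ds` by `b^m`, so for `m < p` the sum of `a_j
ζ_j^p` over a REM(`m`) with i.i.d. marks `a_j` has Laplace transform `exp(-C t^{m/p} E[a^{m/p}])`.
For marks `a = e^{pφ(y+D)}`, with `D` a Gaussian increment of the field, `E[a^{m/p}] =
E[e^{mφ(y+D)}]`, which is one Hopf–Cole step. Integrating out the levels from the leaves to the root
(`lintegral_expNeg_cascade_level`, `exists_lintegral_expNeg_levelSum`) turns the Laplace transform
of `S = ∑ ξ_α e^{ψ(κ_α(1))}` into `E exp(-c t^p e^{pF})`, where `p = x_1`, `F = f(q_1, κ(q_1))`, and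
`c` does not depend on `ψ`.

Taking `ψ = 0`, the sum `T = ∑ ξ_α` has transform `exp(-c t^p)` with the same `c`. Hence `S` has the
law of `e^F` times an independent copy of `T`, and `E log S - E log T = E F` once `log T` is
integrable (`integral_log_sub_of_laplace`). On `[0, q_1)` the distribution function `x` vanishes, so
`f(0,0)` is the Gaussian average `E F`.

Existence for the equation uses the same recursion: between consecutive atoms `x` is a constant `m`,
and the Hopf–Cole transform of the heat semigroup run in the time `g(b) - g(r)` solves the equation
(`isHopfColeFlow_log_heat`, `solvesFrom_extendDown`). Uniqueness is a maximum principle on each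
strip between atoms, with a barrier growing quadratically in `y` (`SolvesFrom.le_of_eq_right`).

Sums and Laplace transforms take values in `[0,∞]`, so no convergence is needed beforehand:
finiteness of `S` and `T` is read off from their transforms. -/

/-! ### The function `u ↦ e^{-u}` on `[0,∞]` -/

/-- `e^{-u}` for `u ∈ [0,∞]`. -/
def expNeg (u : ℝ≥0∞) : ℝ≥0∞ := EReal.exp (-(u : EReal))

/-- The inverse of `expNeg` on `[0,1]`. -/
def negLog (v : ℝ≥0∞) : ℝ≥0∞ := (-(ENNReal.log v)).toENNReal

@[simp] theorem expNeg_zero : expNeg 0 = 1 := by simp [expNeg]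

@[simp] theorem expNeg_top : expNeg ∞ = 0 := by simp [expNeg]

theorem expNeg_ofReal {x : ℝ} (hx : 0 ≤ x) :
    expNeg (ENNReal.ofReal x) = ENNReal.ofReal (Real.exp (-x)) := by
  rw [expNeg, EReal.coe_ennreal_ofReal, max_eq_left hx, ← EReal.coe_neg, EReal.exp_coe]

theorem expNeg_eq_toReal {u : ℝ≥0∞} (hu : u ≠ ∞) :
    expNeg u = ENNReal.ofReal (Real.exp (-u.toReal)) := by
  rw [← expNeg_ofReal ENNReal.toReal_nonneg, ENNReal.ofReal_toReal hu]

theorem expNeg_add (u v : ℝ≥0∞) : expNeg (u + v) = expNeg u * expNeg v := by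
  by_cases hu : u = ∞
  · simp [hu]
  by_cases hv : v = ∞
  · simp [hv]
  rw [expNeg_eq_toReal hu, expNeg_eq_toReal hv, expNeg_eq_toReal (by simp [hu, hv]),
    ENNReal.toReal_add hu hv, ← ENNReal.ofReal_mul (Real.exp_pos _).le, ← Real.exp_add]
  congr 2; ring

theorem strictAnti_expNeg : StrictAnti expNeg := fun u v h => by
  rw [expNeg, expNeg, EReal.exp_lt_exp_iff, EReal.neg_lt_neg_iff]
  exact_mod_cast h

theorem expNeg_le_one (u : ℝ≥0∞) : expNeg u ≤ 1 := by
  simpa using strictAnti_expNeg.antitone (bot_le (a := u))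

theorem expNeg_ne_top (u : ℝ≥0∞) : expNeg u ≠ ∞ :=
  ((expNeg_le_one u).trans_lt ENNReal.one_lt_top).ne

theorem continuous_expNeg : Continuous expNeg :=
  ENNReal.continuous_exp.comp (continuous_neg.comp continuous_coe_ennreal_ereal)

@[fun_prop]
theorem measurable_expNeg : Measurable expNeg := continuous_expNeg.measurable

theorem expNeg_sum {ι : Type*} (s : Finset ι) (u : ι → ℝ≥0∞) :
    expNeg (∑ i ∈ s, u i) = ∏ i ∈ s, expNeg (u i) := by
  classical
  induction s using Finset.induction_on with
  | empty => simp
  | insert a s ha ih => rw [Finset.sum_insert ha, Finset.prod_insert ha, expNeg_add, ih]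

theorem expNeg_mul_nat (a : ℝ≥0∞) (n : ℕ) : expNeg (a * n) = expNeg a ^ n := by
  induction n with
  | zero => simp
  | succ n ih => rw [Nat.cast_succ, mul_add, expNeg_add, ih, mul_one, pow_succ]

theorem tendsto_prod_expNeg {ι : Type*} (u : ι → ℝ≥0∞) :
    Tendsto (fun s : Finset ι => ∏ i ∈ s, expNeg (u i)) atTop (𝓝 (expNeg (∑' i, u i))) := by
  simp_rw [← expNeg_sum]
  exact (continuous_expNeg.tendsto _).comp ENNReal.summable.hasSum

@[fun_prop]
theorem measurable_negLog : Measurable negLog :=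
  (ENNReal.measurable_log.neg).ereal_toENNReal

theorem expNeg_negLog {v : ℝ≥0∞} (hv : v ≤ 1) : expNeg (negLog v) = v := by
  have h : 0 ≤ -(ENNReal.log v) := by
    rw [EReal.neg_nonneg]
    simpa using hv
  rw [expNeg, negLog, EReal.coe_toENNReal h, neg_neg, ENNReal.exp_log]

theorem negLog_expNeg (u : ℝ≥0∞) : negLog (expNeg u) = u :=
  strictAnti_expNeg.injective (expNeg_negLog (expNeg_le_one u))

theorem lintegral_expNeg_le_one {Ω : Type*} [MeasurableSpace Ω] (P : Measure Ω)
    [IsProbabilityMeasure P] (f : Ω → ℝ≥0∞) : ∫⁻ ω, expNeg (f ω) ∂P ≤ 1 :=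
  (lintegral_mono fun ω => expNeg_le_one (f ω)).trans (by simp)

/-! ### The Laplace functional of a Poisson process -/

theorem measurable_pointCount {Ω : Type*} [MeasurableSpace Ω] {Z : ℕ → Ω → ℝ}
    (hZ : ∀ j, Measurable (Z j)) {A : Set ℝ} (hA : MeasurableSet A) :
    Measurable (pointCount Z A) := by
  unfold pointCount
  exact Measurable.tsum fun j => (measurable_one.indicator hA).comp (hZ j)

/-- This is the Poisson generating function `E[b^N] = e^{-(1-b)r}` at `b = e^{-a}`; the value `a =
∞`, that is `b = 0`, is allowed. -/
theorem lintegral_expNeg_mul_poisson (a : ℝ≥0∞) (r : NNReal) :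
    ∫⁻ n, expNeg (a * (n : ℝ≥0∞)) ∂(poissonMeasure r) = expNeg ((1 - expNeg a) * r) := by
  set b := (expNeg a).toReal with hb
  have hb0 : 0 ≤ b := ENNReal.toReal_nonneg
  have hba : expNeg a = ENNReal.ofReal b := (ENNReal.ofReal_toReal (expNeg_ne_top a)).symm
  have hb1 : b ≤ 1 := by
    rw [hb]; exact ENNReal.toReal_le_of_le_ofReal zero_le_one (by simpa using expNeg_le_one a)
  have h1 : (1 - expNeg a) * (r : ℝ≥0∞) = ENNReal.ofReal ((1 - b) * r) := by
    rw [ENNReal.ofReal_mul (by linarith), ENNReal.ofReal_sub _ hb0, hba]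
    simp
  rw [h1, expNeg_ofReal (mul_nonneg (by linarith) r.coe_nonneg), lintegral_countable']
  have h2 : ∀ n : ℕ, expNeg (a * (n : ℝ≥0∞)) * (poissonMeasure r) {n}
      = ENNReal.ofReal (Real.exp (-r) * ((b * r) ^ n / n.factorial)) := by
    intro n
    rw [expNeg_mul_nat, hba, poissonMeasure_singleton, ← ENNReal.ofReal_pow hb0,
      ← ENNReal.ofReal_mul (by positivity)]
    congr 1
    rw [mul_pow]; ring
  simp_rw [h2]
  have h3 : HasSum (fun n : ℕ => Real.exp (-r) * ((b * r) ^ n / n.factorial))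
      (Real.exp (-r) * Real.exp (b * r)) := by
    refine HasSum.mul_left _ ?_
    rw [Real.exp_eq_exp_ℝ]
    exact NormedSpace.expSeries_div_hasSum_exp (b * r : ℝ)
  rw [← ENNReal.ofReal_tsum_of_nonneg (fun n => by positivity) h3.summable, h3.tsum_eq,
    ← Real.exp_add]
  congr 2; ring

/-- The conditional hypothesis lets `a = 0` go with a set of infinite intensity, as happens for the
zero fibre of a test function. -/
theorem IsPoissonProcess.lintegral_expNeg_mul_pointCount {Ω : Type*} [MeasurableSpace Ω]
    {P : Measure Ω} [IsProbabilityMeasure P]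
    {Z : ℕ → Ω → ℝ} {Λ : Measure ℝ} (hZ : IsPoissonProcess Z Λ P) {A : Set ℝ}
    (hA : MeasurableSet A) {a : ℝ≥0∞} (h : a ≠ 0 → Λ A ≠ ∞) :
    ∫⁻ ω, expNeg (a * pointCount Z A ω) ∂P = expNeg ((1 - expNeg a) * Λ A) := by
  by_cases ha : a = 0
  · simp [ha]
  have hL := hZ.hasLaw_count A hA (h ha)
  rw [hL.lintegral_comp (f := fun n => expNeg (a * n)) (by fun_prop),
    lintegral_map (by fun_prop) (by fun_prop), lintegral_expNeg_mul_poisson,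
    ENNReal.coe_toNNReal (h ha)]

/-- The sum is a finite linear combination of the counts in the fibres of `φ`. These are disjoint,
so the counts are independent and the transform factors into one-set transforms. -/
theorem IsPoissonProcess.laplace_simpleFunc {Ω : Type*} [MeasurableSpace Ω]
    {P : Measure Ω} [IsProbabilityMeasure P]
    {Z : ℕ → Ω → ℝ} {Λ : Measure ℝ} (hZ : IsPoissonProcess Z Λ P)
    (φ : SimpleFunc ℝ ℝ≥0∞) (hφ : ∀ a ≠ 0, Λ (φ ⁻¹' {a}) ≠ ∞) :
    ∫⁻ ω, expNeg (∑' j, φ (Z j ω)) ∂P = expNeg (∫⁻ s, (1 - expNeg (φ s)) ∂Λ) := by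
  set n := φ.range.card
  let e : Fin n ≃ φ.range := φ.range.equivFin.symm
  let A : Fin n → Set ℝ := fun i => φ ⁻¹' {(e i : ℝ≥0∞)}
  have hA : ∀ i, MeasurableSet (A i) := fun i => φ.measurableSet_fiber _
  have hdisj : Pairwise (fun i j => Disjoint (A i) (A j)) := fun i j hij => by
    refine Disjoint.preimage _ (Set.disjoint_singleton.2 fun h => hij ?_)
    exact e.injective (Subtype.ext h)
  have hind := hZ.indep_count n A hA hdisj
  have hcomp : ∀ s, φ s = ∑ i, (e i : ℝ≥0∞) * (A i).indicator 1 s := fun s => by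
    let i₀ := e.symm ⟨φ s, φ.mem_range_self s⟩
    have hi₀ : (e i₀ : ℝ≥0∞) = φ s := by simp [i₀]
    rw [Finset.sum_eq_single i₀]
    · rw [Set.indicator_of_mem (by simp [A, hi₀]), hi₀]; simp
    · intro i _ hi
      rw [Set.indicator_of_notMem, mul_zero]
      intro hs
      apply hi
      apply e.injective
      apply Subtype.ext
      rw [hi₀]; exact hs.symm
    · simp
  have hsum : ∀ ω, ∑' j, φ (Z j ω) = ∑ i, (e i : ℝ≥0∞) * pointCount Z (A i) ω := fun ω => by
    simp_rw [hcomp]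
    rw [Summable.tsum_finsetSum fun i _ => ENNReal.summable]
    exact Finset.sum_congr rfl fun i _ => ENNReal.tsum_mul_left
  have hint : ∫⁻ s, (1 - expNeg (φ s)) ∂Λ = ∑ i, (1 - expNeg (e i)) * Λ (A i) := by
    have h := SimpleFunc.lintegral_eq_lintegral (φ.map fun a => 1 - expNeg a) Λ
    rw [SimpleFunc.map_lintegral] at h
    simp only [SimpleFunc.coe_map, Function.comp_apply] at h
    rw [h, ← Finset.sum_coe_sort, ← e.sum_comp]
  simp_rw [hsum, hint, expNeg_sum]
  have hc := hind.comp (fun i x => expNeg ((e i : ℝ≥0∞) * x)) (fun i => by fun_prop)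
  have := lintegral_prod_eq_prod_lintegral_of_indepFun Finset.univ _ hc (fun i => by
    exact measurable_expNeg.comp ((measurable_pointCount hZ.measurable (hA i)).const_mul _))
  simp only [Function.comp_apply] at this
  rw [this]
  refine Finset.prod_congr rfl fun i _ => ?_
  exact hZ.lintegral_expNeg_mul_pointCount (hA i) (fun h => hφ _ h)

theorem IsPoissonProcess.laplace {Ω : Type*} [MeasurableSpace Ω]
    {P : Measure Ω} [IsProbabilityMeasure P]
    {Z : ℕ → Ω → ℝ} {Λ : Measure ℝ} [SigmaFinite Λ] (hZ : IsPoissonProcess Z Λ P)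
    {φ : ℝ → ℝ≥0∞} (hφ : Measurable φ) :
    ∫⁻ ω, expNeg (∑' j, φ (Z j ω)) ∂P = expNeg (∫⁻ s, (1 - expNeg (φ s)) ∂Λ) := by
  -- Simple approximations cut off to spanning sets: their nonzero fibres have finite intensity, and
  -- they still increase to `φ`.
  let φn : ℕ → SimpleFunc ℝ ℝ≥0∞ := fun n => (SimpleFunc.eapprox φ n).restrict (spanningSets Λ n)
  have hval : ∀ n s, φn n s = (spanningSets Λ n).indicator (SimpleFunc.eapprox φ n) s := fun n s =>
    SimpleFunc.restrict_apply _ (measurableSet_spanningSets Λ n) s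
  have hmono : ∀ s, Monotone fun n => φn n s := fun s a b hab => by
    simp only [hval]
    refine (Set.indicator_le_indicator_of_subset (monotone_spanningSets Λ hab)
      (fun _ => bot_le) s).trans (Set.indicator_le_indicator ?_)
    exact SimpleFunc.monotone_eapprox φ hab s
  have hlim : ∀ s, Tendsto (fun n => φn n s) atTop (𝓝 (φ s)) := fun s => by
    have h1 : Tendsto (fun n => SimpleFunc.eapprox φ n s) atTop (𝓝 (φ s)) := by
      rw [← SimpleFunc.iSup_eapprox_apply hφ s]
      exact tendsto_atTop_iSup fun a b hab => SimpleFunc.monotone_eapprox φ hab s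
    refine h1.congr' ?_
    filter_upwards [eventually_ge_atTop (spanningSetsIndex Λ s)] with n hn
    rw [hval, Set.indicator_of_mem]
    exact monotone_spanningSets Λ hn (mem_spanningSetsIndex Λ s)
  have hfin : ∀ n, ∀ a ≠ 0, Λ (φn n ⁻¹' {a}) ≠ ∞ := fun n a ha => by
    refine ne_top_of_le_ne_top (measure_spanningSets_lt_top Λ n).ne (measure_mono fun s hs => ?_)
    by_contra hns
    simp only [mem_preimage, hval, Set.indicator_of_notMem hns, mem_singleton_iff] at hs
    exact ha hs.symm
  have hsum : ∀ ω, Tendsto (fun n => ∑' j, φn n (Z j ω)) atTop (𝓝 (∑' j, φ (Z j ω))) := fun ω => by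
    simp_rw [← lintegral_count]
    refine lintegral_tendsto_of_tendsto_of_monotone (fun n => by fun_prop) ?_ ?_
    · exact ae_of_all _ fun j => hmono _
    · exact ae_of_all _ fun j => hlim _
  have hL : Tendsto (fun n => ∫⁻ ω, expNeg (∑' j, φn n (Z j ω)) ∂P) atTop
      (𝓝 (∫⁻ ω, expNeg (∑' j, φ (Z j ω)) ∂P)) := by
    refine tendsto_lintegral_of_dominated_convergence (fun _ => 1) (fun n => ?_)
      (fun n => ae_of_all _ fun ω => expNeg_le_one _) (by simp) (ae_of_all _ fun ω => ?_)
    · exact measurable_expNeg.comp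
        (Measurable.tsum fun j => (φn n).measurable.comp (hZ.measurable j))
    · exact (continuous_expNeg.tendsto _).comp (hsum ω)
  have hR : Tendsto (fun n => ∫⁻ s, (1 - expNeg (φn n s)) ∂Λ) atTop
      (𝓝 (∫⁻ s, (1 - expNeg (φ s)) ∂Λ)) := by
    refine lintegral_tendsto_of_tendsto_of_monotone (fun n => ?_) ?_ ?_
    · exact (measurable_const.sub (measurable_expNeg.comp (φn n).measurable)).aemeasurable
    · exact ae_of_all _ fun s a b hab =>
        tsub_le_tsub_left (strictAnti_expNeg.antitone (hmono s hab)) _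
    · refine ae_of_all _ fun s => ENNReal.Tendsto.sub tendsto_const_nhds
        ((continuous_expNeg.tendsto _).comp (hlim s)) (Or.inl (by simp))
  refine tendsto_nhds_unique hL ?_
  simp_rw [fun n => hZ.laplace_simpleFunc (φn n) (hfin n)]
  exact (continuous_expNeg.tendsto _).comp hR

/-! ### The intensity measure `m s^{-m-1} ds` -/

instance sigmaFinite_remIntensity (m : ℝ) : SigmaFinite (remIntensity m) := by
  unfold remIntensity
  exact SigmaFinite.withDensity_ofReal _

theorem lintegral_remIntensity (m : ℝ) {F : ℝ → ℝ≥0∞} (hF : Measurable F) :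
    ∫⁻ s, F s ∂remIntensity m
      = ∫⁻ s in Ioi 0, ENNReal.ofReal (m * s ^ (-m - 1)) * F s := by
  rw [remIntensity, lintegral_withDensity_eq_lintegral_mul _ (by fun_prop) hF]
  rfl

/-- The scaling property behind stability: the substitution `s ↦ b s` turns the power density into
`b^m` times itself. -/
theorem lintegral_remIntensity_comp_mul (m : ℝ) {b : ℝ} (hb : 0 < b) {F : ℝ → ℝ≥0∞}
    (hF : Measurable F) :
    ∫⁻ s, F (b * s) ∂remIntensity m = ENNReal.ofReal (b ^ m) * ∫⁻ s, F s ∂remIntensity m := by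
  rw [lintegral_remIntensity m hF, lintegral_remIntensity m (F := fun s => F (b * s))
    (by fun_prop), ← lintegral_indicator measurableSet_Ioi, ← lintegral_indicator measurableSet_Ioi]
  conv_rhs => rw [← Real.smul_map_volume_mul_left hb.ne']
  have hmeas : Measurable ((Ioi (0 : ℝ)).indicator
      fun s => ENNReal.ofReal (m * s ^ (-m - 1)) * F s) :=
    Measurable.indicator (by fun_prop) measurableSet_Ioi
  rw [lintegral_smul_measure, lintegral_map hmeas (by fun_prop), smul_eq_mul, ← mul_assoc,
    ← ENNReal.ofReal_mul (by positivity), ← lintegral_const_mul _ (show Measurable fun s : ℝ => (Ioi (0 : ℝ)).indicator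
      (fun s => ENNReal.ofReal (m * s ^ (-m - 1)) * F s) (b * s) from
        hmeas.comp (measurable_const_mul b))]
  refine lintegral_congr fun s => ?_
  by_cases hs : 0 < s
  · rw [indicator_of_mem (mem_Ioi.2 hs), indicator_of_mem (mem_Ioi.2 (mul_pos hb hs)), ← mul_assoc,
      ← ENNReal.ofReal_mul (by positivity)]
    congr 2
    rw [Real.mul_rpow hb.le hs.le, abs_of_pos hb]
    have : b ^ m * b * b ^ (-m - 1) = 1 := by
      rw [← Real.rpow_add_one hb.ne', ← Real.rpow_add hb]; simp
    linear_combination (-(m * s ^ (-m - 1))) * this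
  · rw [indicator_of_notMem (by simpa using hs), indicator_of_notMem, mul_zero]
    simpa using not_lt.1 (fun h => hs ((mul_pos_iff_of_pos_left hb).1 h))

/-- The constant `∫ (1 - e^{-s^p}) m s^{-m-1} ds`. -/
def stableConst (m p : ℝ) : ℝ≥0∞ :=
  ∫⁻ s, (1 - expNeg (ENNReal.ofReal s ^ p)) ∂remIntensity m

/-- Since `a s^p = (a^{1/p} s)^p`, scaling extracts the factor `(a^{1/p})^m`. -/
theorem lintegral_one_sub_expNeg_remIntensity {m p : ℝ} (hm : 0 < m) (hp : 0 < p) {a : ℝ≥0∞}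
    (ha : a ≠ ∞) :
    ∫⁻ s, (1 - expNeg (a * ENNReal.ofReal s ^ p)) ∂remIntensity m
      = stableConst m p * a ^ (m / p) := by
  by_cases ha0 : a = 0
  · simp [ha0, ENNReal.zero_rpow_of_pos (div_pos hm hp)]
  have hap : 0 < a.toReal := ENNReal.toReal_pos ha0 ha
  have hb : 0 < a.toReal ^ (1 / p) := Real.rpow_pos_of_pos hap _
  have h1 : ∀ s : ℝ, a * ENNReal.ofReal s ^ p
      = ENNReal.ofReal (a.toReal ^ (1 / p) * s) ^ p := fun s => by
    rw [ENNReal.ofReal_mul hb.le, ENNReal.mul_rpow_of_nonneg _ _ hp.le,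
      ENNReal.ofReal_rpow_of_pos hb, ← Real.rpow_mul hap.le, one_div_mul_cancel hp.ne',
      Real.rpow_one, ENNReal.ofReal_toReal ha]
  simp_rw [h1]
  rw [lintegral_remIntensity_comp_mul m hb
    (F := fun s => 1 - expNeg (ENNReal.ofReal s ^ p)) (by fun_prop), mul_comm, stableConst,
    ← Real.rpow_mul hap.le, ← ENNReal.ofReal_rpow_of_pos hap, ENNReal.ofReal_toReal ha,
    one_div_mul_eq_div]

theorem one_sub_expNeg_le (u : ℝ≥0∞) : 1 - expNeg u ≤ u := by
  by_cases hu : u = ∞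
  · simp [hu]
  rw [expNeg_eq_toReal hu, ← ENNReal.ofReal_one, ← ENNReal.ofReal_sub _ (Real.exp_pos _).le]
  conv_rhs => rw [← ENNReal.ofReal_toReal hu]
  exact ENNReal.ofReal_le_ofReal (by linarith [Real.add_one_le_exp (-u.toReal)])

/-- Near `0` the bound `1 - e^{-u} ≤ u` leaves `s^{p-m-1}`, integrable because `m < p`; near
infinity the tail `s^{-m-1}` is integrable because `0 < m`. -/
theorem stableConst_lt_top {m p : ℝ} (hm : 0 < m) (hmp : m < p) : stableConst m p < ∞ := by
  rw [stableConst, lintegral_remIntensity m (by fun_prop), ← Ioc_union_Ioi_eq_Ioi zero_le_one,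
    lintegral_union measurableSet_Ioi (Ioc_disjoint_Ioi le_rfl)]
  refine ENNReal.add_lt_top.2 ⟨?_, ?_⟩
  · have h1 : IntegrableOn (fun s : ℝ => m * s ^ (p - m - 1)) (Ioc 0 1) := by
      refine Integrable.const_mul ?_ m
      have := intervalIntegral.intervalIntegrable_rpow' (a := 0) (b := 1)
        (r := p - m - 1) (by linarith)
      rwa [intervalIntegrable_iff_integrableOn_Ioc_of_le zero_le_one] at this
    refine lt_of_le_of_lt ?_ h1.setLIntegral_lt_top
    refine setLIntegral_mono (by fun_prop) fun s hs => ?_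
    refine (mul_le_mul_right (one_sub_expNeg_le _) _).trans ?_
    rw [ENNReal.ofReal_rpow_of_pos hs.1, ← ENNReal.ofReal_mul
      (mul_nonneg hm.le (Real.rpow_nonneg hs.1.le _)), mul_assoc, ← Real.rpow_add hs.1]
    exact le_of_eq (by ring_nf)
  · have h1 : IntegrableOn (fun s : ℝ => m * s ^ (-m - 1)) (Ioi 1) :=
      (integrableOn_Ioi_rpow_of_lt (by linarith) zero_lt_one).const_mul m
    refine lt_of_le_of_lt ?_ h1.setLIntegral_lt_top
    refine setLIntegral_mono (by fun_prop) fun s hs => ?_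
    exact mul_le_of_le_one_right' tsub_le_self

theorem stableConst_pos {m : ℝ} (hm : 0 < m) (p : ℝ) : 0 < stableConst m p := by
  rw [stableConst, lintegral_remIntensity m (by fun_prop),
    setLIntegral_pos_iff (by fun_prop)]
  have : Ioi (0 : ℝ) ⊆ Function.support fun s : ℝ =>
      ENNReal.ofReal (m * s ^ (-m - 1)) * (1 - expNeg (ENNReal.ofReal s ^ p)) := by
    intro s hs
    have hs : 0 < s := hs
    refine mul_ne_zero (by simpa using by positivity) ?_
    rw [Ne, tsub_eq_zero_iff_le, not_le, ← expNeg_zero]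
    refine strictAnti_expNeg ?_
    exact ENNReal.rpow_pos (by simpa using hs) (by simp)
  rw [inter_eq_self_of_subset_right this]
  simp

/-! ### Integrating out one level of a cascade -/

/-- The identity holds for finite partial products by independence and passes to the limit by
dominated convergence. Writing each factor as `expNeg (negLog _)` expresses the infinite product as
the exponential of a sum, which can serve as input for the next integration. -/
theorem lintegral_expNeg_tsum_of_iIndepFun {Ω I E : Type*} [MeasurableSpace Ω] [MeasurableSpace E]
    [Countable I] {P : Measure Ω} [IsProbabilityMeasure P] {X : I → Ω → E}
    (hX : ∀ i, Measurable (X i)) (hind : iIndepFun X P) {u : I → E → ℝ≥0∞}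
    (hu : ∀ i, Measurable (u i)) :
    ∫⁻ ω, expNeg (∑' i, u i (X i ω)) ∂P
      = expNeg (∑' i, negLog (∫⁻ ω, expNeg (u i (X i ω)) ∂P)) := by
  have h1 := tendsto_prod_expNeg fun i => negLog (∫⁻ ω, expNeg (u i (X i ω)) ∂P)
  simp_rw [fun i => expNeg_negLog (lintegral_expNeg_le_one P fun ω => u i (X i ω))] at h1
  refine tendsto_nhds_unique ?_ h1
  have h2 : Tendsto (fun s : Finset I => ∫⁻ ω, ∏ i ∈ s, expNeg (u i (X i ω)) ∂P) atTop
      (𝓝 (∫⁻ ω, expNeg (∑' i, u i (X i ω)) ∂P)) := by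
    refine tendsto_lintegral_filter_of_dominated_convergence (fun _ => 1)
      (Eventually.of_forall fun s => ?_)
      (Eventually.of_forall fun s => ae_of_all _ fun ω => ?_) (by simp)
      (ae_of_all _ fun ω => tendsto_prod_expNeg _)
    · exact Finset.measurable_fun_prod _ fun i _ => measurable_expNeg.comp ((hu i).comp (hX i))
    · exact Finset.prod_le_one' fun i _ => expNeg_le_one _
  refine h2.congr fun s => ?_
  have hc := hind.comp (fun i x => expNeg (u i x)) (fun i => measurable_expNeg.comp (hu i))
  exact lintegral_prod_eq_prod_lintegral_of_indepFun s _ hc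
    (fun i => measurable_expNeg.comp ((hu i).comp (hX i)))

/-- By independence the joint law is a product, so Fubini freezes `A` and the unconditional
statement applies to the family `X`. -/
theorem lintegral_expNeg_tsum_of_indepFun {Ω I E F : Type*} [MeasurableSpace Ω]
    [MeasurableSpace E] [MeasurableSpace F]
    [Countable I] {P : Measure Ω} [IsProbabilityMeasure P] {A : Ω → F} {X : I → Ω → E}
    (hA : Measurable A) (hX : ∀ i, Measurable (X i))
    (hAX : IndepFun A (fun ω i => X i ω) P) (hind : iIndepFun X P) {u : I → F → E → ℝ≥0∞}
    (hu : ∀ i, Measurable fun z : F × E => u i z.1 z.2) :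
    ∫⁻ ω, expNeg (∑' i, u i (A ω) (X i ω)) ∂P
      = ∫⁻ ω, expNeg (∑' i, negLog (∫⁻ ω', expNeg (u i (A ω) (X i ω')) ∂P)) ∂P := by
  have hXm : Measurable fun ω i => X i ω := measurable_pi_iff.2 hX
  have hG : Measurable fun z : F × (I → E) => expNeg (∑' i, u i z.1 (z.2 i)) :=
    measurable_expNeg.comp (Measurable.tsum fun i =>
      (hu i).comp (measurable_fst.prodMk ((measurable_pi_apply i).comp measurable_snd)))
  have h1 := lintegral_map (μ := P) hG (hA.prodMk hXm)
  rw [(indepFun_iff_map_prod_eq_prod_map_map hA.aemeasurable hXm.aemeasurable).1 hAX] at h1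
  have : IsProbabilityMeasure (P.map fun ω i => X i ω) :=
    Measure.isProbabilityMeasure_map hXm.aemeasurable
  rw [← h1, lintegral_prod _ hG.aemeasurable, lintegral_map hG.lintegral_prod_right' hA]
  refine lintegral_congr fun ω => ?_
  have hGω : Measurable fun y : I → E => expNeg (∑' i, u i (A ω) (y i)) :=
    hG.comp measurable_prodMk_left
  rw [lintegral_map hGω hXm]
  exact lintegral_expNeg_tsum_of_iIndepFun hX hind fun i => (hu i).comp measurable_prodMk_left

theorem ofReal_exp_rpow (x t : ℝ) :
    ENNReal.ofReal (Real.exp x) ^ t = ENNReal.ofReal (Real.exp (t * x)) := by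
  rw [ENNReal.ofReal_rpow_of_pos (Real.exp_pos _), ← Real.exp_mul, mul_comm]

/-- Integrating out the Gaussian increments and the Poisson processes of one level of the
cascade. -/
theorem lintegral_expNeg_cascade_level {Ω I : Type*} [MeasurableSpace Ω] [Countable I]
    {P : Measure Ω} [IsProbabilityMeasure P] {w : I → Ω → ℝ≥0∞} {y : I → Ω → ℝ}
    {ζ : I → ℕ → Ω → ℝ} {D : I × ℕ → Ω → ℝ} {m p : ℝ} (hm : 0 < m) (hmp : m < p) {v : NNReal}
    (hw : ∀ i, Measurable (w i)) (hw_top : ∀ i ω, w i ω ≠ ∞) (hy : ∀ i, Measurable (y i))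
    (hD : ∀ n, HasLaw (D n) (gaussianReal 0 v) P) (hDm : ∀ n, Measurable (D n))
    (hDind : iIndepFun D P)
    (hDpast : IndepFun (fun ω i => ((w i ω, y i ω), fun j => ζ i j ω)) (fun ω n => D n ω) P)
    (hζ : ∀ i, IsREM m (ζ i) P) (hζind : iIndepFun (fun i ω j => ζ i j ω) P)
    (hζpast : IndepFun (fun ω i => (w i ω, y i ω)) (fun ω i j => ζ i j ω) P)
    {φ φ' : ℝ → ℝ} (hφ : Measurable φ)
    (hφ' : ∀ y, ∫⁻ z, ENNReal.ofReal (Real.exp (m * φ (y + z))) ∂(gaussianReal 0 v)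
      = ENNReal.ofReal (Real.exp (m * φ' y)))
    {c : ℝ≥0∞} (hc : c ≠ ∞) :
    ∫⁻ ω, expNeg (c * ∑' n : I × ℕ, (w n.1 ω * ENNReal.ofReal (ζ n.1 n.2 ω)) ^ p
        * ENNReal.ofReal (Real.exp (p * φ (y n.1 ω + D n ω)))) ∂P
      = ∫⁻ ω, expNeg (stableConst m p * c ^ (m / p) *
        ∑' i, w i ω ^ m * ENNReal.ofReal (Real.exp (m * φ' (y i ω)))) ∂P := by
  have hp : 0 < p := hm.trans hmp
  have hζm : ∀ i j, Measurable (ζ i j) := fun i j => (hζ i).poisson.measurable j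
  -- The transform of the contribution of a single point `s`, after averaging over its Gaussian
  -- increment.
  let H : ℝ≥0∞ → ℝ → ℝ → ℝ≥0∞ := fun w y s =>
    ∫⁻ z, expNeg (c * ((w * ENNReal.ofReal s) ^ p
      * ENNReal.ofReal (Real.exp (p * φ (y + z))))) ∂(gaussianReal 0 v)
  have hHm : Measurable fun t : (ℝ≥0∞ × ℝ) × ℝ => H t.1.1 t.1.2 t.2 := by
    refine Measurable.lintegral_prod_right'
      (f := fun t : ((ℝ≥0∞ × ℝ) × ℝ) × ℝ => expNeg (c * ((t.1.1.1 * ENNReal.ofReal t.1.2) ^ p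
      * ENNReal.ofReal (Real.exp (p * φ (t.1.1.2 + t.2)))))) ?_
    fun_prop
  have hH1 : ∀ w y s, H w y s ≤ 1 := fun w y s => lintegral_expNeg_le_one _ _
  -- The Gaussian increments are averaged first, with weights, field values and Poisson points
  -- frozen.
  have step1 : ∫⁻ ω, expNeg (c * ∑' n : I × ℕ, (w n.1 ω * ENNReal.ofReal (ζ n.1 n.2 ω)) ^ p
        * ENNReal.ofReal (Real.exp (p * φ (y n.1 ω + D n ω)))) ∂P
      = ∫⁻ ω, expNeg (∑' i, ∑' j, negLog (H (w i ω) (y i ω) (ζ i j ω))) ∂P := by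
    have := lintegral_expNeg_tsum_of_indepFun (P := P)
      (A := fun ω i => ((w i ω, y i ω), fun j => ζ i j ω)) (X := D)
      (u := fun n a d => c * (((a n.1).1.1 * ENNReal.ofReal ((a n.1).2 n.2)) ^ p
        * ENNReal.ofReal (Real.exp (p * φ ((a n.1).1.2 + d)))))
      (by fun_prop) hDm hDpast hDind (fun n => by fun_prop)
    simp_rw [ENNReal.tsum_mul_left] at this
    rw [this]
    refine lintegral_congr fun ω => ?_
    rw [← ENNReal.tsum_prod]
    congr 2
    ext n
    congr 1
    exact (hD n).lintegral_comp (f := fun d => expNeg (c * ((w n.1 ω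
      * ENNReal.ofReal (ζ n.1 n.2 ω)) ^ p * ENNReal.ofReal (Real.exp (p * φ (y n.1 ω + d))))))
      (by fun_prop)
  rw [step1]
  -- Next come the Poisson processes, with only the weights and field values frozen.
  have step2 := lintegral_expNeg_tsum_of_indepFun (P := P)
    (A := fun ω i => (w i ω, y i ω)) (X := fun i ω j => ζ i j ω)
    (u := fun i a s => ∑' j, negLog (H (a i).1 (a i).2 (s j)))
    (by fun_prop) (fun i => by fun_prop) hζpast hζind (fun i => by
      refine Measurable.tsum fun j => measurable_negLog.comp ?_
      exact hHm.comp (f := fun z : (I → ℝ≥0∞ × ℝ) × (ℕ → ℝ) =>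
        (((z.1 i).1, (z.1 i).2), z.2 j)) (by fun_prop))
  rw [step2]
  refine lintegral_congr fun ω => ?_
  congr 1
  rw [← ENNReal.tsum_mul_left]
  congr 1
  ext i
  set b := w i ω with hb
  set x := y i ω with hx
  have hHs : Measurable fun s => H b x s :=
    hHm.comp (f := fun s : ℝ => ((b, x), s)) (by fun_prop)
  have hL := (hζ i).poisson.laplace (φ := fun s => negLog (H b x s)) (by fun_prop)
  rw [hL, negLog_expNeg]
  simp_rw [expNeg_negLog (hH1 _ _ _)]
  -- Since `1 - H` is itself a Gaussian average, the Poisson intensity can be integrated first;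
  -- scaling then gives `e^{mφ}`, and the Gaussian average of that is `hφ'`.
  have hsub : ∀ s, 1 - H b x s = ∫⁻ z, (1 - expNeg (c * ((b * ENNReal.ofReal s) ^ p
      * ENNReal.ofReal (Real.exp (p * φ (x + z)))))) ∂(gaussianReal 0 v) := fun s => by
    rw [lintegral_sub (by fun_prop) (ne_top_of_le_ne_top ENNReal.one_ne_top (hH1 b x s))
      (ae_of_all _ fun z => expNeg_le_one _)]
    simp [H]
  simp_rw [hsub]
  rw [lintegral_lintegral_swap (by fun_prop)]
  have hb_top : b ≠ ∞ := hw_top i ω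
  have hin : ∀ z, ∫⁻ s, (1 - expNeg (c * ((b * ENNReal.ofReal s) ^ p
      * ENNReal.ofReal (Real.exp (p * φ (x + z)))))) ∂remIntensity m
      = stableConst m p * c ^ (m / p) * b ^ m * ENNReal.ofReal (Real.exp (m * φ (x + z))) := by
    intro z
    have h := lintegral_one_sub_expNeg_remIntensity hm hp
      (a := c * b ^ p * ENNReal.ofReal (Real.exp (p * φ (x + z))))
      (by simp [ENNReal.mul_eq_top, hc, hb_top, ENNReal.rpow_eq_top_iff, hp.not_gt])
    have he : ∀ s, c * b ^ p * ENNReal.ofReal (Real.exp (p * φ (x + z))) * ENNReal.ofReal s ^ p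
        = c * ((b * ENNReal.ofReal s) ^ p * ENNReal.ofReal (Real.exp (p * φ (x + z)))) := by
      intro s
      rw [ENNReal.mul_rpow_of_nonneg _ _ hp.le]; ring
    simp_rw [he] at h
    have hmp' : 0 ≤ m / p := (div_pos hm hp).le
    rw [h, ENNReal.mul_rpow_of_nonneg _ _ hmp', ENNReal.mul_rpow_of_nonneg _ _ hmp',
      ← ENNReal.rpow_mul, ofReal_exp_rpow, mul_div_cancel₀ _ hp.ne', ← mul_assoc (m / p),
      div_mul_cancel₀ _ hp.ne']
    ring
  simp_rw [hin]
  rw [lintegral_const_mul _ (by fun_prop), hφ']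
  ring

/-! ### The heat semigroup on functions of exponential growth -/

/-- `|h y| ≤ A e^{B |y|}` for some `A, B ≥ 0`. -/
def ExpGrowth (h : ℝ → ℝ) : Prop :=
  ∃ A B : ℝ, 0 ≤ A ∧ 0 ≤ B ∧ ∀ y, |h y| ≤ A * Real.exp (B * |y|)

/-- `E[h (y + √v Z)]` for a standard Gaussian variable `Z`. -/
def heat (h : ℝ → ℝ) (v y : ℝ) : ℝ := ∫ z, h (y + √v * z) ∂(gaussianReal 0 1)

theorem integrable_exp_mul_abs_gaussian (b : ℝ) :
    Integrable (fun z => Real.exp (b * |z|)) (gaussianReal 0 1) :=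
  integrable_exp_mul_abs (X := fun z => z) (integrable_exp_mul_gaussianReal b)
    (integrable_exp_mul_gaussianReal (-b))

theorem exp_abs_add_mul_le {A B R V y s z : ℝ} (hA : 0 ≤ A) (hB : 0 ≤ B) (hy : |y| ≤ R)
    (hs : |s| ≤ V) :
    A * Real.exp (B * |y + s * z|) ≤ A * Real.exp (B * R) * Real.exp (B * V * |z|) := by
  rw [mul_assoc, ← Real.exp_add]
  refine mul_le_mul_of_nonneg_left (Real.exp_le_exp.2 ?_) hA
  have h1 : |y + s * z| ≤ R + V * |z| := by
    refine (abs_add_le _ _).trans (add_le_add hy ?_)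
    rw [abs_mul]
    exact mul_le_mul_of_nonneg_right hs (abs_nonneg z)
  nlinarith [mul_le_mul_of_nonneg_left h1 hB]

theorem ExpGrowth.integrable {h : ℝ → ℝ} (hg : ExpGrowth h) (hc : Continuous h) (y s : ℝ) :
    Integrable (fun z => h (y + s * z)) (gaussianReal 0 1) := by
  obtain ⟨A, B, hA, hB, hbd⟩ := hg
  refine Integrable.mono' ((integrable_exp_mul_abs_gaussian (B * |s|)).const_mul
    (A * Real.exp (B * |y|))) (by fun_prop) (ae_of_all _ fun z => ?_)
  exact (hbd _).trans (exp_abs_add_mul_le hA hB le_rfl le_rfl)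

/-- Continuity includes `v = 0`, where the semigroup must match its initial value; for negative `v`
the square root is `0`, so the statement holds on the whole plane. -/
theorem continuous_heat {h : ℝ → ℝ} (hg : ExpGrowth h) (hc : Continuous h) :
    Continuous fun p : ℝ × ℝ => heat h p.1 p.2 := by
  obtain ⟨A, B, hA, hB, hbd⟩ := hg
  refine continuous_iff_continuousAt.2 fun p₀ => ?_
  have e1 : ∀ᶠ p : ℝ × ℝ in 𝓝 p₀, |p.2| ≤ |p₀.2| + 1 :=
    (continuous_snd.abs.tendsto p₀).eventually_le_const (by linarith : |p₀.2| < |p₀.2| + 1)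
  have e2 : ∀ᶠ p : ℝ × ℝ in 𝓝 p₀, |√p.1| ≤ |√p₀.1| + 1 :=
    ((continuous_fst.sqrt.abs).tendsto p₀).eventually_le_const
      (by linarith : |√p₀.1| < |√p₀.1| + 1)
  refine continuousAt_of_dominated
    (bound := fun z => A * Real.exp (B * (|p₀.2| + 1)) * Real.exp (B * (|√p₀.1| + 1) * |z|))
    (Eventually.of_forall fun p => by fun_prop) ?_
    ((integrable_exp_mul_abs_gaussian _).const_mul _) (ae_of_all _ fun z => by fun_prop)
  filter_upwards [e1, e2] with p h1 h2
  exact ae_of_all _ fun z => (hbd _).trans (exp_abs_add_mul_le hA hB h1 h2)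

theorem hasDerivAt_heat_space {h h' : ℝ → ℝ} (hg : ExpGrowth h) (hg' : ExpGrowth h')
    (hc' : Continuous h') (hd : ∀ y, HasDerivAt h (h' y) y) (v y : ℝ) :
    HasDerivAt (heat h v) (heat h' v y) y := by
  have hc : Continuous h := continuous_iff_continuousAt.2 fun y => (hd y).continuousAt
  obtain ⟨A, B, hA, hB, hbd⟩ := hg'
  refine (hasDerivAt_integral_of_dominated_loc_of_deriv_le (s := Metric.ball y 1)
    (F := fun y z => h (y + √v * z)) (F' := fun y z => h' (y + √v * z))
    (bound := fun z => A * Real.exp (B * (|y| + 1)) * Real.exp (B * |√v| * |z|))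
    (Metric.ball_mem_nhds y one_pos) (Eventually.of_forall fun p => by fun_prop)
    (hg.integrable hc _ _) (by fun_prop) (ae_of_all _ fun z x hx => ?_)
    ((integrable_exp_mul_abs_gaussian _).const_mul _) (ae_of_all _ fun z x hx => ?_)).2
  · refine (hbd _).trans (exp_abs_add_mul_le hA hB ?_ le_rfl)
    have : |x - y| < 1 := by simpa [Real.dist_eq] using hx
    calc |x| = |y + (x - y)| := by ring_nf
      _ ≤ |y| + |x - y| := abs_add_le _ _
      _ ≤ |y| + 1 := by linarith
  · simpa using (hd (x + √v * z)).comp_add_const x (√v * z)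

/-- Gaussian integration by parts. -/
theorem integral_mul_gaussian {F F' : ℝ → ℝ} (hd : ∀ z, HasDerivAt F (F' z) z)
    (hF : Integrable F (gaussianReal 0 1)) (hF' : Integrable F' (gaussianReal 0 1))
    (hzF : Integrable (fun z => F z * z) (gaussianReal 0 1)) :
    ∫ z, F z * z ∂(gaussianReal 0 1) = ∫ z, F' z ∂(gaussianReal 0 1) := by
  have hint : ∀ G : ℝ → ℝ, Integrable G (gaussianReal 0 1) →
      Integrable (fun z => G z * gaussianPDFReal 0 1 z) := fun G hG => by
    rw [gaussianReal_of_var_ne_zero _ one_ne_zero,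
      integrable_withDensity_iff_integrable_smul' (measurable_gaussianPDF _ _)
        (ae_of_all _ fun _ => gaussianPDF_lt_top)] at hG
    refine hG.congr (ae_of_all _ fun z => ?_)
    simp [toReal_gaussianPDF, mul_comm]
  have hρ : ∀ z, HasDerivAt (gaussianPDFReal 0 1) (-(z * gaussianPDFReal 0 1 z)) z := fun z => by
    have h1 : HasDerivAt (fun x : ℝ => -(x - 0) ^ 2 / (2 * ((1 : NNReal) : ℝ))) (-z) z := by
      have := ((hasDerivAt_pow 2 z).neg).div_const 2
      simp only [sub_zero, NNReal.coe_one, mul_one]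
      have e : -((2 : ℕ) * z ^ (2 - 1) : ℝ) / 2 = -z := by push_cast; ring
      rw [← e]
      exact this
    have h2 := (h1.exp).const_mul ((√(2 * Real.pi * ((1 : NNReal) : ℝ)))⁻¹)
    have e : -(z * gaussianPDFReal 0 1 z) = (√(2 * Real.pi * ((1 : NNReal) : ℝ)))⁻¹ *
        (Real.exp (-(z - 0) ^ 2 / (2 * ((1 : NNReal) : ℝ))) * -z) := by
      rw [gaussianPDFReal]; ring
    rw [e]
    exact h2
  have hparts := integral_mul_deriv_eq_deriv_mul_of_integrable (u := F) (u' := F')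
    (v := gaussianPDFReal 0 1) (v' := fun z => -(z * gaussianPDFReal 0 1 z))
    (fun x _ => hd x) (fun x _ => hρ x)
    ((hint _ hzF).neg.congr (ae_of_all _ fun z => by simp; ring)) (hint _ hF') (hint _ hF)
  rw [integral_gaussianReal_eq_integral_smul one_ne_zero,
    integral_gaussianReal_eq_integral_smul one_ne_zero]
  simp only [smul_eq_mul]
  have e1 : ∫ x, gaussianPDFReal 0 1 x * (F x * x) = -∫ x, F x * -(x * gaussianPDFReal 0 1 x) := by
    rw [← integral_neg]; congr 1; ext x; ring
  rw [e1, hparts, neg_neg]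
  congr 1; ext x; ring

/-- Differentiating under the integral gives `E[h'(y + √v Z) Z] / (2√v)`, and Gaussian integration
by parts replaces the factor `Z` by `√v` and one more derivative. -/
theorem hasDerivAt_heat_time {h h' h'' : ℝ → ℝ} (hg : ExpGrowth h) (hg' : ExpGrowth h')
    (hg'' : ExpGrowth h'') (hc'' : Continuous h'') (hd : ∀ y, HasDerivAt h (h' y) y)
    (hd' : ∀ y, HasDerivAt h' (h'' y) y) {v : ℝ} (hv : 0 < v) (y : ℝ) :
    HasDerivAt (fun v => heat h v y) (heat h'' v y / 2) v := by
  have hc : Continuous h := continuous_iff_continuousAt.2 fun y => (hd y).continuousAt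
  have hc' : Continuous h' := continuous_iff_continuousAt.2 fun y => (hd' y).continuousAt
  have hsq : 0 < √v := Real.sqrt_pos.2 hv
  obtain ⟨A, B, hA, hB, hbd⟩ := id hg'
  have hz : ∀ z : ℝ, |z| ≤ Real.exp |z| := fun z => by
    linarith [Real.add_one_le_exp |z|]
  -- The neighbourhood stays away from `0`, which keeps `1/(2√x)` bounded.
  have key := hasDerivAt_integral_of_dominated_loc_of_deriv_le (s := Ioo (v / 2) (v + 1))
    (μ := gaussianReal 0 1) (x₀ := v)
    (F := fun v z => h (y + √v * z)) (F' := fun v z => h' (y + √v * z) * (1 / (2 * √v) * z))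
    (bound := fun z => A * Real.exp (B * |y|) * (1 / (2 * √(v / 2))) *
      Real.exp ((B * √(v + 1) + 1) * |z|))
    (Ioo_mem_nhds (by linarith) (by linarith)) (Eventually.of_forall fun p => by fun_prop)
    (hg.integrable hc _ _) (by fun_prop) (ae_of_all _ fun z x hx => ?_)
    ((integrable_exp_mul_abs_gaussian _).const_mul _) (ae_of_all _ fun z x hx => ?_)
  · have hd2 := key.2
    have : ∫ z, h' (y + √v * z) * (1 / (2 * √v) * z) ∂(gaussianReal 0 1) = heat h'' v y / 2 := by
      have hs := integral_mul_gaussian (F := fun z => h' (y + √v * z))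
        (F' := fun z => h'' (y + √v * z) * √v) (fun z => by
          have h1 : HasDerivAt (fun z : ℝ => y + √v * z) √v z := by
            simpa using ((hasDerivAt_id z).const_mul √v).const_add y
          exact (hd' (y + √v * z)).comp z h1)
        (hg'.integrable hc' _ _) ((hg''.integrable hc'' _ _).mul_const _) ?_
      · rw [integral_mul_const] at hs
        have e : ∀ z, h' (y + √v * z) * (1 / (2 * √v) * z)
            = 1 / (2 * √v) * (h' (y + √v * z) * z) := fun z => by ring
        simp_rw [e]
        rw [integral_const_mul, hs]
        unfold heat
        field_simp
      · have := key.1.const_mul (2 * √v)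
        refine this.congr (ae_of_all _ fun z => ?_)
        simp only
        field_simp
    rwa [this] at hd2
  · have hx1 : √x ≤ √(v + 1) := Real.sqrt_le_sqrt hx.2.le
    have hx2 : √(v / 2) ≤ √x := Real.sqrt_le_sqrt hx.1.le
    have hv2 : 0 < √(v / 2) := Real.sqrt_pos.2 (by linarith)
    have b1 : |h' (y + √x * z)| ≤ A * Real.exp (B * |y|) * Real.exp (B * √(v + 1) * |z|) :=
      (hbd _).trans (exp_abs_add_mul_le hA hB le_rfl
        (by rwa [abs_of_nonneg (Real.sqrt_nonneg x)]))
    have b2 : |1 / (2 * √x) * z| ≤ 1 / (2 * √(v / 2)) * Real.exp |z| := by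
      rw [abs_mul, abs_of_nonneg (by positivity)]
      exact mul_le_mul (one_div_le_one_div_of_le (by positivity) (by linarith)) (hz z)
        (abs_nonneg _) (by positivity)
    rw [Real.norm_eq_abs, abs_mul]
    refine (mul_le_mul b1 b2 (abs_nonneg _) (by positivity)).trans (le_of_eq ?_)
    rw [add_mul, Real.exp_add, one_mul]; ring
  · have hx0 : 0 < x := by linarith [hx.1]
    have h1 : HasDerivAt (fun x : ℝ => y + √x * z) (1 / (2 * √x) * z) x := by
      simpa using ((Real.hasDerivAt_sqrt hx0.ne').mul_const z).const_add y
    exact (hd (y + √x * z)).comp x h1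

theorem heat_zero (h : ℝ → ℝ) (y : ℝ) : heat h 0 y = h y := by simp [heat]

theorem heat_eq_integral (h : ℝ → ℝ) (v : NNReal) (y : ℝ) :
    heat h v y = ∫ z, h (y + z) ∂(gaussianReal 0 v) := by
  have h1 : (gaussianReal 0 1).map (√(v : ℝ) * ·) = gaussianReal 0 v := by
    rw [gaussianReal_map_const_mul]
    congr 1
    · simp
    · ext; simp
  by_cases hv : v = 0
  · simp [hv, heat]
  have hs : √(v : ℝ) ≠ 0 := by
    rw [Real.sqrt_ne_zero']
    exact_mod_cast pos_iff_ne_zero.2 hv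
  rw [← h1, (measurableEmbedding_mulLeft₀ hs).integral_map]
  rfl

/-! ### The Hopf–Cole semigroup -/

/-- `C²` functions with first and second derivatives bounded by `K₁` and `K₂`. -/
structure BoundedDerivs (φ : ℝ → ℝ) (K₁ K₂ : ℝ) : Prop where
  contDiff : ContDiff ℝ 2 φ
  deriv_le : ∀ y, |deriv φ y| ≤ K₁
  deriv_deriv_le : ∀ y, |deriv (deriv φ) y| ≤ K₂

theorem BoundedDerivs.of_hasDerivAt {φ φ₁ φ₂ : ℝ → ℝ} {K₁ K₂ : ℝ}
    (h1 : ∀ y, HasDerivAt φ (φ₁ y) y) (h2 : ∀ y, HasDerivAt φ₁ (φ₂ y) y) (hc : Continuous φ₂)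
    (hK₁ : ∀ y, |φ₁ y| ≤ K₁) (hK₂ : ∀ y, |φ₂ y| ≤ K₂) : BoundedDerivs φ K₁ K₂ := by
  have e1 : deriv φ = φ₁ := funext fun y => (h1 y).deriv
  have e2 : deriv φ₁ = φ₂ := funext fun y => (h2 y).deriv
  refine ⟨?_, by rwa [e1], by rwa [e1, e2]⟩
  rw [show (2 : WithTop ℕ∞) = 1 + 1 by norm_num, contDiff_succ_iff_deriv]
  refine ⟨fun y => (h1 y).differentiableAt, by simp, ?_⟩
  rw [e1, contDiff_one_iff_deriv, e2]
  exact ⟨fun y => (h2 y).differentiableAt, hc⟩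

namespace BoundedDerivs

variable {φ : ℝ → ℝ} {K₁ K₂ : ℝ}

theorem hasDerivAt (h : BoundedDerivs φ K₁ K₂) (y : ℝ) : HasDerivAt φ (deriv φ y) y :=
  (h.contDiff.differentiable (by norm_num) y).hasDerivAt

theorem contDiff_deriv (h : BoundedDerivs φ K₁ K₂) : ContDiff ℝ 1 (deriv φ) := by
  have := h.contDiff
  rw [show (2 : WithTop ℕ∞) = 1 + 1 by norm_num, contDiff_succ_iff_deriv] at this
  exact this.2.2

theorem hasDerivAt_deriv (h : BoundedDerivs φ K₁ K₂) (y : ℝ) :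
    HasDerivAt (deriv φ) (deriv (deriv φ) y) y :=
  (h.contDiff_deriv.differentiable (by norm_num) y).hasDerivAt

theorem continuous_deriv_deriv (h : BoundedDerivs φ K₁ K₂) : Continuous (deriv (deriv φ)) :=
  (contDiff_one_iff_deriv.1 h.contDiff_deriv).2

theorem nonneg (h : BoundedDerivs φ K₁ K₂) : 0 ≤ K₁ := (abs_nonneg _).trans (h.deriv_le 0)

theorem abs_sub_le (h : BoundedDerivs φ K₁ K₂) (x y : ℝ) : |φ y - φ x| ≤ K₁ * |y - x| := by
  simpa using (convex_univ (𝕜 := ℝ) (E := ℝ)).norm_image_sub_le_of_norm_deriv_le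
    (f := φ) (C := K₁) (fun x _ => (h.hasDerivAt x).differentiableAt) (fun x _ => h.deriv_le x)
    (mem_univ x) (mem_univ y)

theorem abs_le (h : BoundedDerivs φ K₁ K₂) (y : ℝ) : |φ y| ≤ |φ 0| + K₁ * |y| := by
  have h1 := h.abs_sub_le 0 y
  have h2 := abs_add_le (φ 0) (φ y - φ 0)
  simp only [sub_zero, add_sub_cancel] at h1 h2
  linarith

end BoundedDerivs

theorem expGrowth_of_abs_le {h : ℝ → ℝ} {K : ℝ} (hK : ∀ y, |h y| ≤ K) : ExpGrowth h :=
  ⟨K, 0, (abs_nonneg _).trans (hK 0), le_rfl, fun y => by simpa using hK y⟩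

theorem ExpGrowth.mul {h₁ h₂ : ℝ → ℝ} (hg₁ : ExpGrowth h₁) (hg₂ : ExpGrowth h₂) :
    ExpGrowth fun y => h₁ y * h₂ y := by
  obtain ⟨A, B, hA, hB, hb⟩ := hg₁
  obtain ⟨A', B', hA', hB', hb'⟩ := hg₂
  refine ⟨A * A', B + B', by positivity, by positivity, fun y => ?_⟩
  rw [abs_mul]
  refine (mul_le_mul (hb y) (hb' y) (abs_nonneg _) (by positivity)).trans (le_of_eq ?_)
  rw [add_mul, Real.exp_add]; ring

theorem BoundedDerivs.expGrowth {φ : ℝ → ℝ} {K₁ K₂ : ℝ} (h : BoundedDerivs φ K₁ K₂) :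
    ExpGrowth φ := by
  refine ⟨|φ 0| + K₁, 1, add_nonneg (abs_nonneg _) h.nonneg, zero_le_one, fun y => ?_⟩
  have h1 := h.abs_le y
  have h2 := Real.add_one_le_exp |y|
  have h3 := mul_le_mul_of_nonneg_left (show (1 : ℝ) ≤ Real.exp |y| by
    linarith [abs_nonneg y]) (abs_nonneg (φ 0))
  have h4 := mul_le_mul_of_nonneg_left (show |y| ≤ Real.exp |y| by linarith) h.nonneg
  rw [one_mul, add_mul]
  linarith

theorem BoundedDerivs.expGrowth_exp {φ : ℝ → ℝ} {K₁ K₂ : ℝ} (h : BoundedDerivs φ K₁ K₂)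
    {m : ℝ} (hm : 0 ≤ m) : ExpGrowth fun y => Real.exp (m * φ y) := by
  refine ⟨Real.exp (m * |φ 0|), m * K₁, (Real.exp_pos _).le, mul_nonneg hm h.nonneg, fun y => ?_⟩
  rw [abs_of_pos (Real.exp_pos _), ← Real.exp_add]
  refine Real.exp_le_exp.2 ?_
  have := mul_le_mul_of_nonneg_left ((le_abs_self _).trans (h.abs_le y)) hm
  linarith

theorem heat_pos {h : ℝ → ℝ} (hg : ExpGrowth h) (hc : Continuous h) (hpos : ∀ y, 0 < h y)
    (v y : ℝ) : 0 < heat h v y := by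
  unfold heat
  rw [integral_pos_iff_support_of_nonneg (fun z => (hpos _).le) (hg.integrable hc _ _)]
  have : (Function.support fun z => h (y + √v * z)) = univ :=
    eq_univ_of_forall fun z => (hpos _).ne'
  simp [this]

theorem abs_heat_le {h H : ℝ → ℝ} (hg : ExpGrowth H) (hc : Continuous H)
    (hle : ∀ y, |h y| ≤ H y) (v y : ℝ) : |heat h v y| ≤ heat H v y :=
  norm_integral_le_of_norm_le (f := fun z => h (y + √v * z)) (hg.integrable hc y √v)
    (ae_of_all _ fun _ => hle _)

/-- `(1/m) log E[exp (m φ (y + √v Z))]`, respectively `E[φ (y + √v Z)]` for `m = 0`. -/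
def hopfCole (m : ℝ) (φ : ℝ → ℝ) (v y : ℝ) : ℝ :=
  if m = 0 then heat φ v y else 1 / m * Real.log (heat (fun y => Real.exp (m * φ y)) v y)

theorem hopfCole_zero_time (m : ℝ) (φ : ℝ → ℝ) (y : ℝ) : hopfCole m φ 0 y = φ y := by
  unfold hopfCole
  split_ifs with hm
  · exact heat_zero _ _
  · rw [heat_zero, Real.log_exp]; field_simp

/-- The properties of the Hopf–Cole semigroup that make it solve the Parisi equation. -/
structure IsHopfColeFlow (m : ℝ) (T : ℝ → ℝ → ℝ) (K₁ K₂ : ℝ) : Prop where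
  continuous : Continuous fun p : ℝ × ℝ => T p.1 p.2
  boundedDerivs : ∀ v, BoundedDerivs (T v) K₁ K₂
  equation : ∀ v, 0 < v → ∀ y,
    HasDerivAt (fun v => T v y) ((deriv (deriv (T v)) y + m * (deriv (T v) y) ^ 2) / 2) v

/-- Spatial derivatives commute with Gaussian averaging, which preserves uniform bounds. -/
theorem isHopfColeFlow_heat {φ : ℝ → ℝ} {K₁ K₂ : ℝ} (h : BoundedDerivs φ K₁ K₂) :
    IsHopfColeFlow 0 (heat φ) K₁ K₂ := by
  have g1 := expGrowth_of_abs_le h.deriv_le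
  have g2 := expGrowth_of_abs_le h.deriv_deriv_le
  have d1 := fun v y => hasDerivAt_heat_space h.expGrowth g1 h.contDiff_deriv.continuous
    h.hasDerivAt v y
  have d2 := fun v y => hasDerivAt_heat_space g1 g2 h.continuous_deriv_deriv
    h.hasDerivAt_deriv v y
  have hconst : ∀ (K v y : ℝ), heat (fun _ => K) v y = K := fun K v y => by simp [heat]
  refine ⟨continuous_heat h.expGrowth h.contDiff.continuous, fun v => ?_, fun v hv y => ?_⟩
  · refine BoundedDerivs.of_hasDerivAt (d1 v) (d2 v) ?_ (fun y => ?_) (fun y => ?_)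
    · exact (continuous_heat g2 h.continuous_deriv_deriv).comp (by fun_prop : Continuous (v, ·))
    · exact (abs_heat_le (expGrowth_of_abs_le (K := |K₁|) fun _ => le_rfl) continuous_const
        h.deriv_le v y).trans_eq (hconst _ _ _)
    · exact (abs_heat_le (expGrowth_of_abs_le (K := |K₂|) fun _ => le_rfl) continuous_const
        h.deriv_deriv_le v y).trans_eq (hconst _ _ _)
  · have e1 : deriv (heat φ v) = heat (deriv φ) v := funext fun y => (d1 v y).deriv
    rw [e1, (d2 v y).deriv, zero_mul, add_zero]
    exact hasDerivAt_heat_time h.expGrowth g1 g2 h.continuous_deriv_deriv h.hasDerivAt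
      h.hasDerivAt_deriv hv y

/-- Put `u_i = heat u₀^{(i)}` for `u₀ = e^{mφ}`. The first derivative `u_1/(m u_0)` is an average of
`φ'` with respect to a tilted Gaussian law, so the bound `K₁` persists without loss. The second is
the tilted average of `φ'' + m φ'^2` minus `m` times the square of the first, whence `K₂ + 2 m K₁²`.
The heat equation for `u_0` becomes the nonlinear equation. -/
theorem isHopfColeFlow_log_heat {φ : ℝ → ℝ} {K₁ K₂ m : ℝ} (h : BoundedDerivs φ K₁ K₂)
    (hm : 0 < m) :
    IsHopfColeFlow m (fun v y => 1 / m * Real.log (heat (fun y => Real.exp (m * φ y)) v y))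
      K₁ (K₂ + 2 * m * K₁ ^ 2) := by
  set u₀ : ℝ → ℝ := fun y => Real.exp (m * φ y) with hu₀
  set u₁ : ℝ → ℝ := fun y => m * deriv φ y * u₀ y with hu₁
  set u₂ : ℝ → ℝ := fun y => (m * deriv (deriv φ) y + (m * deriv φ y) ^ 2) * u₀ y with hu₂
  have hc0 : Continuous u₀ := by have := h.contDiff.continuous; fun_prop
  have hcd := h.contDiff_deriv.continuous
  have hcdd := h.continuous_deriv_deriv
  have hc1 : Continuous u₁ := by fun_prop
  have hc2 : Continuous u₂ := by fun_prop
  have hpos : ∀ y, 0 < u₀ y := fun y => Real.exp_pos _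
  have hb1 : ∀ y, |m * deriv φ y| ≤ m * K₁ := fun y => by
    rw [abs_mul, abs_of_pos hm]
    exact mul_le_mul_of_nonneg_left (h.deriv_le y) hm.le
  have hb2 : ∀ y, |m * deriv (deriv φ) y + (m * deriv φ y) ^ 2| ≤ m * K₂ + (m * K₁) ^ 2 :=
    fun y => by
      refine (abs_add_le _ _).trans (add_le_add ?_ ?_)
      · rw [abs_mul, abs_of_pos hm]
        exact mul_le_mul_of_nonneg_left (h.deriv_deriv_le y) hm.le
      · rw [abs_pow]
        exact pow_le_pow_left₀ (abs_nonneg _) (hb1 y) 2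
  have g0 : ExpGrowth u₀ := h.expGrowth_exp hm.le
  have g1 : ExpGrowth u₁ := (expGrowth_of_abs_le hb1).mul g0
  have g2 : ExpGrowth u₂ := (expGrowth_of_abs_le hb2).mul g0
  have D0 : ∀ y, HasDerivAt u₀ (u₁ y) y := fun y => by
    have := ((h.hasDerivAt y).const_mul m).exp
    rwa [mul_comm] at this
  have D1 : ∀ y, HasDerivAt u₁ (u₂ y) y := fun y => by
    have := ((h.hasDerivAt_deriv y).const_mul m).mul (D0 y)
    have e : u₂ y = m * deriv (deriv φ) y * u₀ y + m * deriv φ y * u₁ y := by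
      simp only [hu₁, hu₂]; ring
    rw [e]; exact this
  have d1 := fun v y => hasDerivAt_heat_space g0 g1 hc1 D0 v y
  have d2 := fun v y => hasDerivAt_heat_space g1 g2 hc2 D1 v y
  have hp : ∀ v y, 0 < heat u₀ v y := heat_pos g0 hc0 hpos
  have hmul : ∀ K v y, heat (fun y => K * u₀ y) v y = K * heat u₀ v y := fun K v y =>
    integral_const_mul _ _
  have hB1 : ∀ v y, |heat u₁ v y| ≤ m * K₁ * heat u₀ v y := fun v y => by
    rw [← hmul]
    refine abs_heat_le ((expGrowth_of_abs_le (K := |m * K₁|) fun _ => le_rfl).mul g0)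
      (by fun_prop) (fun y => ?_) v y
    rw [abs_mul, abs_of_pos (hpos y)]
    exact mul_le_mul_of_nonneg_right (hb1 y) (hpos y).le
  have hB2 : ∀ v y, |heat u₂ v y| ≤ (m * K₂ + (m * K₁) ^ 2) * heat u₀ v y := fun v y => by
    rw [← hmul]
    refine abs_heat_le ((expGrowth_of_abs_le (K := |m * K₂ + (m * K₁) ^ 2|)
      fun _ => le_rfl).mul g0) (by fun_prop) (fun y => ?_) v y
    rw [abs_mul, abs_of_pos (hpos y)]
    exact mul_le_mul_of_nonneg_right (hb2 y) (hpos y).le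
  have C0 : Continuous fun p : ℝ × ℝ => heat u₀ p.1 p.2 := continuous_heat g0 hc0
  have C1 : Continuous fun p : ℝ × ℝ => heat u₁ p.1 p.2 := continuous_heat g1 hc1
  have C2 : Continuous fun p : ℝ × ℝ => heat u₂ p.1 p.2 := continuous_heat g2 hc2
  have T1 : ∀ v y, HasDerivAt (fun y => 1 / m * Real.log (heat u₀ v y))
      (heat u₁ v y / (m * heat u₀ v y)) y := fun v y => by
    have hne := (hp v y).ne'
    exact (((d1 v y).log hne).const_mul (1 / m)).congr_deriv (by field_simp)
  have T2 : ∀ v y, HasDerivAt (fun y => heat u₁ v y / (m * heat u₀ v y))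
      (heat u₂ v y / (m * heat u₀ v y) - m * (heat u₁ v y / (m * heat u₀ v y)) ^ 2) y :=
    fun v y => by
      have hne := (hp v y).ne'
      exact ((d2 v y).div ((d1 v y).const_mul m) (mul_pos hm (hp v y)).ne').congr_deriv
        (by field_simp)
  have hS1 : ∀ v y, |heat u₁ v y / (m * heat u₀ v y)| ≤ K₁ := fun v y => by
    rw [abs_div, abs_of_pos (mul_pos hm (hp v y)), div_le_iff₀ (mul_pos hm (hp v y))]
    exact (hB1 v y).trans_eq (by ring)
  have Ccomp : ∀ (v : ℝ) {F : ℝ × ℝ → ℝ}, Continuous F → Continuous fun y => F (v, y) :=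
    fun v F hF => hF.comp (by fun_prop)
  refine ⟨?_, fun v => ?_, fun v hv y => ?_⟩
  · exact continuous_const.mul (C0.log fun p => (hp _ _).ne')
  · refine BoundedDerivs.of_hasDerivAt (T1 v) (T2 v) ?_ (hS1 v) (fun y => ?_)
    · have c0 := Ccomp v C0
      have c1 := Ccomp v C1
      have c2 := Ccomp v C2
      have hne : ∀ y, m * heat u₀ v y ≠ 0 := fun y => (mul_pos hm (hp v y)).ne'
      exact (c2.div (continuous_const.mul c0) hne).sub
        (continuous_const.mul ((c1.div (continuous_const.mul c0) hne).pow 2))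
    · refine (abs_sub _ _).trans ?_
      have a1 : |heat u₂ v y / (m * heat u₀ v y)| ≤ K₂ + m * K₁ ^ 2 := by
        rw [abs_div, abs_of_pos (mul_pos hm (hp v y)), div_le_iff₀ (mul_pos hm (hp v y))]
        exact (hB2 v y).trans_eq (by ring)
      have a2 : |m * (heat u₁ v y / (m * heat u₀ v y)) ^ 2| ≤ m * K₁ ^ 2 := by
        rw [abs_mul, abs_of_pos hm, abs_pow]
        exact mul_le_mul_of_nonneg_left (pow_le_pow_left₀ (abs_nonneg _) (hS1 v y) 2) hm.le
      linarith
  · have e1 : deriv (fun y => 1 / m * Real.log (heat u₀ v y))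
        = fun y => heat u₁ v y / (m * heat u₀ v y) := funext fun y => (T1 v y).deriv
    rw [e1, (T2 v y).deriv]
    have hne := (hp v y).ne'
    exact (((hasDerivAt_heat_time g0 g1 g2 hc2 D0 D1 hv y).log hne).const_mul (1 / m)).congr_deriv
      (by field_simp; ring)

theorem exists_isHopfColeFlow {φ : ℝ → ℝ} {K₁ K₂ m : ℝ} (h : BoundedDerivs φ K₁ K₂)
    (hm : 0 ≤ m) : ∃ K₃, IsHopfColeFlow m (hopfCole m φ) K₁ K₃ := by
  by_cases hm0 : m = 0
  · refine ⟨K₂, ?_⟩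
    have e : hopfCole m φ = heat φ := by ext v y; simp [hopfCole, hm0]
    rw [e, hm0]
    exact isHopfColeFlow_heat h
  · refine ⟨K₂ + 2 * m * K₁ ^ 2, ?_⟩
    have e : hopfCole m φ
        = fun v y => 1 / m * Real.log (heat (fun y => Real.exp (m * φ y)) v y) := by
      ext v y; simp [hopfCole, hm0]
    rw [e]
    exact isHopfColeFlow_log_heat h (lt_of_le_of_ne hm (Ne.symm hm0))

theorem lintegral_exp_hopfCole {φ : ℝ → ℝ} {K₁ K₂ m : ℝ} (h : BoundedDerivs φ K₁ K₂)
    (hm : 0 < m) (v : NNReal) (y : ℝ) :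
    ∫⁻ z, ENNReal.ofReal (Real.exp (m * φ (y + z))) ∂(gaussianReal 0 v)
      = ENNReal.ofReal (Real.exp (m * hopfCole m φ v y)) := by
  have g0 : ExpGrowth fun y => Real.exp (m * φ y) := h.expGrowth_exp hm.le
  have hc0 : Continuous fun y => Real.exp (m * φ y) := by
    have := h.contDiff.continuous; fun_prop
  have hp := heat_pos g0 hc0 (fun y => Real.exp_pos _) v y
  have hint : Integrable (fun z => Real.exp (m * φ (y + z))) (gaussianReal 0 v) := by
    -- A non-integrable function has Bochner integral `0` by convention, contradicting positivity.
    by_contra hni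
    rw [heat_eq_integral, integral_undef hni] at hp
    exact lt_irrefl _ hp
  rw [← ofReal_integral_eq_lintegral_ofReal hint (ae_of_all _ fun z => (Real.exp_pos _).le),
    hopfCole, if_neg hm.ne', ← mul_assoc, mul_one_div_cancel hm.ne', one_mul, Real.exp_log hp,
    heat_eq_integral]

/-! ### The distribution function of a finitely supported measure -/

namespace IsAtomicWithTop

variable {μ : Measure ℝ} {k : ℕ} {q : Fin (k + 1) → ℝ}

theorem measure_eq_zero (hμ : IsAtomicWithTop μ q) {s : Set ℝ} (hs : ∀ i, q i ∉ s) : μ s = 0 :=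
  measure_mono_null (fun x hx => by rintro ⟨i, rfl⟩; exact hs i hx) hμ.concentrated

theorem cdf_eq_of_forall_notMem (hμ : IsAtomicWithTop μ q) {a b : ℝ} (hab : a ≤ b)
    (h : ∀ i, q i ∉ Ioc a b) : cdf μ b = cdf μ a := by
  have := hμ.isProbabilityMeasure
  rw [cdf_eq_real, cdf_eq_real, ← Iic_union_Ioc_eq_Iic hab, measureReal_def, measureReal_def]
  congr 1
  refine le_antisymm ((measure_union_le _ _).trans_eq ?_) (measure_mono subset_union_left)
  rw [hμ.measure_eq_zero h, add_zero]

theorem cdf_of_lt (hμ : IsAtomicWithTop μ q) {r : ℝ} (hr : r < q 0) : cdf μ r = 0 := by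
  have := hμ.isProbabilityMeasure
  rw [cdf_eq_real, measureReal_def, hμ.measure_eq_zero, ENNReal.toReal_zero]
  exact fun i hi => absurd (hr.trans_le (hμ.strictMono.monotone (Fin.zero_le i))) (not_lt.2 hi)

theorem not_mem_Ioo_succ (hμ : IsAtomicWithTop μ q) (l : Fin k) (i : Fin (k + 1)) :
    q i ∉ Ioo (q l.castSucc) (q l.succ) := by
  rintro ⟨h1, h2⟩
  have h1 := hμ.strictMono.lt_iff_lt.1 h1
  have h2 := hμ.strictMono.lt_iff_lt.1 h2
  exact absurd (Fin.castSucc_lt_iff_succ_le.1 h1) (not_le.2 h2)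

theorem cdf_eq_of_mem (hμ : IsAtomicWithTop μ q) (l : Fin k) {r : ℝ}
    (hr : r ∈ Ico (q l.castSucc) (q l.succ)) : cdf μ r = cdf μ (q l.castSucc) :=
  hμ.cdf_eq_of_forall_notMem hr.1 fun i hi =>
    hμ.not_mem_Ioo_succ l i ⟨hi.1, hi.2.trans_lt hr.2⟩

theorem cdf_strictMono (hμ : IsAtomicWithTop μ q) : StrictMono fun i => cdf μ (q i) := by
  intro i j hij
  have := hμ.isProbabilityMeasure
  have hq := hμ.strictMono hij
  have h1 : μ (Iic (q i)) + μ {q j} ≤ μ (Iic (q j)) := by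
    rw [← measure_union (by simpa using hq) (measurableSet_singleton _)]
    refine measure_mono (union_subset (Iic_subset_Iic.2 hq.le) (by simp))
  simp only [cdf_eq_real, measureReal_def]
  refine (ENNReal.toReal_lt_toReal (measure_ne_top _ _) (measure_ne_top _ _)).2
    (lt_of_lt_of_le ?_ h1)
  exact ENNReal.lt_add_right (measure_ne_top _ _) (hμ.atom_pos j).ne'

theorem cdf_pos (hμ : IsAtomicWithTop μ q) (i : Fin (k + 1)) : 0 < cdf μ (q i) := by
  have := hμ.isProbabilityMeasure
  rw [cdf_eq_real, measureReal_def]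
  exact ENNReal.toReal_pos ((hμ.atom_pos i).trans_le (measure_mono (by simp))).ne'
    (measure_ne_top _ _)

theorem cdf_last (hμ : IsAtomicWithTop μ q) : cdf μ (q (Fin.last k)) = 1 := by
  have := hμ.isProbabilityMeasure
  rw [cdf_eq_real, measureReal_def, (prob_compl_eq_zero_iff measurableSet_Iic).1, ENNReal.toReal_one]
  refine hμ.measure_eq_zero fun i => ?_
  simpa using hμ.strictMono.monotone (Fin.le_last i)

theorem mem_Icc (hμ : IsAtomicWithTop μ q) (i : Fin (k + 1)) : q i ∈ Icc (0 : ℝ) 1 :=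
  ⟨hμ.nonneg.trans (hμ.strictMono.monotone (Fin.zero_le i)),
    (hμ.strictMono.monotone (Fin.le_last i)).trans_eq hμ.last_eq_one⟩

end IsAtomicWithTop

/-! ### Solving the Parisi equation downwards from `1` -/

/-- `f` solves the Parisi equation on `[a,1] × ℝ`. -/
structure SolvesFrom (μ : Measure ℝ) (g ψ : ℝ → ℝ) (a : ℝ) (f : ℝ → ℝ → ℝ) : Prop where
  continuousOn : ContinuousOn (fun p : ℝ × ℝ => f p.1 p.2) (Icc a 1 ×ˢ univ)
  boundedDerivs : ∃ K₁ K₂, ∀ q ∈ Icc a 1, BoundedDerivs (f q) K₁ K₂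
  equation : ∀ q ∈ Ioo a 1, μ {q} = 0 → ∀ y,
    DifferentiableAt ℝ (fun r => f r y) q ∧
      deriv (fun r => f r y) q
        + deriv g q / 2 * (deriv (deriv (f q)) y + cdf μ q * (deriv (f q) y) ^ 2) = 0
  boundary : f 1 = ψ

theorem SolvesFrom.isParisiSolution {μ : Measure ℝ} {g ψ : ℝ → ℝ} {f : ℝ → ℝ → ℝ}
    (h : SolvesFrom μ g ψ 0 f) : IsParisiSolution μ g ψ f := by
  obtain ⟨K₁, K₂, hK⟩ := h.boundedDerivs
  exact ⟨h.continuousOn, fun q hq => (hK q hq).contDiff, ⟨K₁, fun q hq => (hK q hq).deriv_le⟩,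
    ⟨K₂, fun q hq => (hK q hq).deriv_deriv_le⟩, h.equation, fun y => by rw [h.boundary]⟩

theorem IsParisiSolution.solvesFrom {μ : Measure ℝ} {g ψ : ℝ → ℝ} {f : ℝ → ℝ → ℝ}
    (h : IsParisiSolution μ g ψ f) : SolvesFrom μ g ψ 0 f := by
  obtain ⟨K₁, hK₁⟩ := h.deriv_bounded
  obtain ⟨K₂, hK₂⟩ := h.deriv_deriv_bounded
  exact ⟨h.continuousOn, ⟨K₁, K₂, fun q hq => ⟨h.contDiff q hq, hK₁ q hq, hK₂ q hq⟩⟩, h.equation,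
    funext h.boundary⟩

/-- Extend `f` from `[b,1]` downwards by the Hopf–Cole semigroup. -/
def extendDown (g : ℝ → ℝ) (m b : ℝ) (f : ℝ → ℝ → ℝ) (r y : ℝ) : ℝ :=
  if b ≤ r then f r y else hopfCole m (f b) (g b - g r) y

theorem extendDown_of_le {g : ℝ → ℝ} {m b : ℝ} {f : ℝ → ℝ → ℝ} {r : ℝ} (hr : b ≤ r) :
    extendDown g m b f r = f r := by ext y; simp [extendDown, hr]

theorem extendDown_of_ge {g : ℝ → ℝ} {m b : ℝ} {f : ℝ → ℝ → ℝ} {r : ℝ} (hr : r ≤ b) :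
    extendDown g m b f r = hopfCole m (f b) (g b - g r) := by
  ext y
  unfold extendDown
  split_ifs with h
  · obtain rfl := le_antisymm hr h
    rw [sub_self, hopfCole_zero_time]
  · rfl

/-- In the time `v = g b - g r` one has `∂_r = -g'(r) ∂_v`, which turns the flow equation into the
Parisi equation with constant `x = m`. The two pieces need only match continuously at `b`: an atom
is exempt from the equation, and `1` is outside the open interval. -/
theorem solvesFrom_extendDown {μ : Measure ℝ} {g ψ : ℝ → ℝ} (hg : ContDiffOn ℝ 1 g (Icc 0 1))
    (hg_mono : StrictMonoOn g (Icc 0 1)) {a b m : ℝ} (ha : 0 ≤ a) (hab : a ≤ b) (hb : b ≤ 1)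
    (hm : 0 ≤ m) (hcdf : ∀ r ∈ Ioo a b, cdf μ r = m) (hatom : b = 1 ∨ μ {b} ≠ 0)
    {f : ℝ → ℝ → ℝ} (hf : SolvesFrom μ g ψ b f) :
    SolvesFrom μ g ψ a (extendDown g m b f) := by
  obtain ⟨K₁, K₂, hK⟩ := hf.boundedDerivs
  obtain ⟨K₃, hT⟩ := exists_isHopfColeFlow (hK b ⟨le_rfl, hb⟩) hm
  refine ⟨?_, ⟨K₁, max K₂ K₃, fun r hr => ?_⟩, fun r hr hμr y => ?_, ?_⟩
  · have hsplit : Icc a 1 ×ˢ (univ : Set ℝ) = Icc b 1 ×ˢ univ ∪ Icc a b ×ˢ univ := by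
      rw [← union_prod, union_comm, Icc_union_Icc_eq_Icc hab hb]
    rw [hsplit]
    refine ContinuousOn.union_of_isClosed ?_ ?_ (isClosed_Icc.prod isClosed_univ)
      (isClosed_Icc.prod isClosed_univ)
    · refine hf.continuousOn.congr fun p hp => ?_
      rw [extendDown_of_le hp.1.1]
    · have : ContinuousOn (fun p : ℝ × ℝ => hopfCole m (f b) (g b - g p.1) p.2)
          (Icc a b ×ˢ univ) := by
        refine hT.continuous.comp_continuousOn (f := fun p : ℝ × ℝ => (g b - g p.1, p.2)) ?_
        refine ContinuousOn.prodMk (continuousOn_const.sub ?_) continuousOn_snd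
        exact hg.continuousOn.comp continuousOn_fst fun p hp =>
          ⟨ha.trans hp.1.1, hp.1.2.trans hb⟩
      refine this.congr fun p hp => ?_
      rw [extendDown_of_ge hp.1.2]
  · rcases le_total b r with h | h
    · rw [extendDown_of_le h]
      have := hK r ⟨h, hr.2⟩
      exact ⟨this.1, this.2, fun y => (this.3 y).trans (le_max_left _ _)⟩
    · rw [extendDown_of_ge h]
      have := hT.boundedDerivs (g b - g r)
      exact ⟨this.1, this.2, fun y => (this.3 y).trans (le_max_right _ _)⟩
  · rcases lt_trichotomy r b with h | h | h
    · have hr01 : r ∈ Ioo (0 : ℝ) 1 := ⟨ha.trans_lt hr.1, hr.2⟩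
      have hgr : HasDerivAt g (deriv g r) r :=
        (((hg.contDiffAt (Icc_mem_nhds hr01.1 hr01.2)).differentiableAt (by norm_num))).hasDerivAt
      have hv : 0 < g b - g r := sub_pos.2
        (hg_mono ⟨hr01.1.le, hr01.2.le⟩ ⟨ha.trans hab, hb⟩ h)
      have hd := (hT.equation _ hv y).comp r (hgr.const_sub (g b))
      have hloc : (fun r => extendDown g m b f r y)
          =ᶠ[𝓝 r] (fun v => hopfCole m (f b) v y) ∘ fun x => g b - g x := by
        filter_upwards [Iio_mem_nhds h] with s hs
        rw [extendDown_of_ge (le_of_lt hs)]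
        rfl
      have hd' := hd.congr_of_eventuallyEq hloc
      refine ⟨hd'.differentiableAt, ?_⟩
      rw [hd'.deriv, hcdf r ⟨hr.1, h⟩, extendDown_of_ge h.le]
      ring
    · subst h
      exact absurd hμr (hatom.resolve_left hr.2.ne)
    · have hloc : (fun s => extendDown g m b f s y) =ᶠ[𝓝 r] fun s => f s y := by
        filter_upwards [Ioi_mem_nhds h] with s hs
        rw [extendDown_of_le (le_of_lt hs)]
      have := hf.equation r ⟨h, hr.2⟩ hμr y
      rw [extendDown_of_le h.le, hloc.deriv_eq]
      exact ⟨this.1.congr_of_eventuallyEq hloc, this.2⟩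
  · rw [extendDown_of_le hb, hf.boundary]

/-- The Parisi equation has a solution, given by the Hopf–Cole recursion between the atoms. -/
theorem exists_isParisiSolution {μ : Measure ℝ} {k : ℕ} {q : Fin (k + 1) → ℝ}
    (hμ : IsAtomicWithTop μ q) {g ψ : ℝ → ℝ} (hg : ContDiffOn ℝ 1 g (Icc 0 1))
    (hg_mono : StrictMonoOn g (Icc 0 1)) {K₁ K₂ : ℝ} (hψ : BoundedDerivs ψ K₁ K₂) :
    ∃ f, IsParisiSolution μ g ψ f ∧
      (∀ l : Fin k, f (q l.castSucc) = hopfCole (cdf μ (q l.castSucc)) (f (q l.succ))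
        (g (q l.succ) - g (q l.castSucc))) ∧
      f 0 = hopfCole 0 (f (q 0)) (g (q 0) - g 0) := by
  have key : ∀ i : Fin (k + 1), ∃ f, SolvesFrom μ g ψ (q i) f ∧ ∀ l : Fin k, i ≤ l.castSucc →
      f (q l.castSucc) = hopfCole (cdf μ (q l.castSucc)) (f (q l.succ))
        (g (q l.succ) - g (q l.castSucc)) := by
    intro i
    induction i using Fin.reverseInduction with
    | last =>
      refine ⟨fun _ => ψ, ?_, fun l hl => absurd hl (not_le.2 (Fin.castSucc_lt_last l))⟩
      rw [hμ.last_eq_one]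
      refine ⟨?_, ⟨K₁, K₂, fun _ _ => hψ⟩, fun r hr => by simp at hr, rfl⟩
      exact (hψ.contDiff.continuous.comp continuous_snd).continuousOn
    | cast i ih =>
      obtain ⟨f, hf, hrec⟩ := ih
      refine ⟨extendDown g (cdf μ (q i.castSucc)) (q i.succ) f,
        solvesFrom_extendDown hg hg_mono (hμ.mem_Icc _).1
          (hμ.strictMono i.castSucc_lt_succ).le (hμ.mem_Icc _).2 (hμ.cdf_pos _).le
          (fun r hr => hμ.cdf_eq_of_mem i ⟨hr.1.le, hr.2⟩) (Or.inr (hμ.atom_pos _).ne') hf,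
        fun l hl => ?_⟩
      have hsucc : q i.succ ≤ q l.succ :=
        hμ.strictMono.monotone (Fin.succ_le_succ_iff.2 (Fin.castSucc_le_castSucc_iff.1 hl))
      rw [extendDown_of_le hsucc]
      rcases hl.eq_or_lt with h | h
      · obtain rfl := Fin.castSucc_injective _ h
        rw [extendDown_of_ge (hμ.strictMono i.castSucc_lt_succ).le]
      · have h' : i.succ ≤ l.castSucc := Fin.castSucc_lt_iff_succ_le.1 h
        rw [extendDown_of_le (hμ.strictMono.monotone h'), hrec l h']
  obtain ⟨f, hf, hrec⟩ := key 0
  have h0 := hμ.mem_Icc 0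
  -- Below the lowest atom the distribution function is `0`, so the last extension is the pure heat
  -- semigroup. If `q 0 = 0` it is trivial.
  refine ⟨extendDown g 0 (q 0) f, (solvesFrom_extendDown hg hg_mono le_rfl h0.1 h0.2 le_rfl
    (fun r hr => hμ.cdf_of_lt hr.2) (Or.inr (hμ.atom_pos _).ne') hf).isParisiSolution,
    fun l => ?_, ?_⟩
  · rw [extendDown_of_le (hμ.strictMono.monotone (Fin.zero_le _)),
      extendDown_of_le (hμ.strictMono.monotone (Fin.zero_le _)), hrec l (Fin.zero_le _)]
  · rw [extendDown_of_le le_rfl, extendDown_of_ge h0.1]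

/-! ### Uniqueness for the Parisi equation -/

/-- If `w₂` were positive, the second derivative test would make the point a local minimum as well;
`w` would be locally constant and `w₂ = 0`. -/
theorem deriv_deriv_nonpos_of_isLocalMax {w w₁ : ℝ → ℝ} {w₂ y : ℝ}
    (h1 : ∀ y, HasDerivAt w (w₁ y) y) (h2 : HasDerivAt w₁ w₂ y) (hmax : IsLocalMax w y) :
    w₂ ≤ 0 := by
  by_contra! hpos
  have e1 : deriv w = w₁ := funext fun y => (h1 y).deriv
  have hmin : IsLocalMin w y := by
    refine isLocalMin_of_deriv_deriv_pos (by rw [e1, h2.deriv]; exact hpos) ?_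
      (h1 y).continuousAt
    exact hmax.deriv_eq_zero
  have hconst : w =ᶠ[𝓝 y] fun _ => w y := by
    filter_upwards [hmax, hmin] with z ha hb
    exact le_antisymm ha hb
  have h3 : deriv (deriv w) y = 0 := by
    have : deriv w =ᶠ[𝓝 y] fun _ => 0 := by
      refine hconst.deriv.trans ?_
      simp
    rw [this.deriv_eq]; simp
  rw [e1, h2.deriv] at h3
  exact hpos.ne' h3

/-- Only slopes to the right are compared, because the maximum over a time interval may sit at its
left end. -/
theorem deriv_nonpos_of_forall_le {w : ℝ → ℝ} {w' r b : ℝ} (h : HasDerivAt w w' r) (hrb : r < b)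
    (hle : ∀ s ∈ Ioo r b, w s ≤ w r) : w' ≤ 0 := by
  have h1 : Tendsto (slope w r) (𝓝[>] r) (𝓝 w') :=
    h.tendsto_slope.mono_left (nhdsWithin_mono _ fun x hx => ne_of_gt hx)
  refine le_of_tendsto h1 ?_
  filter_upwards [Ioo_mem_nhdsGT hrb] with s hs
  rw [slope_def_field]
  exact div_nonpos_of_nonpos_of_nonneg (by linarith [hle s hs]) (by linarith [hs.1])

/-- The algebra of the maximum principle: at a positive maximum of
`f - h - ε ((1 + y²) e^{A (g b - g r)} + (b - r))` the equation is violated. -/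
theorem maximum_principle_algebra {ft ht f1 h1 f2 h2 gp x K ε E y : ℝ} (hε : 0 < ε) (hE : 0 < E)
    (hgp : 0 ≤ gp) (hx0 : 0 ≤ x) (hx1 : x ≤ 1) (hf1 : |f1| ≤ K) (hh1 : |h1| ≤ K)
    (eqf : ft + gp / 2 * (f2 + x * f1 ^ 2) = 0) (eqh : ht + gp / 2 * (h2 + x * h1 ^ 2) = 0)
    (hd1 : f1 - h1 - ε * (2 * y * E) = 0) (hd2 : f2 - h2 - ε * (2 * E) ≤ 0)
    (hdt : ft - ht + ε * ((1 + K) * gp * ((1 + y ^ 2) * E) + 1) ≤ 0) : False := by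
  have hK : 0 ≤ K := (abs_nonneg _).trans hf1
  -- The nonlinearity contributes `x (f1 + h1)(f1 - h1)`, where `f1 - h1 = 2 ε y E` at the maximum;
  -- `2|y| ≤ 1 + y²` brings it under the growth of the barrier.
  have h3 : x * (f1 + h1) * (2 * y) ≤ 2 * K * (1 + y ^ 2) := by
    have a1 : |x * (f1 + h1)| ≤ 2 * K := by
      rw [abs_mul, abs_of_nonneg hx0]
      have := (abs_add_le f1 h1)
      nlinarith [abs_nonneg (f1 + h1)]
    have a2 : |2 * y| ≤ 1 + y ^ 2 := by
      rw [abs_le]; constructor <;> nlinarith [sq_nonneg (y - 1), sq_nonneg (y + 1)]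
    calc x * (f1 + h1) * (2 * y) ≤ |x * (f1 + h1) * (2 * y)| := le_abs_self _
      _ = |x * (f1 + h1)| * |2 * y| := abs_mul _ _
      _ ≤ 2 * K * (1 + y ^ 2) := mul_le_mul a1 a2 (abs_nonneg _) (by linarith)
  have h4 : f2 - h2 + x * (f1 ^ 2 - h1 ^ 2) ≤ ε * E * (2 + 2 * K * (1 + y ^ 2)) := by
    have e : x * (f1 ^ 2 - h1 ^ 2) = ε * E * (x * (f1 + h1) * (2 * y)) := by
      linear_combination (x * (f1 + h1)) * hd1
    rw [e]
    nlinarith [mul_le_mul_of_nonneg_left h3 (mul_pos hε hE).le]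
  have h5 := mul_le_mul_of_nonneg_left h4 (half_pos one_pos).le
  have h6 := mul_le_mul_of_nonneg_left h5 hgp
  -- After cancellation the inequalities leave `ε + gp ε E y² ≤ 0`. The strict term `ε` comes from
  -- `b - r` in the barrier and covers the case `gp = 0`.
  have h7 : 0 ≤ gp * (ε * E) * y ^ 2 := by positivity
  nlinarith

/-- The difference of two solutions grows at most linearly in `y`, since their `y`-derivatives are
bounded. Subtracting `ε` times a quadratic barrier confines a positive maximum to a compact box, off
the edges `|y| = R` and the final time `b`; there the equation is violated. Then `ε → 0`. -/
theorem SolvesFrom.le_of_eq_right {μ : Measure ℝ} [IsProbabilityMeasure μ] {g ψ : ℝ → ℝ}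
    (hg : ContDiffOn ℝ 1 g (Icc 0 1)) (hg_mono : StrictMonoOn g (Icc 0 1))
    {f h : ℝ → ℝ → ℝ} (hf : SolvesFrom μ g ψ 0 f) (hh : SolvesFrom μ g ψ 0 h) {a b : ℝ}
    (ha : 0 ≤ a) (hb : b ≤ 1) (hatom : ∀ r ∈ Ioo a b, μ {r} = 0) (hfh : f b = h b)
    {r : ℝ} (hr : r ∈ Ioo a b) (y : ℝ) : f r y ≤ h r y := by
  obtain ⟨K, Kf₂, hKf⟩ : ∃ K K₂, ∀ q ∈ Icc (0 : ℝ) 1, BoundedDerivs (f q) K K₂ :=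
    hf.boundedDerivs
  obtain ⟨K', Kh₂, hKh⟩ := hh.boundedDerivs
  set L := max K K' with hL
  have hL0 : 0 ≤ L := (hKf 0 (by simp)).nonneg.trans (le_max_left _ _)
  have hsub : ∀ {s}, s ∈ Icc r b → s ∈ Icc (0 : ℝ) 1 := fun {s} hs =>
    ⟨ha.trans (hr.1.le.trans hs.1), hs.2.trans hb⟩
  have hfc0 : ContinuousOn (fun p : ℝ × ℝ => f p.1 p.2 - h p.1 p.2) (Icc 0 1 ×ˢ univ) :=
    hf.continuousOn.sub hh.continuousOn
  obtain ⟨C, hC⟩ : ∃ C, ∀ s ∈ Icc (0 : ℝ) 1, |f s 0 - h s 0| ≤ C := by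
    refine isCompact_Icc.exists_bound_of_continuousOn (f := fun s => f s 0 - h s 0) ?_
    exact hfc0.comp (f := fun s : ℝ => (s, (0 : ℝ))) (by fun_prop) fun s hs => ⟨hs, mem_univ _⟩
  have hC0 : 0 ≤ C := (abs_nonneg _).trans (hC 0 (by simp))
  have hlin : ∀ s ∈ Icc (0 : ℝ) 1, ∀ z, f s z - h s z ≤ C + 2 * L * |z| := fun s hs z => by
    have e1 := (abs_le.1 ((hKf s hs).abs_sub_le 0 z)).2
    have e2 := (abs_le.1 ((hKh s hs).abs_sub_le 0 z)).1
    have e3 := (abs_le.1 (hC s hs)).2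
    simp only [sub_zero] at e1 e2
    have e4 := mul_le_mul_of_nonneg_right (le_max_left K K') (abs_nonneg z)
    have e5 := mul_le_mul_of_nonneg_right (le_max_right K K') (abs_nonneg z)
    rw [← hL] at e4 e5
    linarith
  -- The rate `1 + L` makes the decay of the exponential beat both the diffusion term and the
  -- nonlinearity, which is Lipschitz with a constant controlled by `L`.
  let B : ℝ → ℝ → ℝ := fun s z => (1 + z ^ 2) * Real.exp ((1 + L) * (g b - g s)) + (b - s)
  suffices hε : ∀ ε > 0, f r y - h r y ≤ ε * B r y by
    have hB : Tendsto (fun ε => ε * B r y) (𝓝[>] 0) (𝓝 0) := by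
      have : Tendsto (fun ε : ℝ => ε * B r y) (𝓝 0) (𝓝 (0 * B r y)) :=
        (continuous_mul_const _).tendsto _
      rw [zero_mul] at this
      exact this.mono_left nhdsWithin_le_nhds
    have := ge_of_tendsto hB (by filter_upwards [self_mem_nhdsWithin] with ε h using hε ε h)
    linarith
  intro ε hε
  by_contra! hlt
  -- With this radius `C + 2 L R ≤ ε R² < ε (1 + R²)`, so the barrier dominates the difference at
  -- `|z| = R`, and `y` lies in the box.
  set R := max (max 1 ((C + 2 * L) / ε)) |y| with hR
  have hR1 : 1 ≤ R := (le_max_left _ _).trans (le_max_left _ _)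
  have hRy : |y| ≤ R := le_max_right _ _
  have hRC : C + 2 * L ≤ ε * R := by
    rw [← div_le_iff₀' hε]; exact (le_max_right _ _).trans (le_max_left _ _)
  let w : ℝ × ℝ → ℝ := fun p => f p.1 p.2 - h p.1 p.2 - ε * B p.1 p.2
  have hw : ContinuousOn w (Icc r b ×ˢ Icc (-R) R) := by
    have hgc : ContinuousOn (fun p : ℝ × ℝ => g p.1) (Icc r b ×ˢ Icc (-R) R) :=
      hg.continuousOn.comp continuousOn_fst fun p hp => hsub hp.1
    refine (hfc0.mono (prod_mono (fun s hs => hsub hs) (subset_univ _))).sub ?_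
    exact continuousOn_const.mul ((ContinuousOn.mul (by fun_prop)
      (continuousOn_const.mul (continuousOn_const.sub hgc)).rexp).add (by fun_prop))
  obtain ⟨⟨r₁, y₁⟩, ⟨hr₁, hy₁⟩, hmax⟩ := (isCompact_Icc.prod isCompact_Icc).exists_isMaxOn
    ⟨(r, y), ⟨⟨le_rfl, hr.2.le⟩, abs_le.1 hRy⟩⟩ hw
  simp only at hr₁ hy₁
  have hmax' : ∀ s ∈ Icc r b, ∀ z ∈ Icc (-R) R, w (s, z) ≤ w (r₁, y₁) := fun s hs z hz =>
    hmax (mk_mem_prod hs hz)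
  have hpos : 0 < w (r₁, y₁) := by
    refine lt_of_lt_of_le ?_ (hmax' r ⟨le_rfl, hr.2.le⟩ y (abs_le.1 hRy))
    simp only [w]; linarith
  have hg1 : ∀ s ∈ Icc r b, 1 ≤ Real.exp ((1 + L) * (g b - g s)) := fun s hs => by
    refine Real.one_le_exp (mul_nonneg (by linarith) (sub_nonneg.2 ?_))
    exact hg_mono.monotoneOn (hsub hs) (hsub ⟨hs.1.trans hs.2, le_rfl⟩) hs.2
  have hB1 : ∀ s ∈ Icc r b, ∀ z, 1 + z ^ 2 ≤ B s z := fun s hs z => by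
    have := mul_le_mul_of_nonneg_left (hg1 s hs) (by positivity : 0 ≤ 1 + z ^ 2)
    simp only [B]; linarith [hs.2]
  have hr₁b : r₁ < b := by
    refine lt_of_le_of_ne hr₁.2 fun e => ?_
    simp only [w, e, hfh] at hpos
    have := mul_le_mul_of_nonneg_left (hB1 b ⟨hr.2.le, le_rfl⟩ y₁) hε.le
    nlinarith [sq_nonneg y₁]
  have hy₁R : |y₁| < R := by
    refine lt_of_le_of_ne (abs_le.2 hy₁) fun e => ?_
    have a1 := hlin r₁ (hsub hr₁) y₁
    have a2 := mul_le_mul_of_nonneg_left (hB1 r₁ hr₁ y₁) hε.le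
    rw [← sq_abs, e] at a2
    rw [e] at a1
    simp only [w] at hpos
    nlinarith [mul_le_mul_of_nonneg_right hRC (by linarith : 0 ≤ R)]
  have hr₁01 : r₁ ∈ Ioo (0 : ℝ) 1 := ⟨(ha.trans_lt hr.1).trans_le hr₁.1, hr₁b.trans_le hb⟩
  have hr₁01' := Ioo_subset_Icc_self hr₁01
  have hμr₁ := hatom r₁ ⟨hr.1.trans_le hr₁.1, hr₁b⟩
  obtain ⟨df, ef⟩ := hf.equation r₁ hr₁01 hμr₁ y₁
  obtain ⟨dh, eh⟩ := hh.equation r₁ hr₁01 hμr₁ y₁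
  have hgd : HasDerivAt g (deriv g r₁) r₁ :=
    ((hg.contDiffAt (Icc_mem_nhds hr₁01.1 hr₁01.2)).differentiableAt (by norm_num)).hasDerivAt
  have hgp : 0 ≤ deriv g r₁ := by
    rw [← derivWithin_of_mem_nhds (Icc_mem_nhds hr₁01.1 hr₁01.2)]
    exact hg_mono.monotoneOn.derivWithin_nonneg
  set E := Real.exp ((1 + L) * (g b - g r₁)) with hE
  have dB1 : ∀ z, HasDerivAt (fun z => B r₁ z) (2 * z * E) z := fun z => by
    have := ((((hasDerivAt_pow 2 z).const_add 1).mul_const E).add_const (b - r₁))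
    exact this.congr_deriv (by push_cast; ring)
  have dBt : HasDerivAt (fun s => B s y₁)
      (-((1 + L) * deriv g r₁ * ((1 + y₁ ^ 2) * E) + 1)) r₁ := by
    have := ((((hgd.const_sub (g b)).const_mul (1 + L)).exp).const_mul (1 + y₁ ^ 2)).add
      ((hasDerivAt_id r₁).const_sub b)
    exact this.congr_deriv (by rw [hE]; ring)
  have dw1 : ∀ z, HasDerivAt (fun z => w (r₁, z))
      (deriv (f r₁) z - deriv (h r₁) z - ε * (2 * z * E)) z := fun z =>
    (((hKf r₁ hr₁01').hasDerivAt z).sub ((hKh r₁ hr₁01').hasDerivAt z)).sub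
      ((dB1 z).const_mul ε)
  have dw2 : HasDerivAt (fun z => deriv (f r₁) z - deriv (h r₁) z - ε * (2 * z * E))
      (deriv (deriv (f r₁)) y₁ - deriv (deriv (h r₁)) y₁ - ε * (2 * E)) y₁ := by
    refine (((hKf r₁ hr₁01').hasDerivAt_deriv y₁).sub ((hKh r₁ hr₁01').hasDerivAt_deriv y₁)).sub
      (HasDerivAt.const_mul ε ?_)
    exact (((hasDerivAt_id y₁).const_mul 2).mul_const E).congr_deriv (by ring)
  have hloc : IsLocalMax (fun z => w (r₁, z)) y₁ := by
    filter_upwards [Icc_mem_nhds (abs_lt.1 hy₁R).1 (abs_lt.1 hy₁R).2] with z hz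
    exact hmax' r₁ hr₁ z hz
  have dwt : HasDerivAt (fun s => w (s, y₁)) (deriv (fun s => f s y₁) r₁
      - deriv (fun s => h s y₁) r₁ - ε * -((1 + L) * deriv g r₁ * ((1 + y₁ ^ 2) * E) + 1)) r₁ :=
    (df.hasDerivAt.sub dh.hasDerivAt).sub (dBt.const_mul ε)
  have ht := deriv_nonpos_of_forall_le dwt hr₁b fun s hs =>
    hmax' s ⟨hr₁.1.trans hs.1.le, hs.2.le⟩ y₁ hy₁
  exact maximum_principle_algebra (K := L) hε (Real.exp_pos _) hgp (cdf_nonneg μ r₁)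
    (cdf_le_one μ r₁) (((hKf r₁ hr₁01').deriv_le y₁).trans (le_max_left _ _))
    (((hKh r₁ hr₁01').deriv_le y₁).trans (le_max_right _ _)) ef eh
    (hloc.hasDerivAt_eq_zero (dw1 y₁)) (deriv_deriv_nonpos_of_isLocalMax dw1 dw2 hloc)
    (by linarith)

theorem SolvesFrom.eqOn_of_eq_right {μ : Measure ℝ} [IsProbabilityMeasure μ] {g ψ : ℝ → ℝ}
    (hg : ContDiffOn ℝ 1 g (Icc 0 1)) (hg_mono : StrictMonoOn g (Icc 0 1))
    {f h : ℝ → ℝ → ℝ} (hf : SolvesFrom μ g ψ 0 f) (hh : SolvesFrom μ g ψ 0 h) {a b : ℝ}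
    (ha : 0 ≤ a) (hb : b ≤ 1) (hatom : ∀ r ∈ Ioo a b, μ {r} = 0) (hfh : f b = h b)
    {r : ℝ} (hr : r ∈ Icc a b) : f r = h r := by
  have hIoo : ∀ s ∈ Ioo a b, f s = h s := fun s hs => funext fun y =>
    le_antisymm (hf.le_of_eq_right hg hg_mono hh ha hb hatom hfh hs y)
      (hh.le_of_eq_right hg hg_mono hf ha hb hatom hfh.symm hs y)
  rcases hr.2.eq_or_lt with rfl | hrb
  · exact hfh
  rcases hr.1.eq_or_lt with rfl | har
  -- At the left end `a`, which may be an atom or `0`, the equality follows by continuity from the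
  -- right.
  · ext y
    have hmem : a ∈ Icc (0 : ℝ) 1 := ⟨ha, hr.2.trans hb⟩
    have hcont : ∀ {F : ℝ → ℝ → ℝ}, SolvesFrom μ g ψ 0 F →
        Tendsto (fun s => F s y) (𝓝[>] a) (𝓝 (F a y)) := fun {F} hF => by
      have h1 : ContinuousOn (fun s => F s y) (Icc 0 1) :=
        hF.continuousOn.comp (f := fun s : ℝ => (s, y)) (by fun_prop)
          fun s hs => ⟨hs, mem_univ _⟩
      refine (h1 a hmem).mono_left ?_
      rw [nhdsWithin_le_iff]
      filter_upwards [Ioo_mem_nhdsGT hrb] with s hs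
      exact ⟨ha.trans hs.1.le, hs.2.le.trans hb⟩
    refine tendsto_nhds_unique ((hcont hf).congr' ?_) (hcont hh)
    filter_upwards [Ioo_mem_nhdsGT hrb] with s hs
    rw [hIoo s hs]
  · exact hIoo r ⟨har, hrb⟩

theorem IsParisiSolution.eq {μ : Measure ℝ} {k : ℕ} {q : Fin (k + 1) → ℝ}
    (hμ : IsAtomicWithTop μ q) {g ψ : ℝ → ℝ} (hg : ContDiffOn ℝ 1 g (Icc 0 1))
    (hg_mono : StrictMonoOn g (Icc 0 1)) {f h : ℝ → ℝ → ℝ} (hf : IsParisiSolution μ g ψ f)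
    (hh : IsParisiSolution μ g ψ h) {r : ℝ} (hr : r ∈ Icc (0 : ℝ) 1) : f r = h r := by
  have := hμ.isProbabilityMeasure
  have Sf := hf.solvesFrom
  have Sh := hh.solvesFrom
  have key : ∀ i : Fin (k + 1), ∀ r ∈ Icc (q i) 1, f r = h r := by
    intro i
    induction i using Fin.reverseInduction with
    | last =>
      intro r hr
      rw [hμ.last_eq_one, Icc_self] at hr
      rw [hr, Sf.boundary, Sh.boundary]
    | cast i ih =>
      intro r hr
      rcases le_total (q i.succ) r with h1 | h1
      · exact ih r ⟨h1, hr.2⟩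
      · refine Sf.eqOn_of_eq_right hg hg_mono Sh (hμ.mem_Icc i.castSucc).1 (hμ.mem_Icc i.succ).2
          (fun s hs => hμ.measure_eq_zero fun j hj => ?_)
          (ih _ ⟨le_rfl, (hμ.mem_Icc _).2⟩) ⟨hr.1, h1⟩
        rw [mem_singleton_iff] at hj
        exact hμ.not_mem_Ioo_succ i j (hj ▸ hs)
  rcases le_total (q 0) r with h1 | h1
  · exact key 0 r ⟨h1, hr.2⟩
  · refine Sf.eqOn_of_eq_right hg hg_mono Sh le_rfl (hμ.mem_Icc 0).2
      (fun s hs => hμ.measure_eq_zero fun j hj => ?_) (key 0 _ ⟨le_rfl, (hμ.mem_Icc 0).2⟩)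
      ⟨hr.1, h1⟩
    rw [mem_singleton_iff] at hj
    have := hμ.strictMono.monotone (Fin.zero_le j)
    rw [hj] at this
    exact absurd hs.2 (not_lt.2 this)

/-! ### Laws on `[0,∞]` are determined by their Laplace transforms -/

/-- By Weierstrass, every continuous function is uniformly close to a polynomial on `[0,1]`, which
carries both measures. -/
theorem ext_of_moments {μ ν : Measure ℝ} [IsProbabilityMeasure μ] [IsProbabilityMeasure ν]
    (hμ : ∀ᵐ x ∂μ, x ∈ Icc (0 : ℝ) 1) (hν : ∀ᵐ x ∂ν, x ∈ Icc (0 : ℝ) 1)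
    (h : ∀ n : ℕ, ∫ x, x ^ n ∂μ = ∫ x, x ^ n ∂ν) : μ = ν := by
  have hpoly : ∀ (ρ : Measure ℝ) [IsProbabilityMeasure ρ], (∀ᵐ x ∂ρ, x ∈ Icc (0 : ℝ) 1) →
      ∀ p : Polynomial ℝ, Integrable (fun x => p.eval x) ρ ∧
        ∫ x, p.eval x ∂ρ = ∑ n ∈ Finset.range (p.natDegree + 1), p.coeff n * ∫ x, x ^ n ∂ρ := by
    intro ρ _ hρ p
    have hpow : ∀ n : ℕ, Integrable (fun x : ℝ => x ^ n) ρ := fun n => by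
      refine Integrable.of_bound (by fun_prop) 1 ?_
      filter_upwards [hρ] with x hx
      rw [Real.norm_eq_abs, abs_of_nonneg (pow_nonneg hx.1 n)]
      exact pow_le_one₀ hx.1 hx.2
    simp_rw [Polynomial.eval_eq_sum_range]
    refine ⟨integrable_finsetSum _ fun n _ => (hpow n).const_mul _, ?_⟩
    rw [integral_finsetSum _ fun n _ => (hpow n).const_mul _]
    simp_rw [integral_const_mul]
  refine ext_of_forall_integral_eq_of_IsFiniteMeasure fun f => ?_
  refine eq_of_abs_sub_le_all fun ε hε => ?_
  obtain ⟨p, hp⟩ := exists_polynomial_near_of_continuousOn 0 1 f f.continuous.continuousOn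
    (ε / 2) (half_pos hε)
  have hdiff : ∀ (ρ : Measure ℝ) [IsProbabilityMeasure ρ], (∀ᵐ x ∂ρ, x ∈ Icc (0 : ℝ) 1) →
      |∫ x, f x ∂ρ - ∫ x, p.eval x ∂ρ| ≤ ε / 2 := by
    intro ρ _ hρ
    rw [← integral_sub (f.integrable ρ) (hpoly ρ hρ p).1]
    have := norm_integral_le_of_norm_le_const (μ := ρ) (f := fun x => f x - p.eval x)
      (C := ε / 2) (by
        filter_upwards [hρ] with x hx
        rw [Real.norm_eq_abs, abs_sub_comm]
        exact (hp x hx).le)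
    simpa using this
  have e : ∫ x, p.eval x ∂μ = ∫ x, p.eval x ∂ν := by
    rw [(hpoly μ hμ p).2, (hpoly ν hν p).2]
    simp_rw [h]
  have h1 := abs_le.1 (hdiff μ hμ)
  have h2 := abs_le.1 (hdiff ν hν)
  rw [abs_le]
  constructor <;> linarith [h1.1, h1.2, h2.1, h2.2]

theorem integral_pow_map_expNeg {Ω : Type*} [MeasurableSpace Ω] (P : Measure Ω) {X : Ω → ℝ≥0∞}
    (hX : Measurable X) (n : ℕ) : ∫ x, x ^ n ∂(P.map fun ω => (expNeg (X ω)).toReal)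
      = (∫⁻ ω, expNeg (n * X ω) ∂P).toReal := by
  rw [integral_map (by fun_prop) (by fun_prop), ← integral_toReal (by fun_prop)
    (ae_of_all _ fun ω => (expNeg_ne_top _).lt_top)]
  congr 1
  ext ω
  rw [mul_comm, expNeg_mul_nat, ENNReal.toReal_pow]

/-- Under `x ↦ e^{-x}`, which is injective and sends `∞` to `0`, Laplace transforms at integers
become moments on `[0,1]`. The law is recovered by applying the inverse `negLog`. -/
theorem map_eq_of_laplace_eq {Ω Ω' : Type*} [MeasurableSpace Ω] [MeasurableSpace Ω']
    {P : Measure Ω} {P' : Measure Ω'} [IsProbabilityMeasure P] [IsProbabilityMeasure P']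
    {X : Ω → ℝ≥0∞} {Y : Ω' → ℝ≥0∞} (hX : Measurable X) (hY : Measurable Y)
    (h : ∀ n : ℕ, ∫⁻ ω, expNeg (n * X ω) ∂P = ∫⁻ ω, expNeg (n * Y ω) ∂P') :
    P.map X = P'.map Y := by
  have hU : Measurable fun x : ℝ≥0∞ => (expNeg x).toReal := by fun_prop
  have hmem : ∀ x : ℝ≥0∞, (expNeg x).toReal ∈ Icc (0 : ℝ) 1 := fun x =>
    ⟨ENNReal.toReal_nonneg, ENNReal.toReal_le_of_le_ofReal zero_le_one
      (by simpa using expNeg_le_one x)⟩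
  have hp1 : IsProbabilityMeasure (P.map fun ω => (expNeg (X ω)).toReal) :=
    Measure.isProbabilityMeasure_map (by fun_prop)
  have hp2 : IsProbabilityMeasure (P'.map fun ω => (expNeg (Y ω)).toReal) :=
    Measure.isProbabilityMeasure_map (by fun_prop)
  have key : P.map (fun ω => (expNeg (X ω)).toReal) = P'.map fun ω => (expNeg (Y ω)).toReal := by
    refine ext_of_moments ?_ ?_ fun n => ?_
    · exact (ae_map_iff (hU.comp hX).aemeasurable measurableSet_Icc).2
        (ae_of_all _ fun ω => hmem _)
    · exact (ae_map_iff (hU.comp hY).aemeasurable measurableSet_Icc).2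
        (ae_of_all _ fun ω => hmem _)
    · rw [integral_pow_map_expNeg P hX, integral_pow_map_expNeg P' hY, h]
  have hinv : ∀ x, negLog (ENNReal.ofReal (expNeg x).toReal) = x := fun x => by
    rw [ENNReal.ofReal_toReal (expNeg_ne_top x), negLog_expNeg]
  have := congrArg (Measure.map fun u : ℝ => negLog (ENNReal.ofReal u)) key
  rw [Measure.map_map (by fun_prop) (by fun_prop), Measure.map_map (by fun_prop) (by fun_prop)]
    at this
  simpa only [Function.comp_def, hinv] using this

/-! ### Logarithmic moments of stable laws -/

/-- For `t > 0` the integrand vanishes where `T = ∞`, so the transform bounds `P(T < ∞)` from below;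
as `t → 0` it tends to `1`. -/
theorem ae_ne_top_of_laplace_tendsto {Ω : Type*} [MeasurableSpace Ω] {P : Measure Ω}
    [IsProbabilityMeasure P] {T : Ω → ℝ≥0∞} (hT : Measurable T) {c : ℝ≥0∞} (hc : c ≠ ∞) {p : ℝ}
    (hp : 0 < p) (h : ∀ t : ℝ≥0∞, t ≠ ∞ → ∫⁻ ω, expNeg (t * T ω) ∂P = expNeg (c * t ^ p)) :
    ∀ᵐ ω ∂P, T ω ≠ ∞ := by
  have hms : MeasurableSet {ω | T ω ≠ ∞} := (hT (measurableSet_singleton ∞)).compl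
  have hle : ∀ n : ℕ, expNeg (c * ((n : ℝ≥0∞)⁻¹) ^ p) ≤ P {ω | T ω ≠ ∞} := by
    intro n
    -- For `n = 0` the inverse is `∞`, outside the range of `h`. The bound is then trivial unless `c
    -- = 0`, where `t = 1` serves.
    rcases Nat.eq_zero_or_pos n with rfl | hn
    · by_cases hc0 : c = 0
      · have h1 := h 1 (by simp)
        simp only [hc0, zero_mul, one_mul, expNeg_zero] at h1 ⊢
        rw [← h1, ← lintegral_indicator_one hms]
        refine lintegral_mono fun ω => ?_
        by_cases hω : T ω = ∞
        · simp [hω]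
        · rw [indicator_of_mem (show ω ∈ {ω | T ω ≠ ∞} from hω)]
          exact expNeg_le_one _
      · simp [hc0, hp]
    · rw [← h _ (by simpa using hn.ne'), ← lintegral_indicator_one hms]
      refine lintegral_mono fun ω => ?_
      by_cases hω : T ω = ∞
      · simp [hω]
      · rw [indicator_of_mem (show ω ∈ {ω | T ω ≠ ∞} from hω)]
        exact expNeg_le_one _
  have hlim : Tendsto (fun n : ℕ => expNeg (c * ((n : ℝ≥0∞)⁻¹) ^ p)) atTop (𝓝 1) := by
    have h1 : Tendsto (fun n : ℕ => ((n : ℝ≥0∞)⁻¹) ^ p) atTop (𝓝 (0 ^ p)) :=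
      (ENNReal.continuous_rpow_const.tendsto 0).comp ENNReal.tendsto_inv_nat_nhds_zero
    rw [ENNReal.zero_rpow_of_pos hp] at h1
    have h2 := ENNReal.Tendsto.const_mul h1 (Or.inr hc)
    rw [mul_zero] at h2
    simpa [Function.comp_def] using (continuous_expNeg.tendsto 0).comp h2
  have h1 : 1 ≤ P {ω | T ω ≠ ∞} := le_of_tendsto' hlim hle
  rw [ae_iff, show {ω | ¬T ω ≠ ∞} = {ω | T ω ≠ ∞}ᶜ from rfl, prob_compl_eq_zero_iff hms]
  exact le_antisymm prob_le_one h1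

theorem inv_le_lintegral_expNeg (x : ℝ≥0∞) :
    x⁻¹ ≤ ∫⁻ t in Ioi (0 : ℝ), expNeg (ENNReal.ofReal t * x) := by
  by_cases hx : x = ∞
  · simp [hx]
  by_cases hx0 : x = 0
  · simp [hx0]
  have hpos := ENNReal.toReal_pos hx0 hx
  have h1 : ∀ t ∈ Ioi (0 : ℝ), expNeg (ENNReal.ofReal t * x)
      = ENNReal.ofReal (Real.exp (-x.toReal * t)) := fun t ht => by
    have ht : 0 < t := ht
    conv_lhs => rw [← ENNReal.ofReal_toReal hx]
    rw [← ENNReal.ofReal_mul ht.le, expNeg_ofReal (by positivity)]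
    ring_nf
  rw [setLIntegral_congr_fun measurableSet_Ioi h1, ← ofReal_integral_eq_lintegral_ofReal
    (integrableOn_exp_mul_Ioi (by linarith) 0) (ae_of_all _ fun t => (Real.exp_pos _).le),
    integral_exp_mul_Ioi (by linarith)]
  conv_lhs => rw [← ENNReal.ofReal_toReal hx, ← ENNReal.ofReal_inv_of_pos hpos]
  refine ENNReal.ofReal_le_ofReal (le_of_eq ?_)
  simp

theorem abs_log_toReal_le {x : ℝ≥0∞} (hx0 : x ≠ 0) (hx : x ≠ ∞) {s : ℝ} (hs : 0 < s) :
    ENNReal.ofReal |Real.log x.toReal| ≤ x⁻¹ + ENNReal.ofReal s⁻¹ * x ^ s := by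
  have hpos := ENNReal.toReal_pos hx0 hx
  have e : x⁻¹ + ENNReal.ofReal s⁻¹ * x ^ s
      = ENNReal.ofReal (x.toReal⁻¹ + s⁻¹ * x.toReal ^ s) := by
    rw [ENNReal.ofReal_add (by positivity) (by positivity), ENNReal.ofReal_mul (by positivity),
      ENNReal.ofReal_inv_of_pos hpos, ← ENNReal.ofReal_rpow_of_pos hpos, ENNReal.ofReal_toReal hx]
  rw [e]
  refine ENNReal.ofReal_le_ofReal (abs_le.2 ⟨?_, ?_⟩)
  · have h1 := Real.log_le_sub_one_of_pos (inv_pos.2 hpos)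
    rw [Real.log_inv] at h1
    have : 0 ≤ s⁻¹ * x.toReal ^ s := by positivity
    linarith
  · have h1 := Real.log_le_rpow_div hpos.le hs
    have : 0 < x.toReal⁻¹ := by positivity
    rw [div_eq_inv_mul] at h1
    linarith

/-- For `s < 1`-type scaling with exponent `1`, `T^s` is proportional to `∫ (1 - e^{-rT}) s r^{-s-1}
dr`. Taking expectations inside gives `stableConst s p * c^{s/p}`, finite because `s < p`; since the
proportionality constant is nonzero, the moment is finite. -/
theorem lintegral_rpow_lt_top_of_laplace {Ω : Type*} [MeasurableSpace Ω] {P : Measure Ω}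
    [IsProbabilityMeasure P] {T : Ω → ℝ≥0∞} (hT : Measurable T) {c : ℝ≥0∞} (hc : c ≠ ∞) {p : ℝ}
    (h : ∀ t : ℝ≥0∞, t ≠ ∞ → ∫⁻ ω, expNeg (t * T ω) ∂P = expNeg (c * t ^ p))
    (hfin : ∀ᵐ ω ∂P, T ω ≠ ∞) {s : ℝ} (hs : 0 < s) (hsp : s < p) :
    ∫⁻ ω, T ω ^ s ∂P < ∞ := by
  have e1 : stableConst s 1 * ∫⁻ ω, T ω ^ s ∂P = stableConst s p * c ^ (s / p) := by
    rw [← lintegral_one_sub_expNeg_remIntensity hs (hs.trans hsp) hc,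
      ← lintegral_const_mul _ (by fun_prop)]
    have : ∀ᵐ ω ∂P, stableConst s 1 * T ω ^ s
        = ∫⁻ r, (1 - expNeg (ENNReal.ofReal r * T ω)) ∂remIntensity s := by
      filter_upwards [hfin] with ω hω
      have := lintegral_one_sub_expNeg_remIntensity hs one_pos hω
      simp only [ENNReal.rpow_one, div_one] at this
      rw [← this]
      simp_rw [mul_comm]
    rw [lintegral_congr_ae this, lintegral_lintegral_swap (by fun_prop)]
    refine lintegral_congr fun r => ?_
    rw [lintegral_sub (by fun_prop) (ne_top_of_le_ne_top ENNReal.one_ne_top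
      (lintegral_expNeg_le_one P _)) (ae_of_all _ fun ω => expNeg_le_one _),
      h _ ENNReal.ofReal_ne_top]
    simp
  by_contra htop
  rw [not_lt, top_le_iff] at htop
  rw [htop, ENNReal.mul_top (stableConst_pos hs 1).ne'] at e1
  exact (ENNReal.mul_lt_top (stableConst_lt_top hs hsp)
    (ENNReal.rpow_lt_top_of_nonneg (div_pos hs (hs.trans hsp)).le hc)).ne e1.symm

theorem lintegral_inv_lt_top_of_laplace {Ω : Type*} [MeasurableSpace Ω] {P : Measure Ω}
    [IsProbabilityMeasure P] {T : Ω → ℝ≥0∞} (hT : Measurable T) {c : ℝ≥0∞} (hc0 : c ≠ 0)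
    (hc : c ≠ ∞) {p : ℝ} (hp : 0 < p)
    (h : ∀ t : ℝ≥0∞, t ≠ ∞ → ∫⁻ ω, expNeg (t * T ω) ∂P = expNeg (c * t ^ p)) :
    ∫⁻ ω, (T ω)⁻¹ ∂P < ∞ := by
  refine (lintegral_mono fun ω => inv_le_lintegral_expNeg (T ω)).trans_lt ?_
  rw [lintegral_lintegral_swap (by fun_prop)]
  simp_rw [fun t : ℝ => h (ENNReal.ofReal t) ENNReal.ofReal_ne_top]
  have hpos := ENNReal.toReal_pos hc0 hc
  have h1 : ∀ t ∈ Ioi (0 : ℝ), expNeg (c * ENNReal.ofReal t ^ p)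
      = ENNReal.ofReal (Real.exp (-c.toReal * t ^ p)) := fun t ht => by
    have ht : 0 < t := ht
    conv_lhs => rw [← ENNReal.ofReal_toReal hc]
    rw [ENNReal.ofReal_rpow_of_pos ht, ← ENNReal.ofReal_mul hpos.le,
      expNeg_ofReal (by positivity), neg_mul]
  rw [setLIntegral_congr_fun measurableSet_Ioi h1]
  have hint : IntegrableOn (fun t : ℝ => Real.exp (-c.toReal * t ^ p)) (Ioi 0) := by
    -- The known value of the integral is a positive Gamma expression, so the function cannot be
    -- non-integrable.
    by_contra hni
    have h2 := integral_exp_neg_mul_rpow hp hpos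
    rw [integral_undef hni] at h2
    have h3 : 0 < Real.Gamma (1 / p + 1) := Real.Gamma_pos_of_pos (by positivity)
    have : 0 < c.toReal ^ (-1 / p) * Real.Gamma (1 / p + 1) := by positivity
    exact this.ne h2
  exact hint.setLIntegral_lt_top

theorem integrable_log_of_laplace {Ω : Type*} [MeasurableSpace Ω] {P : Measure Ω}
    [IsProbabilityMeasure P] {T : Ω → ℝ≥0∞} (hT : Measurable T) {c : ℝ≥0∞} (hc0 : c ≠ 0)
    (hc : c ≠ ∞) {p : ℝ} (hp : 0 < p)
    (h : ∀ t : ℝ≥0∞, t ≠ ∞ → ∫⁻ ω, expNeg (t * T ω) ∂P = expNeg (c * t ^ p)) :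
    (∀ᵐ ω ∂P, T ω ≠ 0 ∧ T ω ≠ ∞) ∧ Integrable (fun ω => Real.log (T ω).toReal) P := by
  have hfin := ae_ne_top_of_laplace_tendsto hT hc hp h
  have hinv := lintegral_inv_lt_top_of_laplace hT hc0 hc hp h
  have hne : ∀ᵐ ω ∂P, T ω ≠ 0 ∧ T ω ≠ ∞ := by
    filter_upwards [ae_lt_top hT.inv hinv.ne, hfin] with ω h1 h2
    exact ⟨by simpa using h1.ne, h2⟩
  refine ⟨hne, (Real.measurable_log.comp hT.ennreal_toReal).aestronglyMeasurable, ?_⟩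
  -- Any exponent strictly between `0` and `p` would do: that moment controls the positive part of
  -- the logarithm, the inverse moment the negative part.
  have hs : 0 < p / 2 := half_pos hp
  rw [hasFiniteIntegral_iff_norm]
  refine lt_of_le_of_lt (lintegral_mono_ae (g := fun ω => (T ω)⁻¹
    + ENNReal.ofReal (p / 2)⁻¹ * T ω ^ (p / 2)) ?_) ?_
  · filter_upwards [hne] with ω hω
    exact abs_log_toReal_le hω.1 hω.2 hs
  · rw [lintegral_add_left (by fun_prop), lintegral_const_mul _ (by fun_prop)]
    exact ENNReal.add_lt_top.2 ⟨hinv, ENNReal.mul_lt_top ENNReal.ofReal_lt_top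
      (lintegral_rpow_lt_top_of_laplace hT hc h hfin hs (half_lt_self hp))⟩

/-- If `S` has the Laplace transform of `e^F T` with `T` independent of `F` and stable, then
`E log S - E log T = E F`. -/
theorem integral_log_sub_of_laplace {Ω : Type*} [MeasurableSpace Ω] {P : Measure Ω}
    [IsProbabilityMeasure P] {S T : Ω → ℝ≥0∞} {F : Ω → ℝ} (hS : Measurable S) (hT : Measurable T)
    (hF : Measurable F) (hFi : Integrable F P) {c : ℝ≥0∞} (hc0 : c ≠ 0)
    (hc : c ≠ ∞) {p : ℝ} (hp : 0 < p)
    (hlT : ∀ t : ℝ≥0∞, t ≠ ∞ → ∫⁻ ω, expNeg (t * T ω) ∂P = expNeg (c * t ^ p))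
    (hlS : ∀ t : ℝ≥0∞, t ≠ ∞ → ∫⁻ ω, expNeg (t * S ω) ∂P
      = ∫⁻ ω, expNeg (c * t ^ p * ENNReal.ofReal (Real.exp (p * F ω))) ∂P) :
    (∀ᵐ ω ∂P, T ω ≠ 0 ∧ T ω ≠ ∞) ∧ (∀ᵐ ω ∂P, S ω ≠ 0 ∧ S ω ≠ ∞) ∧
      Integrable (fun ω => Real.log (S ω).toReal - Real.log (T ω).toReal) P ∧
      ∫ ω, (Real.log (S ω).toReal - Real.log (T ω).toReal) ∂P = ∫ ω, F ω ∂P := by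
  obtain ⟨hne, hlog⟩ := integrable_log_of_laplace hT hc0 hc hp hlT
  -- Independence of `T` and `F` on `Ω` is not assumed; the product space supplies an independent
  -- copy, and only the law of `S` matters.
  let Y : Ω × Ω → ℝ≥0∞ := fun z => ENNReal.ofReal (Real.exp (F z.1)) * T z.2
  have hY : Measurable Y := by fun_prop
  have hlaw : P.map S = (P.prod P).map Y := by
    refine map_eq_of_laplace_eq hS hY fun n => ?_
    rw [hlS _ (ENNReal.natCast_ne_top n), lintegral_prod _ (by fun_prop)]
    refine lintegral_congr fun ω => ?_
    simp only [Y, ← mul_assoc]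
    rw [hlT _ (ENNReal.mul_ne_top (ENNReal.natCast_ne_top n) ENNReal.ofReal_ne_top),
      ENNReal.mul_rpow_of_nonneg _ _ hp.le, ofReal_exp_rpow, mul_assoc]
  have hne2 : ∀ᵐ z ∂P.prod P, T z.2 ≠ 0 ∧ T z.2 ≠ ∞ :=
    Measure.quasiMeasurePreserving_snd.ae hne
  have hlogY : (fun z => Real.log (Y z).toReal)
      =ᵐ[P.prod P] fun z => F z.1 + Real.log (T z.2).toReal := by
    filter_upwards [hne2] with z hz
    rw [ENNReal.toReal_mul, ENNReal.toReal_ofReal (Real.exp_pos _).le,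
      Real.log_mul (Real.exp_pos _).ne' (ENNReal.toReal_pos hz.1 hz.2).ne', Real.log_exp]
  have hI1 : Integrable (fun z : Ω × Ω => F z.1) (P.prod P) := hFi.comp_fst P
  have hI2 : Integrable (fun z : Ω × Ω => Real.log (T z.2).toReal) (P.prod P) :=
    hlog.comp_snd P
  have hGm : Measurable fun x : ℝ≥0∞ => Real.log x.toReal := by fun_prop
  have hIY : Integrable (fun z => Real.log (Y z).toReal) (P.prod P) :=
    (hI1.add hI2).congr hlogY.symm
  have hIS : Integrable (fun ω => Real.log (S ω).toReal) P := by
    rw [← Function.comp_def (fun x : ℝ≥0∞ => Real.log x.toReal),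
      ← integrable_map_measure hGm.aestronglyMeasurable hS.aemeasurable, hlaw,
      integrable_map_measure hGm.aestronglyMeasurable hY.aemeasurable]
    exact hIY
  have hES : ∫ ω, Real.log (S ω).toReal ∂P = ∫ ω, F ω ∂P + ∫ ω, Real.log (T ω).toReal ∂P := by
    rw [← integral_map (f := fun x : ℝ≥0∞ => Real.log x.toReal) hS.aemeasurable
      hGm.aestronglyMeasurable, hlaw,
      integral_map hY.aemeasurable hGm.aestronglyMeasurable, integral_congr_ae hlogY,
      integral_add hI1 hI2, integral_fun_fst (f := F),
      integral_fun_snd (f := fun ω => Real.log (T ω).toReal)]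
    simp
  have hneS : ∀ᵐ ω ∂P, S ω ≠ 0 ∧ S ω ≠ ∞ := by
    have hms : MeasurableSet {x : ℝ≥0∞ | x ≠ 0 ∧ x ≠ ∞} :=
      (measurableSet_singleton 0).compl.inter (measurableSet_singleton ∞).compl
    rw [← ae_map_iff hS.aemeasurable hms, hlaw, ae_map_iff hY.aemeasurable hms]
    filter_upwards [hne2] with z hz
    exact ⟨mul_ne_zero (by simpa using Real.exp_pos _) hz.1,
      ENNReal.mul_ne_top ENNReal.ofReal_ne_top hz.2⟩
  refine ⟨hne, hneS, hIS.sub hlog, ?_⟩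
  rw [integral_sub hIS hlog, hES]
  ring

/-! ### Overlaps of zero-extended indices -/

/-- Extend a node of level `l` by zeros to an index. -/
def extendZero {k l : ℕ} (β : Fin l → ℕ) (i : Fin k) : ℕ :=
  if h : (i : ℕ) < l then β ⟨i, h⟩ else 0

/-- The first `n` entries of `α` and `α'` agree. -/
def Agree {k : ℕ} (α α' : Fin k → ℕ) (n : ℕ) : Prop := ∀ i : Fin k, (i : ℕ) < n → α i = α' i

theorem extendZero_self {k : ℕ} (α : Fin k → ℕ) : extendZero α = α := by
  ext i; simp [extendZero]

theorem extendZero_init {k l : ℕ} (β : Fin (l + 1) → ℕ) :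
    Agree (extendZero (k := k) β) (extendZero (Fin.init β)) l := fun i hi => by
  simp [extendZero, hi, hi.trans (Nat.lt_succ_self l), Fin.init]

theorem eq_of_agree_extendZero {k l : ℕ} (hl : l < k + 1) {β β' : Fin l → ℕ}
    (h : Agree (extendZero (k := k) β) (extendZero β') l) : β = β' := by
  ext i
  simpa [extendZero] using h ⟨i, i.2.trans_le (Nat.lt_succ_iff.1 hl)⟩ i.2

theorem exists_agree_level {k : ℕ} (α α' : Fin k → ℕ) (l l' : ℕ) :
    ∃ n, n ≤ l ∧ n ≤ l' ∧ Agree α α' n ∧ (n = l ∨ n = l' ∨ ¬ Agree α α' (n + 1)) := by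
  classical
  have h1 := Nat.findGreatest_le (P := Agree α α') (min l l')
  have h2 : Agree α α' (Nat.findGreatest (Agree α α') (min l l')) :=
    Nat.findGreatest_spec (P := Agree α α') (Nat.zero_le _) fun i hi => absurd hi (Nat.not_lt_zero _)
  refine ⟨_, h1.trans (min_le_left _ _), h1.trans (min_le_right _ _), h2, ?_⟩
  rcases h1.eq_or_lt with h | h
  · rcases min_choice l l' with e | e
    · exact Or.inl (h.trans e)
    · exact Or.inr (Or.inl (h.trans e))
  · exact Or.inr (Or.inr (Nat.findGreatest_is_greatest (Nat.lt_succ_self _) h))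

/-- Here `n` is the level of the deepest common ancestor of two nodes of levels `l` and `l'`; their
covariance is thus `g` at the atom of that ancestor. -/
theorem min_overlap_eq {k : ℕ} {q : Fin (k + 1) → ℝ} (hq : Monotone q) {α α' : Fin k → ℕ}
    {l l' n : ℕ} (hl : l < k + 1) (hl' : l' < k + 1) (hnl : n ≤ l) (hnl' : n ≤ l')
    (hag : Agree α α' n) (hmax : n = l ∨ n = l' ∨ ¬ Agree α α' (n + 1)) :
    min (min (q ⟨l, hl⟩) (q ⟨l', hl'⟩)) (overlap q α α') = q ⟨n, hnl.trans_lt hl⟩ := by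
  refine le_antisymm ?_ (le_min (le_min (hq hnl) (hq hnl')) ?_)
  · rcases hmax with rfl | rfl | h
    · exact (min_le_left _ _).trans (min_le_left _ _)
    · exact (min_le_left _ _).trans (min_le_right _ _)
    · refine (min_le_right _ _).trans (Finset.sup'_le _ _ fun j hj => hq ?_)
      simp only [commonLevels, Finset.mem_filter, Finset.mem_univ, true_and] at hj
      by_contra hlt
      have hlt : n < (j : ℕ) := not_le.1 hlt
      exact h fun i hi => hj i (by omega)
  · exact Finset.le_sup' q (by simpa [commonLevels, Agree] using hag)

/-- Replacing a node of level `l' + 1` by its parent leaves the common ancestor with another node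
unchanged, unless that other node lies in its subtree. -/
theorem min_overlap_succ {k : ℕ} {q : Fin (k + 1) → ℝ} (hq : Monotone q) {α α' α'' : Fin k → ℕ}
    {l l' : ℕ} (hl : l < k + 1) (hl' : l' + 1 < k + 1) (hα : Agree α' α'' l')
    (hne : l' + 1 ≤ l → ¬ Agree α α' (l' + 1)) :
    min (min (q ⟨l, hl⟩) (q ⟨l' + 1, hl'⟩)) (overlap q α α')
      = min (min (q ⟨l, hl⟩) (q ⟨l', (Nat.lt_succ_self l').trans hl'⟩)) (overlap q α α'') := by
  obtain ⟨n, h1, h2, h3, h4⟩ := exists_agree_level α α'' l l'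
  have hag : Agree α α' n := fun i hi => (h3 i hi).trans (hα i (hi.trans_le h2)).symm
  rw [min_overlap_eq hq hl _ h1 h2 h3 h4, min_overlap_eq hq hl hl' h1 (h2.trans l'.le_succ) hag]
  by_cases hnl : n = l
  · exact Or.inl hnl
  refine Or.inr (Or.inr ?_)
  by_cases hnl' : n = l'
  · rw [hnl']
    exact hne (by omega)
  · exact fun h => (h4.resolve_left hnl).resolve_left hnl' fun i hi =>
      (h i hi).trans (hα i (by omega))

/-! ### The increments of the cavity field along the tree -/

/-- The value of the field at a node of level `l`. -/
def nodeField {Ω : Type*} {k : ℕ} (q : Fin (k + 1) → ℝ)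
    (κ : (Fin k → ℕ) → unitInterval → Ω → ℝ) (l : ℕ) (hl : l < k + 1) (β : Fin l → ℕ) (ω : Ω) : ℝ :=
  κ (extendZero β) (projIcc 0 1 zero_le_one (q ⟨l, hl⟩)) ω

/-- The increment of the field at a node of level `l`. -/
def increment {Ω : Type*} {k : ℕ} (q : Fin (k + 1) → ℝ)
    (κ : (Fin k → ℕ) → unitInterval → Ω → ℝ) : (l : ℕ) → l < k + 1 → (Fin l → ℕ) → Ω → ℝ
  | 0, hl, β, ω => nodeField q κ 0 hl β ω
  | l + 1, hl, β, ω =>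
    nodeField q κ (l + 1) hl β ω - nodeField q κ l ((Nat.lt_succ_self l).trans hl) (Fin.init β) ω

/-- The nodes of the levels `0, …, n - 1`. -/
abbrev Node (n : ℕ) : Type := (l : Fin n) × (Fin (l : ℕ) → ℕ)

section Field

variable {Ω : Type*} [MeasurableSpace Ω] {P : Measure Ω} {k : ℕ}
  {q : Fin (k + 1) → ℝ} {g : ℝ → ℝ} {κ : (Fin k → ℕ) → unitInterval → Ω → ℝ}

theorem IsCavityField.measurable_nodeField (h : IsCavityField q g κ P) (l : ℕ) (hl : l < k + 1)
    (β : Fin l → ℕ) : Measurable (nodeField q κ l hl β) := h.measurable _ _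

theorem IsCavityField.measurable_increment (h : IsCavityField q g κ P) (l : ℕ) (hl : l < k + 1)
    (β : Fin l → ℕ) : Measurable (increment q κ l hl β) := by
  cases l with
  | zero => exact h.measurable_nodeField 0 hl β
  | succ l => exact (h.measurable_nodeField _ _ _).sub (h.measurable_nodeField _ _ _)

theorem IsCavityField.memLp_nodeField (h : IsCavityField q g κ P) (l : ℕ) (hl : l < k + 1)
    (β : Fin l → ℕ) : MemLp (nodeField q κ l hl β) 2 P :=
  (h.gaussian.hasGaussianLaw_eval (extendZero β, projIcc 0 1 zero_le_one (q ⟨l, hl⟩))).memLp_two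

theorem IsCavityField.memLp_increment (h : IsCavityField q g κ P) (l : ℕ) (hl : l < k + 1)
    (β : Fin l → ℕ) : MemLp (increment q κ l hl β) 2 P := by
  cases l with
  | zero => exact h.memLp_nodeField 0 hl β
  | succ l => exact (h.memLp_nodeField _ _ _).sub (h.memLp_nodeField _ _ _)

theorem IsCavityField.covariance_nodeField (h : IsCavityField q g κ P)
    (hq : ∀ i, q i ∈ Icc (0 : ℝ) 1) {l l' : ℕ} (hl : l < k + 1) (hl' : l' < k + 1)
    (β : Fin l → ℕ) (β' : Fin l' → ℕ) :
    covariance (nodeField q κ l hl β) (nodeField q κ l' hl' β') P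
      = g (min (min (q ⟨l, hl⟩) (q ⟨l', hl'⟩)) (overlap q (extendZero β) (extendZero β'))) := by
  refine (h.covariance_eq (extendZero β) (extendZero β') (projIcc 0 1 zero_le_one (q ⟨l, hl⟩))
    (projIcc 0 1 zero_le_one (q ⟨l', hl'⟩))).trans ?_
  rw [projIcc_of_mem _ (hq _), projIcc_of_mem _ (hq _)]

theorem IsCavityField.isGaussianProcess_increment (h : IsCavityField q g κ P) :
    IsGaussianProcess (fun (n : Node (k + 1)) => increment q κ n.1 n.1.2 n.2) P := by
  classical
  refine IsGaussianProcess.of_isGaussianProcess h.gaussian fun ⟨⟨l, hl⟩, β⟩ => ?_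
  cases l with
  | zero =>
    exact ⟨{(extendZero β, projIcc 0 1 zero_le_one (q ⟨0, hl⟩))},
      ContinuousLinearMap.proj ⟨_, Finset.mem_singleton_self _⟩, fun ω => rfl⟩
  | succ l =>
    exact ⟨{(extendZero β, projIcc 0 1 zero_le_one (q ⟨l + 1, hl⟩)),
      (extendZero (Fin.init β), projIcc 0 1 zero_le_one (q ⟨l, (Nat.lt_succ_self l).trans hl⟩))},
      ContinuousLinearMap.proj ⟨_, Finset.mem_insert_self _ _⟩
        - ContinuousLinearMap.proj ⟨_, Finset.mem_insert_of_mem (Finset.mem_singleton_self _)⟩,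
      fun ω => rfl⟩

/-- A node outside the subtree of `β'` has the same covariance with `β'` as with its parent, so the
increment is uncorrelated with it. -/
theorem IsCavityField.covariance_nodeField_increment [IsProbabilityMeasure P]
    (h : IsCavityField q g κ P)
    (hq : ∀ i, q i ∈ Icc (0 : ℝ) 1) (hqm : Monotone q) {l l' : ℕ} (hl : l < k + 1)
    (hl' : l' + 1 < k + 1) (β : Fin l → ℕ) (β' : Fin (l' + 1) → ℕ)
    (hne : l' + 1 ≤ l → ¬ Agree (extendZero (k := k) β) (extendZero β') (l' + 1)) :
    covariance (nodeField q κ l hl β) (increment q κ (l' + 1) hl' β') P = 0 := by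
  have e : increment q κ (l' + 1) hl' β' = fun ω => nodeField q κ (l' + 1) hl' β' ω
      - nodeField q κ l' ((Nat.lt_succ_self l').trans hl') (Fin.init β') ω := rfl
  rw [e, covariance_fun_sub_right (h.memLp_nodeField _ _ _) (h.memLp_nodeField _ _ _)
    (h.memLp_nodeField _ _ _), h.covariance_nodeField hq, h.covariance_nodeField hq,
    min_overlap_succ hqm hl hl' (extendZero_init β') hne, sub_self]

theorem IsCavityField.covariance_increment_of_le [IsProbabilityMeasure P]
    (h : IsCavityField q g κ P)
    (hq : ∀ i, q i ∈ Icc (0 : ℝ) 1) (hqm : Monotone q) {n n' : Node (k + 1)} (hne : n ≠ n')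
    (hle : n.1 ≤ n'.1) :
    covariance (increment q κ n.1 n.1.2 n.2) (increment q κ n'.1 n'.1.2 n'.2) P = 0 := by
  obtain ⟨⟨l, hl⟩, β⟩ := n
  obtain ⟨⟨l', hl'⟩, β'⟩ := n'
  have hle : l ≤ l' := hle
  cases l' with
  | zero =>
    obtain rfl : l = 0 := Nat.le_zero.1 hle
    exact absurd (congrArg _ (Subsingleton.elim β β')) hne
  | succ l' =>
    have h1 : covariance (nodeField q κ l hl β) (increment q κ (l' + 1) hl' β') P = 0 := by
      refine h.covariance_nodeField_increment hq hqm hl hl' β β' fun hle' hag => hne ?_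
      obtain rfl : l = l' + 1 := le_antisymm hle hle'
      rw [eq_of_agree_extendZero hl hag]
    cases l with
    | zero => exact h1
    | succ l =>
      have e : increment q κ (l + 1) hl β = fun ω => nodeField q κ (l + 1) hl β ω
          - nodeField q κ l ((Nat.lt_succ_self l).trans hl) (Fin.init β) ω := rfl
      show covariance (increment q κ (l + 1) hl β) (increment q κ (l' + 1) hl' β') P = 0
      rw [e, covariance_fun_sub_left (h.memLp_nodeField _ _ _) (h.memLp_nodeField _ _ _)
        (h.memLp_increment _ _ _), h1,
        -- The parent has level `l < l' + 1`, so the subtree condition is vacuous.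
        h.covariance_nodeField_increment hq hqm _ hl' _ β' (fun hle' => by omega), sub_self]

/-- The increments are jointly Gaussian, being linear in the field, and pairwise uncorrelated, hence
independent. -/
theorem IsCavityField.iIndepFun_increment [IsProbabilityMeasure P] (h : IsCavityField q g κ P)
    (hq : ∀ i, q i ∈ Icc (0 : ℝ) 1) (hqm : Monotone q) :
    iIndepFun (fun (n : Node (k + 1)) => increment q κ n.1 n.1.2 n.2) P := by
  have hG : IsGaussianProcess (fun (p : (_ : Node (k + 1)) × Unit) ω =>
      increment q κ p.1.1 p.1.1.2 p.1.2 ω) P :=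
    h.isGaussianProcess_increment.comp_right fun p : (_ : Node (k + 1)) × Unit => p.1
  have := IsGaussianProcess.iIndepFun_of_covariance_eq_zero
    (X := fun (n : Node (k + 1)) (_ : Unit) => increment q κ n.1 n.1.2 n.2) hG
    (fun n _ => (h.measurable_increment _ _ _).aemeasurable) (fun n n' hne _ _ => by
      rcases le_total n.1 n'.1 with hle | hle
      · exact h.covariance_increment_of_le hq hqm hne hle
      · rw [covariance_comm]
        exact h.covariance_increment_of_le hq hqm hne.symm hle)
  exact this.comp (fun _ x => x ()) fun _ => measurable_pi_apply _

theorem IsCavityField.integral_increment [IsProbabilityMeasure P] (h : IsCavityField q g κ P)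
    (l : ℕ) (hl : l < k + 1) (β : Fin l → ℕ) : ∫ ω, increment q κ l hl β ω ∂P = 0 := by
  cases l with
  | zero => exact h.centered _ _
  | succ l =>
    show ∫ ω, (nodeField q κ (l + 1) hl β ω - nodeField q κ l _ (Fin.init β) ω) ∂P = 0
    rw [integral_sub ((h.memLp_nodeField _ _ _).integrable (by norm_num))
      ((h.memLp_nodeField _ _ _).integrable (by norm_num))]
    unfold nodeField
    rw [h.centered, h.centered, sub_zero]

theorem IsCavityField.hasLaw_increment [IsProbabilityMeasure P] (h : IsCavityField q g κ P)
    {l : ℕ} (hl : l < k + 1) (β : Fin l → ℕ) {v : ℝ}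
    (hv : variance (increment q κ l hl β) P = v) :
    HasLaw (increment q κ l hl β) (gaussianReal 0 v.toNNReal) P := by
  refine ⟨(h.measurable_increment _ _ _).aemeasurable, ?_⟩
  have hG := h.isGaussianProcess_increment.hasGaussianLaw_eval ⟨⟨l, hl⟩, β⟩
  have := hG.map_eq_gaussianReal
  rwa [h.integral_increment, hv] at this

theorem IsCavityField.hasLaw_increment_zero [IsProbabilityMeasure P] (h : IsCavityField q g κ P)
    (hq : ∀ i, q i ∈ Icc (0 : ℝ) 1) (hqm : Monotone q) (β : Fin 0 → ℕ) :
    HasLaw (nodeField q κ 0 (Nat.succ_pos k) β) (gaussianReal 0 (g (q 0)).toNNReal) P := by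
  refine h.hasLaw_increment (Nat.succ_pos k) β ?_
  rw [← covariance_self (h.measurable_increment _ _ _).aemeasurable]
  show covariance (nodeField q κ 0 _ β) (nodeField q κ 0 _ β) P = _
  rw [h.covariance_nodeField hq, min_overlap_eq hqm (n := 0) _ _ le_rfl le_rfl
    (fun _ _ => rfl) (Or.inl rfl)]
  rfl

theorem IsCavityField.hasLaw_increment_succ [IsProbabilityMeasure P] (h : IsCavityField q g κ P)
    (hq : ∀ i, q i ∈ Icc (0 : ℝ) 1) (hqm : Monotone q) (l : Fin k) (β : Fin (l + 1 : ℕ) → ℕ) :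
    HasLaw (increment q κ (l + 1) l.succ.2 β)
      (gaussianReal 0 (g (q l.succ) - g (q l.castSucc)).toNNReal) P := by
  refine h.hasLaw_increment l.succ.2 β ?_
  have e : increment q κ (l + 1) l.succ.2 β = nodeField q κ (l + 1) l.succ.2 β
      - nodeField q κ l l.castSucc.2 (Fin.init β) := rfl
  -- A node and its parent have covariance `g` at the parent's atom, so the variance is `g(q_{l+1})
  -- - 2 g(q_l) + g(q_l)`.
  refine (congrArg (fun X => variance X P) e).trans ?_
  rw [variance_sub (h.memLp_nodeField _ _ _) (h.memLp_nodeField _ _ _),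
    ← covariance_self (h.measurable_nodeField _ _ _).aemeasurable,
    ← covariance_self (h.measurable_nodeField _ _ _).aemeasurable,
    h.covariance_nodeField hq, h.covariance_nodeField hq, h.covariance_nodeField hq,
    min_overlap_eq hqm (n := l + 1) _ _ le_rfl le_rfl (fun _ _ => rfl) (Or.inl rfl),
    min_overlap_eq hqm (n := l) _ _ le_rfl le_rfl (fun _ _ => rfl) (Or.inl rfl),
    min_overlap_eq hqm (n := l) _ _ (Nat.le_succ _) le_rfl (extendZero_init β)
      (Or.inr (Or.inl rfl))]
  simp only [Fin.castSucc, Fin.castAdd, Fin.castLE, Fin.succ]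
  ring

end Field

/-! ### Independence of the levels of the cascade -/

theorem iIndep_sumElim {Ω ι κ : Type*} {mΩ : MeasurableSpace Ω} {P : Measure Ω}
    {m₁ : ι → MeasurableSpace Ω} {m₂ : κ → MeasurableSpace Ω} (h₁ : iIndep m₁ P)
    (h₂ : iIndep m₂ P) (h : Indep (⨆ i, m₁ i) (⨆ j, m₂ j) P) : iIndep (Sum.elim m₁ m₂) P := by
  rw [iIndep_iff]
  intro s f hf
  have e : ⋂ i ∈ s, f i
      = (⋂ i ∈ s.toLeft, f (Sum.inl i)) ∩ ⋂ j ∈ s.toRight, f (Sum.inr j) := by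
    ext ω
    simp only [mem_iInter, mem_inter_iff, Finset.mem_toLeft, Finset.mem_toRight]
    exact ⟨fun H => ⟨fun i hi => H _ hi, fun j hj => H _ hj⟩,
      fun H i hi => match i, hi with
        | Sum.inl i, hi => H.1 i hi
        | Sum.inr j, hi => H.2 j hi⟩
  have hL : ∀ i ∈ s.toLeft, MeasurableSet[m₁ i] (f (Sum.inl i)) := fun i hi =>
    hf _ (Finset.mem_toLeft.1 hi)
  have hR : ∀ j ∈ s.toRight, MeasurableSet[m₂ j] (f (Sum.inr j)) := fun j hj =>
    hf _ (Finset.mem_toRight.1 hj)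
  rw [e, (Indep_iff _ _ _).1 h _ _
    (Finset.measurableSet_biInter _ fun i hi => le_iSup m₁ i _ (hL i hi))
    (Finset.measurableSet_biInter _ fun j hj => le_iSup m₂ j _ (hR j hj)),
    h₁.meas_biInter hL, h₂.meas_biInter hR]
  conv_rhs => rw [← Finset.toLeft_disjSum_toRight (u := s), Finset.prod_disjSum]

theorem measurable_pi_of {Ω ι : Type*} {E : ι → Type*} {m : MeasurableSpace Ω}
    [∀ i, MeasurableSpace (E i)] {f : Ω → ∀ i, E i} (h : ∀ i, Measurable[m] fun ω => f ω i) :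
    Measurable[m] f := measurable_pi_iff.2 h

theorem measurable_apply_of {Ω ι : Type*} {E : ι → Type*} {m : MeasurableSpace Ω}
    [∀ i, MeasurableSpace (E i)] {f : Ω → ∀ i, E i} (h : Measurable[m] f) (i : ι) :
    Measurable[m] fun ω => f ω i := measurable_pi_iff.1 h i

theorem indepFun_of_measurable_iSup {Ω J E F : Type*} {mΩ : MeasurableSpace Ω} {P : Measure Ω}
    [MeasurableSpace E] [MeasurableSpace F] {m : J → MeasurableSpace Ω} (hle : ∀ i, m i ≤ mΩ)
    (h : iIndep m P) {S T : Set J} (hST : Disjoint S T) {A : Ω → E} {X : Ω → F}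
    (hA : Measurable[⨆ i ∈ S, m i] A) (hX : Measurable[⨆ i ∈ T, m i] X) : IndepFun A X P := by
  rw [IndepFun_iff_Indep]
  exact indep_of_indep_of_le_left (indep_of_indep_of_le_right
    (indep_iSup_of_disjoint hle h hST) hX.comap_le) hA.comap_le

/-- The product of the points of the cascade along the path to a node of level `l`. -/
def cascadeWeight {Ω : Type*} {k : ℕ} (ζ : (l : Fin k) → (Fin (l : ℕ) → ℕ) → ℕ → Ω → ℝ) :
    (l : ℕ) → l < k + 1 → (Fin l → ℕ) → Ω → ℝ≥0∞
  | 0, _, _, _ => 1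
  | l + 1, hl, β, ω => cascadeWeight ζ l ((Nat.lt_succ_self l).trans hl) (Fin.init β) ω
      * ENNReal.ofReal (ζ ⟨l, Nat.lt_of_succ_lt_succ hl⟩ (Fin.init β) (β (Fin.last l)) ω)

theorem cascadeWeight_ne_top {Ω : Type*} {k : ℕ}
    (ζ : (l : Fin k) → (Fin (l : ℕ) → ℕ) → ℕ → Ω → ℝ) (l : ℕ) (hl : l < k + 1) (β : Fin l → ℕ)
    (ω : Ω) : cascadeWeight ζ l hl β ω ≠ ∞ := by
  induction l with
  | zero => simp [cascadeWeight]
  | succ l ih => exact ENNReal.mul_ne_top (ih _ _) ENNReal.ofReal_ne_top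

theorem cascadeWeight_eq_ofReal_weight {Ω : Type*} {k : ℕ}
    {ζ : (l : Fin k) → (Fin (l : ℕ) → ℕ) → ℕ → Ω → ℝ} {ω : Ω} (hpos : ∀ l β j, 0 < ζ l β j ω)
    (α : Fin k → ℕ) :
    cascadeWeight ζ k (Nat.lt_succ_self k) α ω = ENNReal.ofReal (weight ζ α ω) := by
  have key : ∀ (l : ℕ) (hl : l < k + 1),
      cascadeWeight ζ l hl (fun i => α (Fin.castLE (Nat.lt_succ_iff.1 hl) i)) ω
        = ∏ i : Fin l, ENNReal.ofReal (ζ (Fin.castLE (Nat.lt_succ_iff.1 hl) i)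
            (trunc α (Fin.castLE (Nat.lt_succ_iff.1 hl) i))
            (α (Fin.castLE (Nat.lt_succ_iff.1 hl) i)) ω) := by
    intro l
    induction l with
    | zero => intro hl; simp [cascadeWeight]
    | succ l ih =>
      intro hl
      rw [Fin.prod_univ_castSucc]
      exact congrArg (· * _) (ih _)
  have := key k (Nat.lt_succ_self k)
  rw [weight, ENNReal.ofReal_prod_of_nonneg fun i _ => (hpos _ _ _).le]
  exact this

section Levels

variable {Ω : Type*} {k : ℕ}
  {q : Fin (k + 1) → ℝ} {g : ℝ → ℝ} {ζ : (l : Fin k) → (Fin (l : ℕ) → ℕ) → ℕ → Ω → ℝ}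
  {κ : (Fin k → ℕ) → unitInterval → Ω → ℝ}

/-- The σ-algebras generated by the point processes and by the increments of the field. -/
abbrev nodeSigma (q : Fin (k + 1) → ℝ) (ζ : (l : Fin k) → (Fin (l : ℕ) → ℕ) → ℕ → Ω → ℝ)
    (κ : (Fin k → ℕ) → unitInterval → Ω → ℝ) : Node k ⊕ Node (k + 1) → MeasurableSpace Ω :=
  Sum.elim (fun n => MeasurableSpace.pi.comap fun ω j => ζ n.1 n.2 j ω)
    (fun n => Real.measurableSpace.comap (increment q κ n.1 n.1.2 n.2))

theorem measurable_nodeSigma_point {S : Set (Node k ⊕ Node (k + 1))} {l : Fin k}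
    {β : Fin (l : ℕ) → ℕ} (h : Sum.inl ⟨l, β⟩ ∈ S) (j : ℕ) :
    Measurable[⨆ i ∈ S, nodeSigma q ζ κ i] (ζ l β j) := by
  have h1 : Measurable[nodeSigma q ζ κ (Sum.inl ⟨l, β⟩)] fun ω j => ζ l β j ω :=
    comap_measurable _
  exact (measurable_pi_apply j).comp (h1.mono (le_biSup (nodeSigma q ζ κ) h) le_rfl)

theorem measurable_nodeSigma_increment {S : Set (Node k ⊕ Node (k + 1))} {l : ℕ}
    {hl : l < k + 1} {β : Fin l → ℕ} (h : Sum.inr ⟨⟨l, hl⟩, β⟩ ∈ S) :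
    Measurable[⨆ i ∈ S, nodeSigma q ζ κ i] (increment q κ l hl β) := by
  have h1 : Measurable[nodeSigma q ζ κ (Sum.inr ⟨⟨l, hl⟩, β⟩)] (increment q κ l hl β) :=
    comap_measurable _
  exact h1.mono (le_biSup (nodeSigma q ζ κ) h) le_rfl

theorem measurable_nodeSigma_cascadeWeight {S : Set (Node k ⊕ Node (k + 1))} (l : ℕ)
    (hl : l < k + 1) (h : ∀ n : Node k, (n.1 : ℕ) < l → Sum.inl n ∈ S) (β : Fin l → ℕ) :
    Measurable[⨆ i ∈ S, nodeSigma q ζ κ i] (cascadeWeight ζ l hl β) := by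
  induction l with
  | zero => exact measurable_const
  | succ l ih =>
    refine Measurable.mul (ih _ (fun n hn => h n (hn.trans l.lt_succ_self)) _)
      (ENNReal.measurable_ofReal.comp (measurable_nodeSigma_point (h ⟨⟨l, _⟩, _⟩ ?_) _))
    exact l.lt_succ_self

theorem measurable_nodeSigma_nodeField {S : Set (Node k ⊕ Node (k + 1))} (l : ℕ)
    (hl : l < k + 1) (h : ∀ n : Node (k + 1), (n.1 : ℕ) ≤ l → Sum.inr n ∈ S) (β : Fin l → ℕ) :
    Measurable[⨆ i ∈ S, nodeSigma q ζ κ i] (nodeField q κ l hl β) := by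
  induction l with
  | zero => exact measurable_nodeSigma_increment (l := 0) (hl := hl) (h ⟨⟨0, hl⟩, β⟩ le_rfl)
  | succ l ih =>
    have e : nodeField q κ (l + 1) hl β = fun ω =>
        nodeField q κ l ((Nat.lt_succ_self l).trans hl) (Fin.init β) ω
          + increment q κ (l + 1) hl β ω := by
      ext ω; simp [increment]
    rw [e]
    exact Measurable.add (ih _ (fun n hn => h n (hn.trans l.le_succ)) _)
      (measurable_nodeSigma_increment (h ⟨⟨l + 1, hl⟩, β⟩ le_rfl))

variable [MeasurableSpace Ω] {P : Measure Ω} {μ : Measure ℝ}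

theorem IsGREMWithField.nodeSigma_le (H : IsGREMWithField μ q g ζ κ P)
    (i : Node k ⊕ Node (k + 1)) : nodeSigma q ζ κ i ≤ ‹MeasurableSpace Ω› := by
  cases i with
  | inl n =>
    exact (measurable_pi_iff.2 fun j => (H.cascade.isREM n.1 n.2).poisson.measurable j).comap_le
  | inr n => exact (H.field.measurable_increment _ _ _).comap_le

/-- Three independences are glued: among the point processes, among the increments, and between
cascade and field. Afterwards, independence of past and next level is a matter of disjoint index
sets. -/
theorem IsGREMWithField.iIndep_nodeSigma [IsProbabilityMeasure P]
    (H : IsGREMWithField μ q g ζ κ P) (hμ : IsAtomicWithTop μ q) :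
    iIndep (nodeSigma q ζ κ) P := by
  refine iIndep_sumElim H.cascade.indep
    (H.field.iIndepFun_increment hμ.mem_Icc hμ.strictMono.monotone) ?_
  -- The canonical field on path space: it exhibits all increments as one measurable function of
  -- `κ`, to which the independence from the cascade transfers.
  let κ' : (Fin k → ℕ) → unitInterval → ((Fin k → ℕ) × unitInterval → ℝ) → ℝ :=
    fun α r x => x (α, r)
  have hκ' : Measurable fun x (n : Node (k + 1)) => increment q κ' n.1 n.1.2 n.2 x := by
    refine measurable_pi_iff.2 fun ⟨⟨l, hl⟩, β⟩ => ?_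
    cases l with
    | zero => exact measurable_pi_apply _
    | succ l => exact (measurable_pi_apply _).sub (measurable_pi_apply _)
  have hind := H.indep.comp measurable_id hκ'
  rw [IndepFun_iff_Indep] at hind
  refine indep_of_indep_of_le_left (indep_of_indep_of_le_right hind ?_) ?_
  · refine iSup_le fun n => Measurable.comap_le ?_
    have e : increment q κ n.1 n.1.2 n.2
        = fun ω => increment q κ' n.1 n.1.2 n.2 fun p => κ p.1 p.2 ω := by
      obtain ⟨⟨l, hl⟩, β⟩ := n
      cases l <;> rfl
    rw [e]
    exact measurable_apply_of (comap_measurable ((fun x (n : Node (k + 1)) =>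
      increment q κ' n.1 n.1.2 n.2 x) ∘ fun ω p => κ p.1 p.2 ω)) n
  · refine iSup_le fun n => Measurable.comap_le ?_
    exact measurable_apply_of (comap_measurable (id ∘ fun ω (n : Node k) j => ζ n.1 n.2 j ω)) n

theorem IsGREMWithField.measurable_cascadeWeight (H : IsGREMWithField μ q g ζ κ P) (l : ℕ)
    (hl : l < k + 1) (β : Fin l → ℕ) : Measurable (cascadeWeight ζ l hl β) :=
  (measurable_nodeSigma_cascadeWeight (q := q) (κ := κ) (S := univ) l hl
    (fun _ _ => mem_univ _) β).mono (iSup₂_le fun i _ => H.nodeSigma_le i) le_rfl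

theorem tsum_snoc {l : ℕ} (F : (Fin (l + 1) → ℕ) → ℝ≥0∞) :
    ∑' β, F β = ∑' n : (Fin l → ℕ) × ℕ, F (Fin.snoc (α := fun _ => ℕ) n.1 n.2) :=
  ((((Equiv.prodComm _ _).trans (Fin.snocEquiv fun _ : Fin (l + 1) => ℕ))).tsum_eq F).symm

/-- The sum over the nodes of level `l`, integrated out from below. -/
def levelSum (μ : Measure ℝ) (q : Fin (k + 1) → ℝ)
    (ζ : (l : Fin k) → (Fin (l : ℕ) → ℕ) → ℕ → Ω → ℝ) (κ : (Fin k → ℕ) → unitInterval → Ω → ℝ)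
    (φ : ℝ → ℝ) (i : Fin (k + 1)) (ω : Ω) : ℝ≥0∞ :=
  ∑' β : Fin (i : ℕ) → ℕ, cascadeWeight ζ i i.2 β ω ^ (cdf μ (q i) : ℝ)
    * ENNReal.ofReal (Real.exp (cdf μ (q i) * φ (nodeField q κ i i.2 β ω)))

theorem IsGREMWithField.lintegral_expNeg_levelSum_succ [IsProbabilityMeasure P]
    (H : IsGREMWithField μ q g ζ κ P) (hμ : IsAtomicWithTop μ q) (l : Fin k) {φ φ' : ℝ → ℝ}
    (hφ : Measurable φ)
    (hφ' : ∀ y, ∫⁻ z, ENNReal.ofReal (Real.exp (cdf μ (q l.castSucc) * φ (y + z)))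
      ∂(gaussianReal 0 (g (q l.succ) - g (q l.castSucc)).toNNReal)
      = ENNReal.ofReal (Real.exp (cdf μ (q l.castSucc) * φ' y))) {c : ℝ≥0∞} (hc : c ≠ ∞) :
    ∫⁻ ω, expNeg (c * levelSum μ q ζ κ φ l.succ ω) ∂P
      = ∫⁻ ω, expNeg (stableConst (cdf μ (q l.castSucc)) (cdf μ (q l.succ))
          * c ^ (cdf μ (q l.castSucc) / cdf μ (q l.succ))
          * levelSum μ q ζ κ φ' l.castSucc ω) ∂P := by
  have hl : (l : ℕ) < k + 1 := l.castSucc.2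
  have hl' : (l : ℕ) + 1 < k + 1 := l.succ.2
  have hInd := H.iIndep_nodeSigma hμ
  have hle := H.nodeSigma_le
  let D : (Fin (l : ℕ) → ℕ) × ℕ → Ω → ℝ := fun n =>
    increment q κ (l + 1) hl' (Fin.snoc (α := fun _ => ℕ) n.1 n.2)
  let ι : (Fin (l : ℕ) → ℕ) × ℕ → Node (k + 1) := fun n =>
    ⟨⟨l + 1, hl'⟩, Fin.snoc (α := fun _ => ℕ) n.1 n.2⟩
  have hι : Function.Injective ι := fun a b hab => by
    have h1 : Fin.snoc (α := fun _ => ℕ) a.1 a.2 = Fin.snoc (α := fun _ => ℕ) b.1 b.2 :=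
      eq_of_heq (Sigma.mk.inj hab).2
    exact Prod.ext (by simpa using congrArg Fin.init h1)
      (by simpa using congrFun h1 (Fin.last _))
  have hDind : iIndepFun D P :=
    (H.field.iIndepFun_increment hμ.mem_Icc hμ.strictMono.monotone).precomp hι
  have hζind : iIndepFun (fun (i : Fin (l : ℕ) → ℕ) ω j => ζ l i j ω) P := by
    have hinj : Function.Injective fun i : Fin (l : ℕ) → ℕ => (⟨l, i⟩ : Node k) :=
      fun a b hab => eq_of_heq (Sigma.mk.inj hab).2
    exact H.cascade.indep.precomp hinj
  have hDpast : IndepFun (fun ω (i : Fin (l : ℕ) → ℕ) =>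
      ((cascadeWeight ζ l hl i ω, nodeField q κ l hl i ω), fun j => ζ l i j ω))
      (fun ω n => D n ω) P := by
    -- Past: all point processes and the increments up to level `l`. New: the increments of level `l
    -- + 1`.
    refine indepFun_of_measurable_iSup hle hInd
      (S := range Sum.inl ∪ Sum.inr '' {n | (n.1 : ℕ) ≤ l})
      (T := Sum.inr '' {n | (n.1 : ℕ) = l + 1}) ?_ ?_ ?_
    · refine Set.disjoint_left.2 ?_
      rintro _ (⟨n, rfl⟩ | ⟨n, hn, rfl⟩) ⟨n', hn', h⟩
      · simp at h
      · obtain rfl := Sum.inr_injective h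
        simp only [mem_ofPred_eq] at hn hn'
        omega
    · refine measurable_pi_of fun i => Measurable.prodMk (Measurable.prodMk ?_ ?_)
        (measurable_pi_of fun j => measurable_nodeSigma_point (Or.inl ⟨_, rfl⟩) j)
      · exact measurable_nodeSigma_cascadeWeight l hl (fun n _ => Or.inl ⟨n, rfl⟩) i
      · exact measurable_nodeSigma_nodeField l hl (fun n hn => Or.inr ⟨n, hn, rfl⟩) i
    · exact measurable_pi_of fun n => measurable_nodeSigma_increment ⟨ι n, rfl, rfl⟩
  have hζpast : IndepFun (fun ω (i : Fin (l : ℕ) → ℕ) =>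
      (cascadeWeight ζ l hl i ω, nodeField q κ l hl i ω)) (fun ω i j => ζ l i j ω) P := by
    -- Past: the point processes strictly above level `l` in the tree and all increments. New: the
    -- point processes attached to the nodes of level `l`.
    refine indepFun_of_measurable_iSup hle hInd
      (S := Sum.inl '' {n | (n.1 : ℕ) < l} ∪ range Sum.inr)
      (T := Sum.inl '' {n | n.1 = l}) ?_ ?_ ?_
    · refine Set.disjoint_left.2 ?_
      rintro _ (⟨n, hn, rfl⟩ | ⟨n, rfl⟩) ⟨n', hn', h⟩
      · obtain rfl := Sum.inl_injective h
        simp only [mem_ofPred_eq] at hn hn'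
        rw [hn'] at hn
        exact lt_irrefl _ hn
      · simp at h
    · refine measurable_pi_of fun i => Measurable.prodMk ?_ ?_
      · exact measurable_nodeSigma_cascadeWeight l hl (fun n hn => Or.inl ⟨n, hn, rfl⟩) i
      · exact measurable_nodeSigma_nodeField l hl (fun n _ => Or.inr ⟨n, rfl⟩) i
    · exact measurable_pi_of fun i => measurable_pi_of fun j =>
        measurable_nodeSigma_point
          (mem_image_of_mem Sum.inl (show (⟨l, i⟩ : Node k) ∈ {n : Node k | n.1 = l} from rfl)) j
  have key := lintegral_expNeg_cascade_level (P := P) (w := fun i => cascadeWeight ζ l hl i)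
    (y := fun i => nodeField q κ l hl i) (ζ := fun i => ζ l i) (D := D)
    (hμ.cdf_pos l.castSucc) (hμ.cdf_strictMono l.castSucc_lt_succ)
    (fun i => H.measurable_cascadeWeight _ _ _) (fun i ω => cascadeWeight_ne_top ζ _ _ _ ω)
    (fun i => H.field.measurable_nodeField _ _ _)
    (fun n => H.field.hasLaw_increment_succ hμ.mem_Icc hμ.strictMono.monotone l _)
    (fun n => H.field.measurable_increment _ _ _) hDind hDpast
    (fun i => H.cascade.isREM l i) hζind hζpast hφ hφ' hc
  refine Eq.trans (lintegral_congr fun ω => ?_) key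
  congr 2
  refine (tsum_snoc (l := l) _).trans (tsum_congr fun n => ?_)
  have e1 : cascadeWeight ζ (l + 1) hl' (Fin.snoc (α := fun _ => ℕ) n.1 n.2) ω
      = cascadeWeight ζ l hl n.1 ω * ENNReal.ofReal (ζ l n.1 n.2 ω) := by
    simp [cascadeWeight]
  have e2 : nodeField q κ (l + 1) hl' (Fin.snoc (α := fun _ => ℕ) n.1 n.2) ω
      = nodeField q κ l hl n.1 ω + D n ω := by
    simp [D, increment]
  exact congrArg₂ (fun a b => a ^ (cdf μ (q l.succ) : ℝ)
    * ENNReal.ofReal (Real.exp (cdf μ (q l.succ) * φ b))) e1 e2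

end Levels

/-! ### The Parisi functional on the cascade -/

theorem IsAdmissible.boundedDerivs {ψ : ℝ → ℝ} (h : IsAdmissible ψ) :
    ∃ K₁ K₂, BoundedDerivs ψ K₁ K₂ := by
  obtain ⟨K₁, h₁⟩ := h.deriv_bounded
  obtain ⟨K₂, h₂⟩ := h.deriv_deriv_bounded
  exact ⟨K₁, K₂, h.contDiff, h₁, h₂⟩

section Recursion

variable {Ω : Type*} {μ : Measure ℝ} {k : ℕ} {q : Fin (k + 1) → ℝ} {g : ℝ → ℝ}
  {ζ : (l : Fin k) → (Fin (l : ℕ) → ℕ) → ℕ → Ω → ℝ} {κ : (Fin k → ℕ) → unitInterval → Ω → ℝ}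

/-- The functions `φ i` on the levels are related by the Hopf–Cole recursion. -/
structure IsLevelRecursion (μ : Measure ℝ) (q : Fin (k + 1) → ℝ) (g : ℝ → ℝ)
    (φ : Fin (k + 1) → ℝ → ℝ) : Prop where
  measurable : ∀ i, Measurable (φ i)
  lintegral_exp : ∀ (l : Fin k) (y : ℝ),
    ∫⁻ z, ENNReal.ofReal (Real.exp (cdf μ (q l.castSucc) * φ l.succ (y + z)))
      ∂(gaussianReal 0 (g (q l.succ) - g (q l.castSucc)).toNNReal)
      = ENNReal.ofReal (Real.exp (cdf μ (q l.castSucc) * φ l.castSucc y))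

theorem isLevelRecursion_zero : IsLevelRecursion μ q g fun _ _ => 0 :=
  ⟨fun _ => measurable_const, fun _ _ => by simp⟩

theorem levelSum_zero (φ : ℝ → ℝ) (ω : Ω) : levelSum μ q ζ κ φ 0 ω
    = ENNReal.ofReal (Real.exp (cdf μ (q 0) * φ (nodeField q κ 0 (Nat.succ_pos k) default ω))) := by
  unfold levelSum
  rw [tsum_eq_single (default : Fin ((0 : Fin (k + 1)) : ℕ) → ℕ)
    fun β hβ => absurd (Subsingleton.elim (α := Fin 0 → ℕ) β _) hβ]
  have : cascadeWeight ζ ((0 : Fin (k + 1)) : ℕ) (0 : Fin (k + 1)).2 default ω = 1 := rfl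
  rw [this, ENNReal.one_rpow, one_mul]
  rfl

theorem levelSum_last (hμ : IsAtomicWithTop μ q) (φ : ℝ → ℝ) {ω : Ω}
    (hpos : ∀ l β j, 0 < ζ l β j ω) : levelSum μ q ζ κ φ (Fin.last k) ω
    = ∑' α, ENNReal.ofReal (weight ζ α ω * Real.exp (φ (κ α 1 ω))) := by
  unfold levelSum
  refine tsum_congr fun α : Fin k → ℕ => ?_
  have hw : 0 ≤ weight ζ α ω := Finset.prod_nonneg fun i _ => (hpos _ _ _).le
  have e : nodeField q κ k (Nat.lt_succ_self k) α ω = κ α 1 ω := by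
    have h1 : q ⟨k, Nat.lt_succ_self k⟩ = 1 := hμ.last_eq_one
    rw [nodeField, extendZero_self, h1, projIcc_right]
    rfl
  rw [hμ.cdf_last, ENNReal.rpow_one, one_mul, ENNReal.ofReal_mul hw,
    ← cascadeWeight_eq_ofReal_weight hpos α, ← e]
  rfl

variable [MeasurableSpace Ω] {P : Measure Ω}

/-- The order of quantifiers matters: `c` is chosen before `φ`, so the numerator and the denominator
of the ratio share the same constant and it cancels. -/
theorem IsGREMWithField.exists_lintegral_expNeg_levelSum [IsProbabilityMeasure P]
    (H : IsGREMWithField μ q g ζ κ P)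
    (hμ : IsAtomicWithTop μ q) (i : Fin (k + 1)) :
    ∃ c : ℝ≥0∞, c ≠ 0 ∧ c ≠ ∞ ∧ ∀ φ, IsLevelRecursion μ q g φ → ∀ t : ℝ≥0∞, t ≠ ∞ →
      ∫⁻ ω, expNeg (t * levelSum μ q ζ κ (φ (Fin.last k)) (Fin.last k) ω) ∂P
        = ∫⁻ ω, expNeg (c * t ^ (cdf μ (q i) : ℝ) * levelSum μ q ζ κ (φ i) i ω) ∂P := by
  induction i using Fin.reverseInduction with
  | last => exact ⟨1, one_ne_zero, ENNReal.one_ne_top, fun φ _ t _ => by simp [hμ.cdf_last]⟩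
  | cast l ih =>
    obtain ⟨c, hc0, hc, h⟩ := ih
    have hm := hμ.cdf_pos l.castSucc
    have hp := hμ.cdf_pos l.succ
    have hmp := hμ.cdf_strictMono l.castSucc_lt_succ
    have hdiv : 0 ≤ cdf μ (q l.castSucc) / cdf μ (q l.succ) := (div_pos hm hp).le
    refine ⟨stableConst (cdf μ (q l.castSucc)) (cdf μ (q l.succ))
      * c ^ (cdf μ (q l.castSucc) / cdf μ (q l.succ)), ?_, ?_, fun φ hφ t ht => ?_⟩
    · exact mul_ne_zero (stableConst_pos hm _).ne' (ENNReal.rpow_pos hc0.bot_lt hc).ne'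
    · exact ENNReal.mul_ne_top (stableConst_lt_top hm hmp).ne
        (ENNReal.rpow_ne_top_of_nonneg hdiv hc)
    · rw [h φ hφ t ht, H.lintegral_expNeg_levelSum_succ hμ l (hφ.measurable _)
        (hφ.lintegral_exp l) (ENNReal.mul_ne_top hc (ENNReal.rpow_ne_top_of_nonneg hp.le ht)),
        ENNReal.mul_rpow_of_nonneg _ _ hdiv, ← ENNReal.rpow_mul, mul_div_cancel₀ _ hp.ne',
        mul_assoc (stableConst _ _)]

theorem IsGREMWithField.measurable_levelSum (H : IsGREMWithField μ q g ζ κ P) {φ : ℝ → ℝ}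
    (hφ : Measurable φ) (i : Fin (k + 1)) : Measurable (levelSum μ q ζ κ φ i) := by
  refine Measurable.tsum fun β => Measurable.mul ?_ ?_
  · exact (H.measurable_cascadeWeight _ _ β).pow_const _
  · exact ENNReal.measurable_ofReal.comp (Real.measurable_exp.comp
      ((hφ.comp (H.field.measurable_nodeField _ _ β)).const_mul _))

theorem IsGREMWithField.ae_pos (H : IsGREMWithField μ q g ζ κ P) :
    ∀ᵐ ω ∂P, ∀ l β j, 0 < ζ l β j ω :=
  ae_all_iff.2 fun l => ae_all_iff.2 fun β => (H.cascade.isREM l β).pos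

/-- The zero functions also satisfy the recursion, and their leaf sum is `∑ ξ_α`. At the root the
single level sum is `e^{pF}`, which puts the pair of sums in the form required by
`integral_log_sub_of_laplace`. -/
theorem IsGREMWithField.integral_logRatio [IsProbabilityMeasure P]
    (H : IsGREMWithField μ q g ζ κ P)
    (hμ : IsAtomicWithTop μ q) {φ : Fin (k + 1) → ℝ → ℝ} (hφ : IsLevelRecursion μ q g φ)
    (hint : Integrable (fun ω => φ 0 (nodeField q κ 0 (Nat.succ_pos k) default ω)) P) :
    (∀ᵐ ω ∂P, Summable (fun α => weight ζ α ω) ∧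
      Summable (fun α => weight ζ α ω * Real.exp (φ (Fin.last k) (κ α 1 ω)))) ∧
    Integrable (logRatio (φ (Fin.last k)) ζ κ) P ∧
    ∫ ω, logRatio (φ (Fin.last k)) ζ κ ω ∂P
      = ∫ ω, φ 0 (nodeField q κ 0 (Nat.succ_pos k) default ω) ∂P := by
  obtain ⟨c, hc0, hc, hlap⟩ := H.exists_lintegral_expNeg_levelSum hμ 0
  obtain ⟨hT, hS, hI, hE⟩ := integral_log_sub_of_laplace (P := P)
    (S := levelSum μ q ζ κ (φ (Fin.last k)) (Fin.last k))
    (T := levelSum μ q ζ κ (fun _ => 0) (Fin.last k))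
    (F := fun ω => φ 0 (nodeField q κ 0 (Nat.succ_pos k) default ω))
    (H.measurable_levelSum (hφ.measurable _) _) (H.measurable_levelSum measurable_const _)
    ((hφ.measurable 0).comp (H.field.measurable_nodeField _ _ _)) hint hc0 hc (hμ.cdf_pos 0)
    (fun t ht => by
      rw [hlap _ isLevelRecursion_zero t ht]
      simp [levelSum_zero])
    (fun t ht => by
      rw [hlap φ hφ t ht]
      simp_rw [levelSum_zero])
  have hsum : ∀ {φ : ℝ → ℝ} {ω : Ω}, (∀ l β j, 0 < ζ l β j ω) →
      levelSum μ q ζ κ φ (Fin.last k) ω ≠ ∞ →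
      Summable (fun α => weight ζ α ω * Real.exp (φ (κ α 1 ω))) ∧
      (levelSum μ q ζ κ φ (Fin.last k) ω).toReal
        = ∑' α, weight ζ α ω * Real.exp (φ (κ α 1 ω)) := by
    intro φ ω hpos hfin
    rw [levelSum_last hμ φ hpos] at hfin ⊢
    have hw : ∀ α, 0 ≤ weight ζ α ω * Real.exp (φ (κ α 1 ω)) := fun α =>
      mul_nonneg (Finset.prod_nonneg fun i _ => (hpos _ _ _).le) (Real.exp_pos _).le
    have h1 := ENNReal.summable_toReal hfin
    simp_rw [ENNReal.toReal_ofReal (hw _)] at h1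
    rw [ENNReal.tsum_toReal_eq fun α => ENNReal.ofReal_ne_top]
    simp_rw [ENNReal.toReal_ofReal (hw _)]
    exact ⟨h1, trivial⟩
  have hlog : (fun ω => Real.log (levelSum μ q ζ κ (φ (Fin.last k)) (Fin.last k) ω).toReal
      - Real.log (levelSum μ q ζ κ (fun _ => 0) (Fin.last k) ω).toReal)
      =ᵐ[P] logRatio (φ (Fin.last k)) ζ κ := by
    filter_upwards [H.ae_pos, hT, hS] with ω hpos hTω hSω
    have h1 := (hsum hpos hSω.2).2
    have h2 := (hsum hpos hTω.2).2
    simp only [Real.exp_zero, mul_one] at h2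
    rw [← Real.log_div (ENNReal.toReal_pos hSω.1 hSω.2).ne' (ENNReal.toReal_pos hTω.1 hTω.2).ne',
      h1, h2, logRatio]
  refine ⟨?_, hI.congr hlog, (integral_congr_ae hlog).symm.trans hE⟩
  filter_upwards [H.ae_pos, hT, hS] with ω hpos hTω hSω
  have h2 := (hsum hpos hTω.2).1
  simp only [Real.exp_zero, mul_one] at h2
  exact ⟨h2, (hsum hpos hSω.2).1⟩

end Recursion

theorem isLevelRecursion_of_hopfCole {μ : Measure ℝ} {k : ℕ} {q : Fin (k + 1) → ℝ}
    (hμ : IsAtomicWithTop μ q) {g : ℝ → ℝ} (hg_mono : StrictMonoOn g (Icc 0 1))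
    {φ : Fin (k + 1) → ℝ → ℝ} {K₁ K₂ : ℝ} (hφ : ∀ i, BoundedDerivs (φ i) K₁ K₂)
    (h : ∀ l : Fin k, φ l.castSucc = hopfCole (cdf μ (q l.castSucc)) (φ l.succ)
      (g (q l.succ) - g (q l.castSucc))) : IsLevelRecursion μ q g φ := by
  refine ⟨fun i => (hφ i).contDiff.continuous.measurable, fun l y => ?_⟩
  have hv : 0 ≤ g (q l.succ) - g (q l.castSucc) := sub_nonneg.2
    (hg_mono.monotoneOn (hμ.mem_Icc _) (hμ.mem_Icc _) (hμ.strictMono l.castSucc_lt_succ).le)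
  rw [lintegral_exp_hopfCole (hφ l.succ) (hμ.cdf_pos _), Real.coe_toNNReal _ hv, h l]

end RuelleCascade

end

/-! ### Combining the solution of the equation with the cascade computation -/

theorem mainTheorem1 (μ : Measure ℝ) (k : ℕ) (q : Fin (k + 1) → ℝ)
    (hμ : RuelleCascade.IsAtomicWithTop μ q)
    (g : ℝ → ℝ) (hg : ContDiffOn ℝ 1 g (Icc 0 1)) (hg_mono : StrictMonoOn g (Icc 0 1))
    (hg0 : g 0 = 0)
    (ψ : ℝ → ℝ) (hψ : RuelleCascade.IsAdmissible ψ) :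
    ∃ f : ℝ → ℝ → ℝ,
      RuelleCascade.IsParisiSolution μ g ψ f ∧
      (∀ h : ℝ → ℝ → ℝ, RuelleCascade.IsParisiSolution μ g ψ h →
        ∀ r ∈ Icc (0 : ℝ) 1, ∀ y, h r y = f r y) ∧
      ∀ (Ω : Type*) [MeasurableSpace Ω] (P : Measure Ω) [IsProbabilityMeasure P]
        (ζ : (l : Fin k) → (Fin (l : ℕ) → ℕ) → ℕ → Ω → ℝ)
        (κ : (Fin k → ℕ) → unitInterval → Ω → ℝ),
        RuelleCascade.IsGREMWithField μ q g ζ κ P →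
        (∀ᵐ ω ∂P, Summable (fun α => RuelleCascade.weight ζ α ω) ∧
          Summable (fun α => RuelleCascade.weight ζ α ω * Real.exp (ψ (κ α 1 ω)))) ∧
        Integrable (RuelleCascade.logRatio ψ ζ κ) P ∧
        ∫ ω, RuelleCascade.logRatio ψ ζ κ ω ∂P = f 0 0 := by
  obtain ⟨K₁, K₂, hK⟩ := hψ.boundedDerivs
  obtain ⟨f, hf, hrec, hf0⟩ := RuelleCascade.exists_isParisiSolution hμ hg hg_mono hK
  refine ⟨f, hf, fun h hh r hr y => congrFun (hh.eq hμ hg hg_mono hf hr) y, ?_⟩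
  intro Ω _ P _ ζ κ H
  obtain ⟨L₁, L₂, hL⟩ := hf.solvesFrom.boundedDerivs
  have hφ : RuelleCascade.IsLevelRecursion μ q g fun i => f (q i) :=
    RuelleCascade.isLevelRecursion_of_hopfCole hμ hg_mono (fun i => hL _ (hμ.mem_Icc i)) hrec
  have h0 := hL _ (hμ.mem_Icc 0)
  have hY := H.field.memLp_nodeField 0 (Nat.succ_pos k) default
  -- `f (q 0)` is Lipschitz, so it grows at most linearly and is integrable against the Gaussian
  -- root value.
  have hint : Integrable
      (fun ω => f (q 0) (RuelleCascade.nodeField q κ 0 (Nat.succ_pos k) default ω)) P :=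
    ((integrable_const |f (q 0) 0|).add
      ((hY.integrable (by norm_num)).abs.const_mul L₁)).mono'
      (h0.contDiff.continuous.comp_aestronglyMeasurable hY.1) (ae_of_all _ fun ω => h0.abs_le _)
  have hlast : f (q (Fin.last k)) = ψ := by rw [hμ.last_eq_one, hf.solvesFrom.boundary]
  obtain ⟨h1, h2, h3⟩ := H.integral_logRatio hμ hφ hint
  simp only [hlast] at h1 h2 h3
  refine ⟨h1, h2, h3.trans ?_⟩
  have hg0' : 0 ≤ g (q 0) := by
    rw [← hg0]
    exact hg_mono.monotoneOn (by simp) (hμ.mem_Icc 0) (hμ.mem_Icc 0).1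
  have hlaw := H.field.hasLaw_increment_zero hμ.mem_Icc hμ.strictMono.monotone default
  have hE := hlaw.integral_comp (f := f (q 0)) h0.contDiff.continuous.aestronglyMeasurable
  have hheat := RuelleCascade.heat_eq_integral (f (q 0)) (g (q 0)).toNNReal 0
  rw [Real.coe_toNNReal _ hg0'] at hheat
  simp only [zero_add] at hheat
  -- Since `g 0 = 0`, the heat step from `q 0` down to `0` has variance `g (q 0)`, exactly that of
  -- the root value of the field.
  rw [hf0, hg0, sub_zero, RuelleCascade.hopfCole, if_pos rfl, hheat]
  exact hE
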